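/- Let $C_m\subset\mathbb{R}P^2$ be the real part of a non-singular real algebraic plane curve of odd degree $m$. Its components are embedded circles: one pseudo-line $\mathcal J$ (not null-homotopic) and ovals (null-homotopic); the interior of an oval is the component of its complement that is an open disc. Assume that exactly one oval $O$ is non-empty, i.e. contains another oval in its interior, and call the ovals inside $O$ the interior ovals. Choose one point in the interior of each interior oval, so that the chosen points do not all lie on one line (in particular there are at least three interior ovals). For two chosen points $X\ne Y$, the principal segment $[XY]$ is the one of the two segments of the line $XY$ with end points $X,Y$ that cuts $\mathcal J$ an even number of times (counted with multiplicity). For three non-collinear chosen points $X,Y,Z$, the principal triangle $XYZ$ is the one of the four triangles of $\mathbb{R}P^2$ with these vertices that is bounded by $[XY]$, $[XZ]$, $[YZ]$. Let $\Delta$ be the union of all principal triangles whose vertices are chosen points; if $\Delta$ is a closed disc bounded by a (simple closed) polygon, it is called the convex hull of the interior ovals. Then: (1) if $m\le 11$, the interior ovals have a convex hull, i.e. $\Delta$ is a disc bounded by a polygon; (2) for any odd $m$, if $\Delta$ is not a disc bounded by a polygon, then some line through two of the chosen points meets $C_m$ in at least $13$ distinct points. -/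

import Mathlib

open scoped LinearAlgebra.Projectivization

noncomputable section

namespace RealCurve

/-- The real projective plane. -/
abbrev RP2 : Type := ℙ ℝ (Fin 3 → ℝ)

/-- The quotient topology on the real projective plane. -/
instance : TopologicalSpace RP2 :=
  TopologicalSpace.coinduced (Projectivization.mk' ℝ) inferInstance

/-- `F` defines a real algebraic plane curve of degree `m` without singular points,
real or complex. -/
structure IsNonsingularCurve (m : ℕ) (F : MvPolynomial (Fin 3) ℝ) : Prop where
  homogeneous : F.IsHomogeneous m
  nonsingular : ∀ z : Fin 3 → ℂ, z ≠ 0 → MvPolynomial.aeval z F = 0 →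
    ∃ i, MvPolynomial.aeval z (MvPolynomial.pderiv i F) ≠ 0

/-- The real part of the curve `F = 0`. -/
def realPart (F : MvPolynomial (Fin 3) ℝ) : Set RP2 :=
  {p | ∀ (v : Fin 3 → ℝ) (hv : v ≠ 0), p = Projectivization.mk ℝ v hv → MvPolynomial.eval v F = 0}

/-- `K` is a connected component of the real part. -/
def IsComponent (F : MvPolynomial (Fin 3) ℝ) (K : Set RP2) : Prop :=
  ∃ p ∈ realPart F, K = connectedComponentIn (realPart F) p

/-- The inclusion of a subset of the projective plane, as a continuous map. -/
def inclusion (K : Set RP2) : C(K, RP2) := ⟨Subtype.val, continuous_subtype_val⟩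

/-- An oval: a component (an embedded circle, the curve being nonsingular) whose inclusion is
null-homotopic. The first homology and the fundamental group of the projective plane being the
same group of order two, this says that the circle realizes the class `0`. -/
def IsOval (F : MvPolynomial (Fin 3) ℝ) (K : Set RP2) : Prop :=
  IsComponent F K ∧ (inclusion K).Nullhomotopic

/-- A pseudo-line: a component that realizes the non-trivial class. -/
def IsPseudoLine (F : MvPolynomial (Fin 3) ℝ) (K : Set RP2) : Prop :=
  IsComponent F K ∧ ¬ (inclusion K).Nullhomotopic

/-- The points lying on a pseudo-line. A nonsingular curve of odd degree has exactly one
pseudo-line, and this set is that pseudo-line. -/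
def pseudoLine (F : MvPolynomial (Fin 3) ℝ) : Set RP2 :=
  {p | ∃ K, IsPseudoLine F K ∧ p ∈ K}

/-- The interior of an oval `K`: the part of the complement of `K` that is an (open) disc;
the other part is a Möbius band. -/
def ovalInterior (K : Set RP2) : Set RP2 :=
  {p | p ∉ K ∧ Nonempty
    (connectedComponentIn Kᶜ p ≃ₜ Metric.ball (0 : EuclideanSpace ℝ (Fin 2)) 1)}

/-- `K` is an oval whose interior contains another oval. -/
def IsNonemptyOval (F : MvPolynomial (Fin 3) ℝ) (K : Set RP2) : Prop :=
  IsOval F K ∧ ∃ K', IsOval F K' ∧ K' ⊆ ovalInterior K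

/-- The ovals lying in the interior of the oval `O`. -/
def interiorOvals (F : MvPolynomial (Fin 3) ℝ) (O : Set RP2) : Set (Set RP2) :=
  {K | IsOval F K ∧ K ⊆ ovalInterior O}

/-- The points of the projective plane represented by the nonnegative combinations of `u` and `v`.
If `u`, `v` are linearly independent, this is one of the two segments with end points
`[u]`, `[v]` on the line through them; the other one is `projSegment u (-v)`. -/
def projSegment (u v : Fin 3 → ℝ) : Set RP2 :=
  {p | ∃ (a b : ℝ) (h : a • u + b • v ≠ 0), 0 ≤ a ∧ 0 ≤ b ∧ p = Projectivization.mk ℝ _ h}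

/-- The points represented by the nonnegative combinations of `u`, `v`, `w`. If these vectors are
linearly independent, this is the triangle bounded by `projSegment u v`, `projSegment u w` and
`projSegment v w`; changing signs of the vectors gives the four triangles with vertices
`[u]`, `[v]`, `[w]`. -/
def projTriangle (u v w : Fin 3 → ℝ) : Set RP2 :=
  {p | ∃ (a b c : ℝ) (h : a • u + b • v + c • w ≠ 0),
    0 ≤ a ∧ 0 ≤ b ∧ 0 ≤ c ∧ p = Projectivization.mk ℝ _ h}

/-- The polynomial `t ↦ F ((1 - t) u + t v)`. -/
def restrictToLine (F : MvPolynomial (Fin 3) ℝ) (u v : Fin 3 → ℝ) : Polynomial ℝ :=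
  MvPolynomial.aeval
    (fun i => (1 - Polynomial.X) * Polynomial.C (u i) + Polynomial.X * Polynomial.C (v i)) F

open scoped Classical in
/-- The number of times, counted with multiplicity, that the interior of the segment
`projSegment u v` cuts the pseudo-line. -/
def cutNumber (F : MvPolynomial (Fin 3) ℝ) (u v : Fin 3 → ℝ) : ℕ :=
  Multiset.card ((restrictToLine F u v).roots.filter fun t =>
    0 < t ∧ t < 1 ∧
      ∃ h : (1 - t) • u + t • v ≠ 0, Projectivization.mk ℝ _ h ∈ pseudoLine F)

/-- `projSegment u v` is the principal segment determined by `[u]` and `[v]`. -/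
def IsPrincipal (F : MvPolynomial (Fin 3) ℝ) (u v : Fin 3 → ℝ) : Prop :=
  Even (cutNumber F u v)

/-- `T` is the principal triangle determined by the non-collinear points `p`, `q`, `r`: the
triangle with these vertices that is bounded by principal segments. -/
def IsPrincipalTriangle (F : MvPolynomial (Fin 3) ℝ) (p q r : RP2) (T : Set RP2) : Prop :=
  ∃ (u v w : Fin 3 → ℝ) (hu : u ≠ 0) (hv : v ≠ 0) (hw : w ≠ 0),
    p = Projectivization.mk ℝ u hu ∧ q = Projectivization.mk ℝ v hv ∧
    r = Projectivization.mk ℝ w hw ∧ LinearIndependent ℝ ![u, v, w] ∧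
    IsPrincipal F u v ∧ IsPrincipal F u w ∧ IsPrincipal F v w ∧ T = projTriangle u v w

/-- The union of all principal triangles whose vertices are interior ovals, each interior oval
`K` being represented by the point `X K`. -/
def triangleUnion (F : MvPolynomial (Fin 3) ℝ) (O : Set RP2) (X : Set RP2 → RP2) : Set RP2 :=
  {p | ∃ K ∈ interiorOvals F O, ∃ L ∈ interiorOvals F O, ∃ M ∈ interiorOvals F O,
    ∃ T, IsPrincipalTriangle F (X K) (X L) (X M) T ∧ p ∈ T}

/-- `S` is one of the two segments with the distinct end points `p` and `q`. -/
def IsSegment (p q : RP2) (S : Set RP2) : Prop :=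
  p ≠ q ∧ ∃ (u v : Fin 3 → ℝ) (hu : u ≠ 0) (hv : v ≠ 0),
    p = Projectivization.mk ℝ u hu ∧ q = Projectivization.mk ℝ v hv ∧ S = projSegment u v

/-- `P` is a simple closed polygon, with vertices `p i` and edges `E i`, `i` in `ℤ/n`. -/
def IsPolygon (P : Set RP2) : Prop :=
  ∃ (n : ℕ) (p : ZMod n → RP2) (E : ZMod n → Set RP2), 3 ≤ n ∧
    (∀ i, IsSegment (p i) (p (i + 1)) (E i)) ∧
    (∀ i, E i ∩ E (i + 1) = {p (i + 1)}) ∧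
    (∀ i j, j ≠ i → j ≠ i + 1 → i ≠ j + 1 → Disjoint (E i) (E j)) ∧
    P = ⋃ i, E i

/-- `D` is a closed disc bounded by a polygon. -/
def IsPolygonalDisc (D : Set RP2) : Prop :=
  ∃ e : Metric.closedBall (0 : EuclideanSpace ℝ (Fin 2)) 1 ≃ₜ D,
    IsPolygon {p | ∃ x : Metric.closedBall (0 : EuclideanSpace ℝ (Fin 2)) 1,
      ‖(x : EuclideanSpace ℝ (Fin 2))‖ = 1 ∧ p = (e x : RP2)}

/-- The interior ovals, represented by the points `X K`, have a convex hull. -/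
def HasConvexHull (F : MvPolynomial (Fin 3) ℝ) (O : Set RP2) (X : Set RP2 → RP2) : Prop :=
  IsPolygonalDisc (triangleUnion F O X)

/-- The points of the projective line given by a two-dimensional subspace. -/
def projLine (l : Submodule ℝ (Fin 3 → ℝ)) : Set RP2 :=
  {p | p.submodule ≤ l}

end RealCurve

end

noncomputable section

namespace RealCurve

open Set Filter Topology

/-! Everything is lifted to the nonzero vectors of three-space, which up to scaling form the double
cover of the projective plane. This space is simply connected, so the cone over the pseudo-line is
two-sided in it: some sign function `σ` changes sign across that cone and nowhere else. Since `m` is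
odd, `σ` is odd (`exists_odd_isFlip`). Hence each chosen point has a representative of sign `1`,
unique up to a positive factor, and the parity of the cut number of `projSegment u v` tells whether
`σ u = σ v` (`isPrincipal_iff`). With representatives of sign `1`, the principal triangles are
therefore the projections of the cones spanned by triples of representatives (`triangleUnion_eq`).
All depends on whether the origin is in the convex hull of the representatives.

If it is not, some linear form is positive on all representatives. In the affine chart defined by
this form, Carathéodory's theorem shows that the union of the principal triangles is the ordinary
convex hull of finitely many non-collinear points, which is a polygonal disc
(`isPolygonalDisc_iUnion_projTriangle`).

If it is, Carathéodory's theorem writes the origin as a positive combination of at most four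
affinely independent representatives. Let `D` be the disc bounded by `O`. It is disjoint from the
pseudo-line, so the vectors over `D` of sign `-1` form a connected set `H`, which contains the
negatives of all representatives. With two or three vectors in the combination, the negative of one
lies in the cone of the others. With four, the negative of one is interior to the cone of the other
three while the negative of another is outside, so `H` meets a face of that cone. Either way some
principal segment from `X` to `Y` contains a point `Z` of `D` at which the sign is `-1`
(`exists_line_of_zero_mem_convexHull`).

Along the line from `X` through `Z` and `Y` back to `X`, the sign reads `1, -1, 1, -1`. This gives 3
points of the pseudo-line. Each of them lies between two points of `D`, which gives 6 points of `O`;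
the ovals around `X` and `Y` contribute 2 points each. The total is 13 (`thirteen_le_encard`). Such
a line carries at most `m + 1` points of the curve, so this is impossible for `m ≤ 11`. -/

/-! ### Topology of the projective plane through cones of vectors. -/

/-- Homogeneous coordinate vectors. -/
abbrev Vec : Type := Fin 3 → ℝ

/-- The set of nonzero vectors representing points of `S`. -/
def cone (S : Set RP2) : Set Vec := {v | ∃ h : v ≠ 0, Projectivization.mk ℝ v h ∈ S}

/-- The set of points represented by nonzero vectors of `U`. -/
def projImage (U : Set Vec) : Set RP2 := {p | ∃ v ∈ U, ∃ h : v ≠ 0, p = Projectivization.mk ℝ v h}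

lemma isQuotientMap_mk' :
    IsQuotientMap (Projectivization.mk' ℝ : {v : Vec // v ≠ 0} → RP2) where
  surjective := Quotient.mk''_surjective
  eq_coinduced := rfl

lemma mk_smul {v : Vec} (hv : v ≠ 0) {c : ℝ} (hc : c ≠ 0) :
    Projectivization.mk ℝ (c • v) (smul_ne_zero hc hv) = Projectivization.mk ℝ v hv :=
  (Projectivization.mk_eq_mk_iff' ℝ _ _ _ _).2 ⟨c, rfl⟩

lemma cone_ne_zero {S : Set RP2} {v : Vec} (h : v ∈ cone S) : v ≠ 0 := h.1

lemma mem_cone {S : Set RP2} {v : Vec} (h : v ≠ 0) :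
    v ∈ cone S ↔ Projectivization.mk ℝ v h ∈ S := ⟨fun ⟨_, h'⟩ => h', fun h' => ⟨h, h'⟩⟩

lemma smul_mem_cone {S : Set RP2} {v : Vec} {c : ℝ} (hc : c ≠ 0) :
    c • v ∈ cone S ↔ v ∈ cone S := by
  by_cases hv : v = 0
  · subst hv
    simp
  · rw [mem_cone hv, mem_cone (smul_ne_zero hc hv), mk_smul hv hc]

lemma neg_mem_cone {S : Set RP2} {v : Vec} : -v ∈ cone S ↔ v ∈ cone S := by
  rw [← neg_one_smul ℝ v]
  exact smul_mem_cone (by norm_num)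

lemma mem_projImage_mk {U : Set Vec} {v : Vec} (hv : v ≠ 0) :
    Projectivization.mk ℝ v hv ∈ projImage U ↔ ∃ c : ℝ, c ≠ 0 ∧ c • v ∈ U := by
  constructor
  · rintro ⟨w, hw, h, he⟩
    obtain ⟨c, hc⟩ := (Projectivization.mk_eq_mk_iff' ℝ _ _ _ _).1 he.symm
    refine ⟨c, ?_, hc ▸ hw⟩
    rintro rfl
    exact h (by simpa using hc.symm)
  · rintro ⟨c, hc, hw⟩
    exact ⟨c • v, hw, smul_ne_zero hc hv, (mk_smul hv hc).symm⟩

lemma isOpen_cone {S : Set RP2} (hS : IsOpen S) : IsOpen (cone S) := by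
  have h := hS.preimage isQuotientMap_mk'.continuous
  have h0 : IsOpen {v : Vec | v ≠ 0} := isOpen_ne
  have := h0.isOpenMap_subtype_val _ h
  convert this using 1
  ext v
  simp [cone, Projectivization.mk'_eq_mk]

/-- The preimage of the image is the union of the nonzero dilates of `U`, each of them open. -/
lemma isOpen_projImage {U : Set Vec} (hU : IsOpen U) : IsOpen (projImage U) := by
  rw [← isQuotientMap_mk'.isOpen_preimage]
  have : (Projectivization.mk' ℝ : {v : Vec // v ≠ 0} → RP2) ⁻¹' projImage U =
      ⋃ c : {c : ℝ // c ≠ 0}, {v : {v : Vec // v ≠ 0} | c.1 • v.1 ∈ U} := by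
    ext v
    simp only [mem_preimage, Projectivization.mk'_eq_mk, mem_projImage_mk v.2, mem_iUnion,
      mem_ofPred_eq, Subtype.exists, exists_prop]
  rw [this]
  exact isOpen_iUnion fun c => hU.preimage (by fun_prop)

lemma continuous_mk {A : Type*} [TopologicalSpace A] {f : A → Vec} (hf : Continuous f)
    (h : ∀ a, f a ≠ 0) : Continuous fun a => Projectivization.mk ℝ (f a) (h a) :=
  isQuotientMap_mk'.continuous.comp (hf.subtype_mk h)

lemma projImage_eq_image {U : Set Vec} : projImage U =
    (Projectivization.mk' ℝ : {v : Vec // v ≠ 0} → RP2) '' (Subtype.val ⁻¹' U) := by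
  ext p
  constructor
  · rintro ⟨v, hv, h, rfl⟩
    exact ⟨⟨v, h⟩, hv, rfl⟩
  · rintro ⟨⟨v, h⟩, hv, rfl⟩
    exact ⟨v, hv, h, rfl⟩

lemma isPreconnected_projImage {U : Set Vec} (hU : IsPreconnected U) (h0 : (0 : Vec) ∉ U) :
    IsPreconnected (projImage U) := by
  rw [projImage_eq_image]
  refine IsPreconnected.image ?_ _ isQuotientMap_mk'.continuous.continuousOn
  refine (IsInducing.induced (Subtype.val : {v : Vec // v ≠ 0} → Vec)).isPreconnected_image.1 ?_
  convert hU
  ext v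
  constructor
  · rintro ⟨w, hw, rfl⟩
    exact hw
  · exact fun hv => ⟨⟨v, fun h => h0 (h ▸ hv)⟩, hv, rfl⟩

lemma projImage_mono {U V : Set Vec} (h : U ⊆ V) : projImage U ⊆ projImage V :=
  fun _ ⟨v, hv, h', e⟩ => ⟨v, h hv, h', e⟩

lemma projImage_cone (S : Set RP2) : projImage (cone S) = S := by
  ext p
  constructor
  · rintro ⟨v, ⟨h, hv⟩, h', rfl⟩
    exact hv
  · intro hp
    induction p using Projectivization.ind with
    | h v hv => exact ⟨v, ⟨hv, hp⟩, hv, rfl⟩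

lemma cone_mem_nhds {v : Vec} (hv : v ≠ 0) {S : Set RP2}
    (hS : S ∈ 𝓝 (Projectivization.mk ℝ v hv)) : cone S ∈ 𝓝 v := by
  obtain ⟨V, hV, hVo, hvV⟩ := mem_nhds_iff.1 hS
  exact mem_of_superset ((isOpen_cone hVo).mem_nhds ⟨hv, hvV⟩) fun w ⟨h, hw⟩ => ⟨h, hV hw⟩

lemma eventually_mem_cone {v : Vec} (hv : v ≠ 0) {P : RP2 → Prop}
    (h : ∀ᶠ p in 𝓝 (Projectivization.mk ℝ v hv), P p) :
    ∀ᶠ w in 𝓝 v, ∃ hw : w ≠ 0, P (Projectivization.mk ℝ w hw) :=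
  cone_mem_nhds hv h

/-- The rank one orthogonal projection onto the line spanned by a vector. -/
def projMatrix (v : Vec) (i j : Fin 3) : ℝ := v i * v j / ∑ k, v k ^ 2

lemma sum_sq_pos {v : Vec} (hv : v ≠ 0) : 0 < ∑ k, v k ^ 2 := by
  obtain ⟨i, hi⟩ := Function.ne_iff.1 hv
  exact lt_of_lt_of_le (by simpa using (sq_pos_of_ne_zero hi))
    (Finset.single_le_sum (f := fun k => v k ^ 2) (fun k _ => sq_nonneg _) (Finset.mem_univ i))

lemma projMatrix_smul (v : Vec) {c : ℝ} (hc : c ≠ 0) : projMatrix (c • v) = projMatrix v := by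
  ext i j
  simp only [projMatrix, Pi.smul_apply, smul_eq_mul, mul_pow, ← Finset.mul_sum]
  rw [show c * v i * (c * v j) = c ^ 2 * (v i * v j) by ring]
  exact mul_div_mul_left _ _ (pow_ne_zero 2 hc)

/-- A line is recovered from the orthogonal projection onto it, so the projection matrix maps the
plane continuously and injectively into a Hausdorff space. -/
instance : T2Space RP2 := by
  let f : RP2 → Fin 3 → Fin 3 → ℝ := Projectivization.lift (fun v => projMatrix v.1) (by
    rintro ⟨a, ha⟩ ⟨b, hb⟩ c h
    simp only at h
    subst h
    exact projMatrix_smul _ (by rintro rfl; simp at ha))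
  have hf : Continuous f := by
    rw [isQuotientMap_mk'.continuous_iff]
    change Continuous fun v : {v : Vec // v ≠ 0} => projMatrix v.1
    unfold projMatrix
    have hc : ∀ i, Continuous fun v : {v : Vec // v ≠ 0} => v.1 i :=
      fun i => (continuous_apply i).comp continuous_subtype_val
    exact continuous_pi fun i => continuous_pi fun j => ((hc i).mul (hc j)).div
      (continuous_finsetSum _ fun k _ => (hc k).pow 2) fun v => (sum_sq_pos v.2).ne'
  refine T2Space.of_injective_continuous (f := f) ?_ hf
  intro p q h
  induction p using Projectivization.ind with
  | h u hu =>
  induction q using Projectivization.ind with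
  | h v hv =>
  have h' : projMatrix u = projMatrix v := h
  rw [Projectivization.mk_eq_mk_iff']
  -- This is the coefficient of the projection of `u` onto the line of `v`; as the two projections
  -- agree, that projection is `u` itself.
  refine ⟨(∑ j, u j * v j) / ∑ k, v k ^ 2, ?_⟩
  have hu' := (sum_sq_pos hu).ne'
  have hv' := (sum_sq_pos hv).ne'
  ext i
  have h1 : ∑ j, projMatrix u i j * u j = u i := by
    simp only [projMatrix, div_mul_eq_mul_div, ← Finset.sum_div]
    rw [div_eq_iff hu', Finset.mul_sum]
    exact Finset.sum_congr rfl fun j _ => by ring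
  rw [h'] at h1
  rw [← h1]
  simp only [projMatrix, div_mul_eq_mul_div, ← Finset.sum_div, Pi.smul_apply, smul_eq_mul,
    Finset.sum_mul]
  congr 1
  exact Finset.sum_congr rfl fun j _ => by ring

lemma one_lt_rank_vec : 1 < Module.rank ℝ Vec := by
  rw [rank_fin_fun]
  norm_num

lemma isPreconnected_ne_zero : IsPreconnected {v : Vec | v ≠ 0} :=
  (isConnected_compl_singleton_of_one_lt_rank one_lt_rank_vec 0).isPreconnected

instance : PreconnectedSpace RP2 := by
  refine ⟨?_⟩
  have h := isPreconnected_projImage isPreconnected_ne_zero (by simp)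
  convert h
  symm
  rw [eq_univ_iff_forall]
  intro p
  induction p using Projectivization.ind with
  | h v hv => exact ⟨v, hv, hv, rfl⟩

/-- The projection of the unit sphere to the projective plane. -/
def sphereProj (v : Metric.sphere (0 : Vec) 1) : RP2 :=
  Projectivization.mk ℝ v.1 (ne_zero_of_mem_unit_sphere v)

lemma continuous_sphereProj : Continuous sphereProj :=
  continuous_mk continuous_subtype_val _

lemma sphereProj_surjective : Function.Surjective sphereProj := by
  intro p
  induction p using Projectivization.ind with
  | h v hv =>
    have hn : ‖v‖⁻¹ ≠ 0 := inv_ne_zero (norm_ne_zero_iff.2 hv)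
    refine ⟨⟨‖v‖⁻¹ • v, ?_⟩, mk_smul hv hn⟩
    simp [norm_smul, hv]

instance : CompactSpace RP2 :=
  sphereProj_surjective.compactSpace continuous_sphereProj

/-! ### Sign functions that flip across a set. -/

/-- Near the points of `U`, the function `g` is a nonzero constant off `A`, and on `A` it is the
sign of `f` up to a nonzero constant: it changes sign across `A`. -/
def IsFlip {E : Type*} [TopologicalSpace E] (f : E → ℝ) (A U : Set E) (g : E → SignType) : Prop :=
  ∀ p ∈ U, (p ∉ A → ∃ c : SignType, c ≠ 0 ∧ ∀ᶠ q in 𝓝 p, g q = c) ∧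
    (p ∈ A → ∃ c : SignType, c ≠ 0 ∧ ∀ᶠ q in 𝓝 p, g q = c * SignType.sign (f q))

section

variable {E : Type*} [TopologicalSpace E] {f : E → ℝ} {A U V : Set E} {g g₁ g₂ : E → SignType}

lemma IsFlip.mono (h : IsFlip f A U g) (hV : V ⊆ U) : IsFlip f A V g := fun p hp => h p (hV hp)

lemma IsFlip.ne_zero (h : IsFlip f A U g) {p : E} (hp : p ∈ U) (hA : p ∉ A) : g p ≠ 0 := by
  obtain ⟨c, hc, h'⟩ := (h p hp).1 hA
  rwa [h'.self_of_nhds]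

lemma IsFlip.congr (h : IsFlip f A U g₁) (hg : ∀ p ∈ U, ∀ᶠ q in 𝓝 p, g₂ q = g₁ q) :
    IsFlip f A U g₂ := by
  intro p hp
  refine ⟨fun hA => ?_, fun hA => ?_⟩
  · obtain ⟨c, hc, h'⟩ := (h p hp).1 hA
    exact ⟨c, hc, by filter_upwards [h', hg p hp] with q h1 h2 using h2.trans h1⟩
  · obtain ⟨c, hc, h'⟩ := (h p hp).2 hA
    exact ⟨c, hc, by filter_upwards [h', hg p hp] with q h1 h2 using h2.trans h1⟩

lemma IsFlip.const_mul (h : IsFlip f A U g) {c : SignType} (hc : c ≠ 0) :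
    IsFlip f A U fun q => c * g q := by
  intro p hp
  refine ⟨fun hA => ?_, fun hA => ?_⟩
  · obtain ⟨d, hd, h'⟩ := (h p hp).1 hA
    exact ⟨c * d, mul_ne_zero hc hd, h'.mono fun q hq => by simp only [hq]⟩
  · obtain ⟨d, hd, h'⟩ := (h p hp).2 hA
    exact ⟨c * d, mul_ne_zero hc hd, h'.mono fun q hq => by simp only [hq, mul_assoc]⟩

lemma sign_mul_self {c : SignType} (hc : c ≠ 0) : c * c = 1 := by
  cases c <;> simp_all

lemma sign_cases {c : SignType} (hc : c ≠ 0) : c = 1 ∨ c = -1 := by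
  cases c <;> simp_all

/-- Two sign functions that flip across the same set agree up to a constant. -/
lemma IsFlip.eq_const_mul (h₁ : IsFlip f A U g₁) (h₂ : IsFlip f A U g₂) (hU : IsPreconnected U)
    (hf : ∀ p ∈ U, p ∈ A → ∃ᶠ q in 𝓝 p, f q ≠ 0) :
    ∃ c : SignType, c ≠ 0 ∧ ∀ p ∈ U, g₁ p = c * g₂ p := by
  let S : SignType → Set E := fun c => {p | ∀ᶠ q in 𝓝 p, g₁ q = c * g₂ q}
  have hopen : ∀ c, IsOpen (S c) := fun c => isOpen_iff_mem_nhds.2 fun p hp =>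
    eventually_eventually_nhds.2 hp
  have hex : ∀ p ∈ U, ∃ c, c ≠ 0 ∧ p ∈ S c := by
    intro p hp
    by_cases hA : p ∈ A
    · obtain ⟨c, hc, h⟩ := (h₁ p hp).2 hA
      obtain ⟨d, hd, h'⟩ := (h₂ p hp).2 hA
      refine ⟨c * d, mul_ne_zero hc hd, ?_⟩
      filter_upwards [h, h'] with q h1 h2
      rw [h1, h2, mul_assoc, ← mul_assoc d d, sign_mul_self hd, one_mul]
    · obtain ⟨c, hc, h⟩ := (h₁ p hp).1 hA
      obtain ⟨d, hd, h'⟩ := (h₂ p hp).1 hA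
      refine ⟨c * d, mul_ne_zero hc hd, ?_⟩
      filter_upwards [h, h'] with q h1 h2
      rw [h1, h2, mul_assoc, sign_mul_self hd, mul_one]
  have hcov : U ⊆ S 1 ∪ S (-1) := by
    intro p hp
    obtain ⟨c, hc, h⟩ := hex p hp
    rcases sign_cases hc with rfl | rfl
    · exact Or.inl h
    · exact Or.inr h
  -- If both constants worked near `p`, then `g₂` would vanish near `p`. Off `A` this contradicts
  -- the definition, and on `A` it fails because `f` is nonzero arbitrarily close to `p`.
  have hdisj : U ∩ (S 1 ∩ S (-1)) = ∅ := by
    rw [eq_empty_iff_forall_notMem]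
    rintro p ⟨hp, h1, h2⟩
    have h0 : ∀ᶠ q in 𝓝 p, g₂ q = 0 := by
      filter_upwards [h1, h2] with q h1 h2
      rw [h1, one_mul] at h2
      generalize g₂ q = x at h2
      cases x <;> simp_all
    by_cases hA : p ∈ A
    · obtain ⟨d, hd, h'⟩ := (h₂ p hp).2 hA
      obtain ⟨q, hq, hq', hq''⟩ := ((hf p hp hA).and_eventually (h0.and h')).exists
      rw [hq'] at hq''
      rcases mul_eq_zero.1 hq''.symm with h | h
      · exact hd h
      · exact hq (sign_eq_zero_iff.1 h)
    · exact h₂.ne_zero hp hA h0.self_of_nhds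
  rcases isPreconnected_iff_subset_of_disjoint.1 hU _ _ (hopen 1) (hopen (-1)) hcov hdisj with h | h
  · exact ⟨1, by decide, fun p hp => (h hp).self_of_nhds⟩
  · exact ⟨-1, by decide, fun p hp => (h hp).self_of_nhds⟩

/-- A sign function that flips nowhere is constant on a preconnected set. -/
lemma IsFlip.const_of_disjoint (h : IsFlip f A U g) (hU : IsPreconnected U) (hA : Disjoint U A)
    {p q : E} (hp : p ∈ U) (hq : q ∈ U) : g p = g q := by
  have h1 : IsFlip f A U fun _ => 1 := fun p hp =>
    ⟨fun _ => ⟨1, by decide, by simp⟩, fun h => absurd h (disjoint_left.1 hA hp)⟩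
  obtain ⟨c, -, hc⟩ := h.eq_const_mul h1 hU fun p hp h => absurd h (disjoint_left.1 hA hp)
  rw [hc p hp, hc q hq]

/-- On the connected overlap the two functions differ by a nonzero constant; multiplying `g₂` by it
makes them agree there. -/
lemma IsFlip.glue (h₁ : IsFlip f A U g₁) (h₂ : IsFlip f A V g₂) (hU : IsOpen U) (hV : IsOpen V)
    (hUV : IsPreconnected (U ∩ V)) (hf : ∀ p ∈ A, ∃ᶠ q in 𝓝 p, f q ≠ 0) :
    ∃ g, IsFlip f A (U ∪ V) g := by
  classical
  obtain ⟨c, hc, h⟩ := (h₁.mono inter_subset_left).eq_const_mul (h₂.mono inter_subset_right) hUV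
    fun p _ hp => hf p hp
  refine ⟨fun q => if q ∈ U then g₁ q else c * g₂ q, ?_⟩
  rintro p (hp | hp)
  · refine h₁.congr (g₂ := fun q => if q ∈ U then g₁ q else c * g₂ q) (fun p hp => ?_) p hp
    filter_upwards [hU.mem_nhds hp] with q hq
    rw [if_pos hq]
  · refine (h₂.const_mul hc).congr (g₂ := fun q => if q ∈ U then g₁ q else c * g₂ q)
      (fun p hp => ?_) p hp
    filter_upwards [hV.mem_nhds hp] with q hq
    split_ifs with hqU
    · exact h q ⟨hqU, hq⟩
    · rfl

lemma IsFlip.comp {E' : Type*} [TopologicalSpace E'] {φ : E' → E} (hφ : Continuous φ)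
    (h : IsFlip f A U g) : IsFlip (f ∘ φ) (φ ⁻¹' A) (φ ⁻¹' U) (g ∘ φ) := by
  intro p hp
  refine ⟨fun hA => ?_, fun hA => ?_⟩
  · obtain ⟨c, hc, h'⟩ := (h _ hp).1 hA
    exact ⟨c, hc, hφ.continuousAt.eventually h'⟩
  · obtain ⟨c, hc, h'⟩ := (h _ hp).2 hA
    exact ⟨c, hc, hφ.continuousAt.eventually h'⟩

end

/-! ### Two-sidedness in the complement of the origin. -/

section

variable {E : Type*} [NormedAddCommGroup E] [NormedSpace ℝ E] {f : E → ℝ} {A : Set E}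

/-- Local sign functions are chained along the segment. A Lebesgue subdivision puts each piece in
one ball, and thickenings of consecutive pieces are convex with convex intersection, so each gluing
is possible. -/
lemma exists_isFlip_segment (hf : ∀ p ∈ A, ∃ᶠ q in 𝓝 p, f q ≠ 0) (a b : E)
    (hloc : ∀ p ∈ segment ℝ a b, ∃ r > 0, ∃ g, IsFlip f A (Metric.ball p r) g) :
    ∃ U, IsOpen U ∧ Convex ℝ U ∧ segment ℝ a b ⊆ U ∧ ∃ g, IsFlip f A U g := by
  let γ : ℝ → E := AffineMap.lineMap a b
  have hγ : Continuous γ := AffineMap.lineMap_continuous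
  have hseg : ∀ t : unitInterval, γ t ∈ segment ℝ a b := fun t => by
    rw [segment_eq_image_lineMap]
    exact ⟨t, t.2, rfl⟩
  choose! r hr g hg using hloc
  -- With half the radius, a thickening of a piece by `ρ / 2` still fits in the ball where `g` is
  -- defined.
  let c : unitInterval → Set unitInterval := fun t => {s | γ s ∈ Metric.ball (γ t) (r (γ t) / 2)}
  have hc : ∀ t, IsOpen (c t) := fun t =>
    Metric.isOpen_ball.preimage (hγ.comp continuous_subtype_val)
  have hcov : univ ⊆ ⋃ t, c t := fun t _ => mem_iUnion.2
    ⟨t, Metric.mem_ball_self (half_pos (hr _ (hseg t)))⟩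
  obtain ⟨t, ht0, htm, ⟨n, hn⟩, ht⟩ := exists_monotone_Icc_subset_open_cover_unitInterval hc hcov
  let I : ℝ → ℝ → Set E := fun x y => γ '' Icc x y
  have hconv : ∀ x y, Convex ℝ (I x y) := fun x y => (convex_Icc x y).affine_image _
  have key : ∀ k, ∃ ε > 0, ∃ g, IsFlip f A (Metric.thickening ε (I 0 (t k))) g := by
    intro k
    induction k with
    | zero =>
      have h0 := hseg 0
      refine ⟨r (γ (0 : unitInterval)), hr _ h0, g (γ (0 : unitInterval)), (hg _ h0).mono ?_⟩
      simp [I, ht0]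
    | succ k ih =>
      obtain ⟨ε, hε, g₁, h₁⟩ := ih
      obtain ⟨s, hs⟩ := ht k
      have hs' := hseg s
      set ρ := r (γ s) with hρ
      have hρ0 : 0 < ρ := hr _ hs'
      set δ := min ε (ρ / 2) with hδ
      have hδ0 : 0 < δ := lt_min hε (half_pos hρ0)
      have h₁' : IsFlip f A (Metric.thickening δ (I 0 (t k))) g₁ :=
        h₁.mono (Metric.thickening_mono (min_le_left _ _) _)
      have h₂ : IsFlip f A (Metric.thickening δ (I (t k) (t (k + 1)))) (g (γ s)) := by
        refine (hg _ hs').mono ?_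
        intro p hp
        obtain ⟨_, ⟨x, hx, rfl⟩, hpx⟩ := Metric.mem_thickening_iff.1 hp
        have hx1 : x ∈ Icc (0 : ℝ) 1 := ⟨(t k).2.1.trans hx.1, hx.2.trans (t (k + 1)).2.2⟩
        have : γ x ∈ Metric.ball (γ s) (ρ / 2) :=
          hs (show (⟨x, hx1⟩ : unitInterval) ∈ Icc (t k) (t (k + 1)) from hx)
        rw [Metric.mem_ball] at this ⊢
        calc dist p (γ s) ≤ dist p (γ x) + dist (γ x) (γ s) := dist_triangle _ _ _
          _ < ρ / 2 + ρ / 2 := add_lt_add (hpx.trans_le (min_le_right _ _)) this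
          _ = ρ := add_halves ρ
      obtain ⟨g₃, h₃⟩ := h₁'.glue h₂ Metric.isOpen_thickening Metric.isOpen_thickening
        (((hconv _ _).thickening _).inter ((hconv _ _).thickening _)).isPreconnected hf
      refine ⟨δ, hδ0, g₃, ?_⟩
      have : I 0 (t (k + 1)) = I 0 (t k) ∪ I (t k) (t (k + 1)) := by
        rw [← image_union, Icc_union_Icc_eq_Icc (t k).2.1 (htm (Nat.le_succ k))]
      rwa [this, Metric.thickening_union]
  obtain ⟨ε, hε, g, h⟩ := key n
  have hI : I 0 (t n) = segment ℝ a b := by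
    rw [hn n le_rfl, segment_eq_image_lineMap]
    rfl
  rw [hI] at h
  exact ⟨_, Metric.isOpen_thickening, (convex_segment a b).thickening _,
    Metric.self_subset_thickening hε _, g, h⟩

lemma isOpen_compl_ray {b : E} (hb : b ≠ 0) : IsOpen {u : E | ∀ t : ℝ, 0 ≤ t → u ≠ -(t • b)} := by
  have h := (isClosedEmbedding_smul_left (𝕜 := ℝ) (neg_ne_zero.2 hb)).isClosedMap (Ici 0)
    isClosed_Ici
  convert h.isOpen_compl using 1
  ext u
  simp only [mem_ofPred_eq, mem_compl_iff, mem_image, mem_Ici, not_exists, not_and, smul_neg]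
  exact ⟨fun h t ht e => h t ht e.symm, fun h t ht e => h t ht e.symm⟩

/-- The set is star-shaped about `b`. Continuation along segments from `b`, normalized by `g b = 1`,
gives a value at each point. Neighbouring choices agree, because two sign functions on convex sets
containing `b` are proportional on the intersection, with factor `1` at `b`. -/
lemma exists_isFlip_compl_ray (hf : ∀ p ∈ A, ∃ᶠ q in 𝓝 p, f q ≠ 0)
    (hloc : ∀ p ≠ 0, ∃ r > 0, ∃ g, IsFlip f A (Metric.ball p r) g) {b : E} (hb : b ≠ 0)
    (hbA : b ∉ A) : ∃ g, IsFlip f A {u : E | ∀ t : ℝ, 0 ≤ t → u ≠ -(t • b)} g := by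
  set S := {u : E | ∀ t : ℝ, 0 ≤ t → u ≠ -(t • b)}
  have hseg : ∀ u ∈ S, ∀ p ∈ segment ℝ b u, p ≠ 0 := by
    rintro u hu p ⟨x, y, hx, hy, hxy, rfl⟩ h
    rcases hy.eq_or_lt with rfl | hy
    · simp only [add_zero] at hxy
      subst hxy
      exact hb (by simpa using h)
    · refine hu (x / y) (div_nonneg hx hy.le) ?_
      rw [eq_neg_iff_add_eq_zero, ← smul_right_injective E hy.ne' |>.eq_iff, smul_add, smul_smul,
        mul_div_cancel₀ _ hy.ne', smul_zero, add_comm, h]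
  have : ∀ u ∈ S, ∃ U, IsOpen U ∧ Convex ℝ U ∧ segment ℝ b u ⊆ U ∧ ∃ g, IsFlip f A U g ∧ g b = 1 := by
    intro u hu
    obtain ⟨U, h1, h2, h3, g, hg⟩ := exists_isFlip_segment hf b u fun p hp => hloc p (hseg u hu p hp)
    have hgb : g b ≠ 0 := hg.ne_zero (h3 (left_mem_segment ℝ b u)) hbA
    exact ⟨U, h1, h2, h3, _, hg.const_mul hgb, sign_mul_self hgb⟩
  choose! U hUo hUc hU g hg hgb using this
  refine ⟨fun u => g u u, fun p hp => ?_⟩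
  have hpU : p ∈ U p := hU p hp (right_mem_segment ℝ b p)
  refine ((hg p hp).mono (inter_subset_left (t := S))).congr (g₂ := fun u => g u u)
    (fun q hq => ?_) p ⟨hpU, hp⟩
  filter_upwards [(hUo p hp).mem_nhds hq.1, (isOpen_compl_ray hb).mem_nhds hq.2] with u hu huS
  obtain ⟨c, hc, h⟩ := ((hg u huS).mono inter_subset_left).eq_const_mul
    ((hg p hp).mono inter_subset_right) ((hUc u huS).inter (hUc p hp)).isPreconnected
    fun p _ hp => hf p hp
  have h1 := h b ⟨hU u huS (left_mem_segment ℝ b u), hU p hp (left_mem_segment ℝ b p)⟩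
  rw [hgb u huS, hgb p hp, mul_one] at h1
  have h2 := h u ⟨hU u huS (right_mem_segment ℝ b u), hu⟩
  rwa [← h1, one_mul] at h2

end

/-- A set that is locally the zero set of `f` or empty is two-sided in the complement of the
origin. -/
theorem exists_isFlip {f : Vec → ℝ} {A : Set Vec} (hf : ∀ p ∈ A, ∃ᶠ q in 𝓝 p, f q ≠ 0)
    (hloc : ∀ p ≠ 0, ∃ r > 0, ∃ g, IsFlip f A (Metric.ball p r) g) {b : Vec} (hb : b ≠ 0)
    (hbA : b ∉ A) (hbA' : -b ∉ A) : ∃ g, IsFlip f A {v | v ≠ 0} g := by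
  obtain ⟨g₁, h₁⟩ := exists_isFlip_compl_ray hf hloc hb hbA
  obtain ⟨g₂, h₂⟩ := exists_isFlip_compl_ray hf hloc (neg_ne_zero.2 hb) hbA'
  -- The two slit domains overlap in the complement of a line, which is connected because the line
  -- has codimension two.
  obtain ⟨g, h⟩ := h₁.glue h₂ (isOpen_compl_ray hb) (isOpen_compl_ray (neg_ne_zero.2 hb)) (by
    have hcod : 1 < Module.rank ℝ (Vec ⧸ Submodule.span ℝ {b}) := by
      rw [← Module.finrank_eq_rank]
      have h := Submodule.finrank_quotient_add_finrank (Submodule.span ℝ {b})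
      rw [finrank_span_singleton hb, Module.finrank_fin_fun] at h
      have : Module.finrank ℝ (Vec ⧸ Submodule.span ℝ {b}) = 2 := by omega
      rw [this]
      norm_num
    refine Eq.subst (motive := fun s : Set Vec => IsPreconnected s) ?_
      (isConnected_compl_of_one_lt_codim hcod).isPreconnected
    refine Set.ext fun u => ?_
    simp only [mem_inter_iff, mem_ofPred_eq, mem_compl_iff, SetLike.mem_coe,
      Submodule.mem_span_singleton, not_exists, smul_neg, neg_neg]
    symm
    constructor
    · rintro ⟨h1, h2⟩ t ht
      rcases le_total 0 t with h | h
      · exact h2 t h ht.symm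
      · exact h1 (-t) (by linarith) (by rw [neg_smul, neg_neg, ht])
    · intro h
      exact ⟨fun t _ ht => h (-t) (by rw [neg_smul, ht]), fun t _ ht => h t ht.symm⟩) hf
  refine ⟨g, h.mono fun u hu => ?_⟩
  by_contra hcon
  simp only [mem_union, mem_ofPred_eq, smul_neg, neg_neg, not_or, not_forall, not_not] at hcon
  obtain ⟨⟨s, hs, h1⟩, t, ht, h2⟩ := hcon
  have h3 : (s + t) • b = 0 := by
    rw [add_smul, ← h2, h1, add_neg_cancel]
  rcases smul_eq_zero.1 h3 with h3 | h3
  · have : t = 0 := by linarith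
    exact hu (by rw [h2, this, zero_smul])
  · exact hb h3

/-! ### Local structure of a nonsingular curve and its components. -/

lemma hasStrictFDerivAt_eval (F : MvPolynomial (Fin 3) ℝ) (v : Vec) :
    HasStrictFDerivAt (fun v : Vec => MvPolynomial.eval v F)
      (∑ i, MvPolynomial.eval v (MvPolynomial.pderiv i F) •
        (ContinuousLinearMap.proj i : Vec →L[ℝ] ℝ)) v := by
  induction F using MvPolynomial.induction_on with
  | C a => simpa using hasStrictFDerivAt_const a v
  | add p q hp hq =>
    simp only [map_add, add_smul, Finset.sum_add_distrib]
    exact hp.add hq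
  | mul_X p n hp =>
    have hX : HasStrictFDerivAt (fun v : Vec => v n)
      (ContinuousLinearMap.proj n : Vec →L[ℝ] ℝ) v :=
      (ContinuousLinearMap.proj n : Vec →L[ℝ] ℝ).hasStrictFDerivAt
    have h := hp.mul hX
    simp only [map_mul, MvPolynomial.eval_X]
    refine HasStrictFDerivAt.congr_fderiv h ?_
    ext w
    simp only [Derivation.leibniz, MvPolynomial.pderiv_X, smul_eq_mul, map_add, map_mul,
      MvPolynomial.eval_X, add_apply, smul_apply,
      sum_apply, ContinuousLinearMap.proj_apply, Finset.mul_sum, add_mul,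
      Finset.sum_add_distrib]
    congr 1
    · simp [Pi.single_apply, apply_ite]
    · exact Finset.sum_congr rfl fun i _ => by ring

lemma continuous_eval (F : MvPolynomial (Fin 3) ℝ) :
    Continuous fun v : Vec => MvPolynomial.eval v F := MvPolynomial.continuous_eval F

/-- Near a zero with nonvanishing derivative, the zero set and the two sides of it are connected,
and the zero set is adherent to both sides. -/
lemma exists_chart {E : Type*} [NormedAddCommGroup E] [NormedSpace ℝ E] [CompleteSpace E]
    {f : E → ℝ} {f' : E →L[ℝ] ℝ} {p : E} (hf : HasStrictFDerivAt f f' p) (hf' : f' ≠ 0)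
    (hp : f p = 0) {U : Set E} (hU : U ∈ 𝓝 p) :
    ∃ N ⊆ U, IsOpen N ∧ p ∈ N ∧ IsPreconnected (N ∩ {q | f q = 0}) ∧
      IsPreconnected (N ∩ {q | 0 < f q}) ∧ IsPreconnected (N ∩ {q | f q < 0}) ∧
      ∀ q ∈ N, f q = 0 → (∃ᶠ x in 𝓝 q, 0 < f x) ∧ ∃ᶠ x in 𝓝 q, f x < 0 := by
  have hr : f'.range = ⊤ := by
    refine LinearMap.range_eq_top.2 (LinearMap.surjective (f := (f' : E →ₗ[ℝ] ℝ)) ?_)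
    exact fun h => hf' (ContinuousLinearMap.coe_injective h)
  -- In this chart `f` is the first coordinate, so within a ball the zero set and its two sides
  -- become convex.
  let e := hf.implicitToOpenPartialHomeomorph f f' hr
  have hfst : ∀ x, (e x).1 = f x := fun x => rfl
  have hps : p ∈ e.source := hf.mem_implicitToOpenPartialHomeomorph_source hr
  have hep : e p = (0, 0) := by
    rw [hf.implicitToOpenPartialHomeomorph_self hr, hp]
  have ht : e.target ∩ e.symm ⁻¹' (interior U) ∈ 𝓝 ((0, 0) : ℝ × f'.ker) := by
    refine (e.isOpen_inter_preimage_symm isOpen_interior).mem_nhds ?_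
    rw [← hep]
    refine ⟨e.map_source hps, ?_⟩
    rw [mem_preimage, e.left_inv hps]
    exact mem_interior_iff_mem_nhds.2 hU
  obtain ⟨r, hr0, hball⟩ := Metric.mem_nhds_iff.1 ht
  set B := Metric.ball ((0, 0) : ℝ × f'.ker) r
  have hBt : B ⊆ e.target := fun x hx => (hball hx).1
  have hN : ∀ C : Set ℝ, e.symm '' (B ∩ {x | x.1 ∈ C}) = e.symm '' B ∩ {q | f q ∈ C} := by
    intro C
    ext q
    constructor
    · rintro ⟨x, ⟨hx, hxC⟩, rfl⟩
      refine ⟨⟨x, hx, rfl⟩, ?_⟩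
      rwa [mem_ofPred_eq, ← hfst, e.right_inv (hBt hx)]
    · rintro ⟨⟨x, hx, rfl⟩, hC⟩
      refine ⟨x, ⟨hx, ?_⟩, rfl⟩
      rwa [mem_ofPred_eq, ← hfst, e.right_inv (hBt hx)] at hC
  have hconn : ∀ C : Set ℝ, Convex ℝ C → IsPreconnected (e.symm '' B ∩ {q | f q ∈ C}) := by
    intro C hC
    rw [← hN]
    refine IsPreconnected.image ?_ _ (e.continuousOn_symm.mono fun x hx => hBt hx.1)
    exact ((convex_ball _ _).inter
      (hC.linear_preimage (LinearMap.fst ℝ ℝ f'.ker))).isPreconnected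
  -- Moving the first coordinate in the direction of `s` leaves the zero set; `s = 1` and `s = -1`
  -- give the two sides.
  have hclos : ∀ q ∈ e.symm '' B, f q = 0 → ∀ s : ℝ, s ≠ 0 →
      ∃ᶠ x in 𝓝 q, 0 < f x * s := by
    rintro _ ⟨x, hx, rfl⟩ hq s hs
    rw [← hfst, e.right_inv (hBt hx)] at hq
    have hc : Tendsto (fun t : ℝ => e.symm (t * s, x.2)) (𝓝[>] 0) (𝓝 (e.symm x)) := by
      have h1 : ContinuousAt e.symm x := e.continuousAt_symm (hBt hx)
      have h2 : Tendsto (fun t : ℝ => (t * s, x.2)) (𝓝[>] 0) (𝓝 x) := by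
        have : Continuous fun t : ℝ => (t * s, x.2) := by fun_prop
        have h3 := this.tendsto 0
        simp only [zero_mul] at h3
        rw [show ((0 : ℝ), x.2) = x from Prod.ext hq.symm rfl] at h3
        exact h3.mono_left nhdsWithin_le_nhds
      exact h1.tendsto.comp h2
    have hmem : ∀ᶠ t : ℝ in 𝓝[>] 0, (t * s, x.2) ∈ e.target := by
      have : Continuous fun t : ℝ => (t * s, x.2) := by fun_prop
      refine (this.tendsto 0).mono_left nhdsWithin_le_nhds |>.eventually
        (e.open_target.mem_nhds ?_)
      rw [zero_mul, show ((0 : ℝ), x.2) = x from Prod.ext hq.symm rfl]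
      exact hBt hx
    refine hc.frequently (Eventually.frequently ?_)
    filter_upwards [hmem, self_mem_nhdsWithin] with t ht ht0
    rw [← hfst, e.right_inv ht]
    rw [mul_assoc]
    exact mul_pos ht0 (mul_self_pos.2 hs)
  refine ⟨e.symm '' B, ?_, e.isOpen_image_symm_of_subset_target Metric.isOpen_ball hBt,
    ⟨(0, 0), Metric.mem_ball_self hr0, ?_⟩, ?_, hconn (Ioi 0) (convex_Ioi 0),
    hconn (Iio 0) (convex_Iio 0), fun q hq h0 => ⟨?_, ?_⟩⟩
  · rintro _ ⟨x, hx, rfl⟩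
    exact interior_subset (hball hx).2
  · rw [← hep, e.left_inv hps]
  · simpa using hconn {0} (convex_singleton 0)
  · simpa using hclos q hq h0 1 one_ne_zero
  · simpa using hclos q hq h0 (-1) (by norm_num)

section

variable {m : ℕ} {F : MvPolynomial (Fin 3) ℝ}

lemma IsNonsingularCurve.eval_smul (hF : IsNonsingularCurve m F) (c : ℝ) (v : Vec) :
    MvPolynomial.eval (c • v) F = c ^ m * MvPolynomial.eval v F := by
  have h := hF.homogeneous
  rw [MvPolynomial.eval_eq', MvPolynomial.eval_eq', Finset.mul_sum]
  refine Finset.sum_congr rfl fun d hd => ?_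
  have hdeg := h (MvPolynomial.mem_support_iff.1 hd)
  have : ∑ i, d i = m := by
    rw [← hdeg, Finsupp.weight_apply, Finsupp.sum_fintype _ _ (by simp)]
    simp
  simp only [Pi.smul_apply, smul_eq_mul, mul_pow, Finset.prod_mul_distrib, Finset.prod_pow_eq_pow_sum,
    this]
  ring

lemma mk_mem_realPart (hF : IsNonsingularCurve m F) {v : Vec} (hv : v ≠ 0) :
    Projectivization.mk ℝ v hv ∈ realPart F ↔ MvPolynomial.eval v F = 0 := by
  constructor
  · intro h
    exact h v hv rfl
  · intro h w hw he
    obtain ⟨c, hc⟩ := (Projectivization.mk_eq_mk_iff' ℝ _ _ _ _).1 he.symm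
    rw [← hc, hF.eval_smul, h, mul_zero]

lemma mem_cone_realPart (hF : IsNonsingularCurve m F) {v : Vec} :
    v ∈ cone (realPart F) ↔ v ≠ 0 ∧ MvPolynomial.eval v F = 0 :=
  ⟨fun ⟨h, h'⟩ => ⟨h, (mk_mem_realPart hF h).1 h'⟩, fun ⟨h, h'⟩ => ⟨h, (mk_mem_realPart hF h).2 h'⟩⟩

/-- A real zero with vanishing gradient would be a singular point of the complex curve. -/
lemma IsNonsingularCurve.fderiv_ne_zero (hF : IsNonsingularCurve m F) {v : Vec} (hv : v ≠ 0)
    (h0 : MvPolynomial.eval v F = 0) :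
    (∑ i, MvPolynomial.eval v (MvPolynomial.pderiv i F) •
        (ContinuousLinearMap.proj i : Vec →L[ℝ] ℝ)) ≠ 0 := by
  have haev : ∀ G : MvPolynomial (Fin 3) ℝ,
      MvPolynomial.aeval (fun i => (v i : ℂ)) G = (MvPolynomial.eval v G : ℂ) := by
    intro G
    have := MvPolynomial.aeval_algebraMap_apply ℂ v G
    rwa [MvPolynomial.aeval_eq_eval] at this
  obtain ⟨i, hi⟩ := hF.nonsingular (fun i => (v i : ℂ)) (by
    intro h
    refine hv (funext fun i => ?_)
    simpa using congrFun h i) (by rw [haev, h0]; simp)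
  rw [haev] at hi
  intro h
  have := congrArg (fun φ : Vec →L[ℝ] ℝ => φ (Pi.single i 1)) h
  simp [Pi.single_apply] at this
  exact hi (by rw [this]; simp)

lemma isClosed_realPart (hF : IsNonsingularCurve m F) : IsClosed (realPart F) := by
  rw [← isQuotientMap_mk'.isClosed_preimage]
  have : (Projectivization.mk' ℝ : {v : Vec // v ≠ 0} → RP2) ⁻¹' realPart F =
      {v | MvPolynomial.eval v.1 F = 0} := by
    ext v
    exact mk_mem_realPart hF v.2
  rw [this]
  exact isClosed_eq ((continuous_eval F).comp continuous_subtype_val) continuous_const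

/-- Every point of a nonsingular curve has a neighbourhood in which the curve and its two sides
are connected. -/
lemma exists_proj_chart (hF : IsNonsingularCurve m F) {p : RP2} (hp : p ∈ realPart F) {U : Set RP2}
    (hU : U ∈ 𝓝 p) :
    ∃ N ⊆ U, IsOpen N ∧ p ∈ N ∧ IsPreconnected (N ∩ realPart F) ∧
      ∃ S T, N \ realPart F = S ∪ T ∧ IsPreconnected S ∧ IsPreconnected T ∧
        N ∩ realPart F ⊆ closure S ∩ closure T := by
  induction p using Projectivization.ind with
  | h v hv =>
  have hv0 := (mk_mem_realPart hF hv).1 hp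
  obtain ⟨N, hNU, hNo, hvN, hN0, hNp, hNm, hcl⟩ := exists_chart (hasStrictFDerivAt_eval F v)
    (hF.fderiv_ne_zero hv hv0) hv0 (cone_mem_nhds hv hU)
  have hne : (0 : Vec) ∉ N := fun h => cone_ne_zero (hNU h) rfl
  refine ⟨projImage N, ?_, isOpen_projImage hNo, ⟨v, hvN, hv, rfl⟩, ?_,
    projImage (N ∩ {q | 0 < MvPolynomial.eval q F}),
    projImage (N ∩ {q | MvPolynomial.eval q F < 0}), ?_,
    isPreconnected_projImage hNp fun h => hne h.1, isPreconnected_projImage hNm fun h => hne h.1, ?_⟩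
  · exact (projImage_mono hNU).trans (projImage_cone U).subset
  · convert isPreconnected_projImage hN0 fun h => hne h.1 using 1
    ext p
    constructor
    · rintro ⟨⟨w, hw, hw0, rfl⟩, h⟩
      exact ⟨w, ⟨hw, (mk_mem_realPart hF hw0).1 h⟩, hw0, rfl⟩
    · rintro ⟨w, ⟨hw, h⟩, hw0, rfl⟩
      exact ⟨⟨w, hw, hw0, rfl⟩, (mk_mem_realPart hF hw0).2 h⟩
  · ext p
    constructor
    · rintro ⟨⟨w, hw, hw0, rfl⟩, h⟩
      rw [mk_mem_realPart hF] at h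
      rcases lt_or_gt_of_ne h with h | h
      · exact Or.inr ⟨w, ⟨hw, h⟩, hw0, rfl⟩
      · exact Or.inl ⟨w, ⟨hw, h⟩, hw0, rfl⟩
    · rintro (⟨w, ⟨hw, h⟩, hw0, rfl⟩ | ⟨w, ⟨hw, h⟩, hw0, rfl⟩)
      · exact ⟨⟨w, hw, hw0, rfl⟩, fun h' => ne_of_gt h ((mk_mem_realPart hF hw0).1 h')⟩
      · exact ⟨⟨w, hw, hw0, rfl⟩, fun h' => ne_of_lt h ((mk_mem_realPart hF hw0).1 h')⟩
  · rintro _ ⟨⟨w, hw, hw0, rfl⟩, h⟩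
    obtain ⟨h1, h2⟩ := hcl w hw ((mk_mem_realPart hF hw0).1 h)
    have hwN := hNo.mem_nhds hw
    constructor
    · rw [mem_closure_iff_nhds]
      intro V hV
      obtain ⟨x, hx, ⟨hx0, hxV⟩, hxN⟩ :=
        (h1.and_eventually (inter_mem (cone_mem_nhds hw0 hV) hwN)).exists
      exact ⟨_, hxV, x, ⟨hxN, hx⟩, hx0, rfl⟩
    · rw [mem_closure_iff_nhds]
      intro V hV
      obtain ⟨x, hx, ⟨hx0, hxV⟩, hxN⟩ :=
        (h2.and_eventually (inter_mem (cone_mem_nhds hw0 hV) hwN)).exists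
      exact ⟨_, hxV, x, ⟨hxN, hx⟩, hx0, rfl⟩

lemma frequently_eval_ne_zero (hF : IsNonsingularCurve m F) {v : Vec} (hv : v ≠ 0)
    (h0 : MvPolynomial.eval v F = 0) : ∃ᶠ q in 𝓝 v, MvPolynomial.eval q F ≠ 0 := by
  obtain ⟨N, -, -, hvN, -, -, -, hcl⟩ := exists_chart (hasStrictFDerivAt_eval F v)
    (hF.fderiv_ne_zero hv h0) h0 univ_mem
  exact (hcl v hvN h0).1.mono fun _ h => h.ne'

lemma exists_eval_ne_zero (hF : IsNonsingularCurve m F) :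
    ∃ v : Vec, v ≠ 0 ∧ MvPolynomial.eval v F ≠ 0 := by
  have h1 : (fun _ => 1 : Vec) ≠ 0 := fun h => one_ne_zero (congrFun h 0)
  by_cases h0 : MvPolynomial.eval (fun _ => 1 : Vec) F = 0
  · obtain ⟨q, hq, hq'⟩ := ((frequently_eval_ne_zero hF h1 h0).and_eventually
      (isOpen_ne.mem_nhds h1)).exists
    exact ⟨q, hq', hq⟩
  · exact ⟨_, h1, h0⟩

/-- The components of a nonsingular curve are relatively open. -/
lemma eventually_component_eq (hF : IsNonsingularCurve m F) {p : RP2} (hp : p ∈ realPart F) :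
    ∀ᶠ q in 𝓝 p, q ∈ realPart F →
      connectedComponentIn (realPart F) q = connectedComponentIn (realPart F) p := by
  obtain ⟨N, -, hNo, hpN, hN, -⟩ := exists_proj_chart hF hp univ_mem
  filter_upwards [hNo.mem_nhds hpN] with q hq hqF
  exact connectedComponentIn_eq (hN.subset_connectedComponentIn ⟨hq, hqF⟩ inter_subset_right
    ⟨hpN, hp⟩)

/-- The components are relatively open in a compact set. In particular there are finitely many
interior ovals. -/
lemma finite_components (hF : IsNonsingularCurve m F) : {K | IsComponent F K}.Finite := by
  have hc : IsCompact (realPart F) := (isClosed_realPart hF).isCompact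
  obtain ⟨t, ht, hcov⟩ := hc.elim_nhds_subcover
    (fun p => {q | q ∈ realPart F →
      connectedComponentIn (realPart F) q = connectedComponentIn (realPart F) p})
    fun p hp => eventually_component_eq hF hp
  refine (t.finite_toSet.image fun p => connectedComponentIn (realPart F) p).subset ?_
  rintro K ⟨q, hq, rfl⟩
  obtain ⟨p, hp, h⟩ := mem_iUnion₂.1 (hcov hq)
  exact ⟨p, hp, (h hq).symm⟩

lemma IsComponent.eq_connectedComponentIn {K : Set RP2} (hK : IsComponent F K) {p : RP2}
    (hp : p ∈ K) : K = connectedComponentIn (realPart F) p := by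
  obtain ⟨q, hq, rfl⟩ := hK
  exact connectedComponentIn_eq hp

lemma IsComponent.subset {K : Set RP2} (hK : IsComponent F K) : K ⊆ realPart F := by
  obtain ⟨q, hq, rfl⟩ := hK
  exact connectedComponentIn_subset _ _

lemma IsComponent.nonempty {K : Set RP2} (hK : IsComponent F K) : K.Nonempty := by
  obtain ⟨q, hq, rfl⟩ := hK
  exact ⟨q, mem_connectedComponentIn hq⟩

lemma IsComponent.isPreconnected {K : Set RP2} (hK : IsComponent F K) : IsPreconnected K := by
  obtain ⟨q, hq, rfl⟩ := hK
  exact isPreconnected_connectedComponentIn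

lemma IsComponent.eq_or_disjoint {K L : Set RP2} (hK : IsComponent F K) (hL : IsComponent F L) :
    K = L ∨ Disjoint K L := by
  by_cases h : Disjoint K L
  · exact Or.inr h
  · obtain ⟨p, hpK, hpL⟩ := not_disjoint_iff.1 h
    exact Or.inl ((hK.eq_connectedComponentIn hpK).trans (hL.eq_connectedComponentIn hpL).symm)

lemma isComponent_of_mem {p : RP2} (hp : p ∈ realPart F) :
    IsComponent F (connectedComponentIn (realPart F) p) := ⟨p, hp, rfl⟩

lemma IsComponent.isClosed (hF : IsNonsingularCurve m F) {K : Set RP2} (hK : IsComponent F K) :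
    IsClosed K := by
  obtain ⟨q, hq, rfl⟩ := hK
  refine isClosed_of_closure_subset ?_
  exact isPreconnected_connectedComponentIn.closure.subset_connectedComponentIn
    (subset_closure (mem_connectedComponentIn hq))
    (closure_minimal (connectedComponentIn_subset _ _) (isClosed_realPart hF))

lemma IsComponent.eventually_mem_iff (hF : IsNonsingularCurve m F) {K : Set RP2}
    (hK : IsComponent F K) {p : RP2} (hp : p ∈ realPart F) :
    ∀ᶠ q in 𝓝 p, q ∈ realPart F → (q ∈ K ↔ p ∈ K) := by
  filter_upwards [eventually_component_eq hF hp] with q hq hqF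
  constructor
  · intro h
    rw [hK.eq_connectedComponentIn h, hq hqF]
    exact mem_connectedComponentIn hp
  · intro h
    rw [hK.eq_connectedComponentIn h, ← hq hqF]
    exact mem_connectedComponentIn hqF

end

/-! ### The double cover by the sphere and the lifting of ovals. -/

/-- The unit sphere of `ℝ` is the group of signs, acting by the antipodal map. The covering property
is what allows homotopies to be lifted. -/
lemma isQuotientCoveringMap_sphereProj :
    IsQuotientCoveringMap sphereProj (Metric.sphere (0 : ℝ) 1) where
  toIsQuotientMap := IsQuotientMap.of_surjective_continuous sphereProj_surjective
    continuous_sphereProj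
  continuous_const_smul g := by
    refine Continuous.subtype_mk ?_ _
    exact (continuous_subtype_val (p := (· ∈ Metric.sphere (0 : Vec) 1))).const_smul (g : ℝ)
  apply_eq_iff_mem_orbit := by
    intro u v
    rw [sphereProj, sphereProj, Projectivization.mk_eq_mk_iff']
    constructor
    · rintro ⟨a, ha⟩
      have ha' : ‖a‖ = 1 := by
        have h := congrArg norm ha
        rwa [norm_smul, norm_eq_of_mem_sphere, norm_eq_of_mem_sphere, mul_one] at h
      exact ⟨⟨a, by simpa using ha'⟩, Subtype.ext ha⟩
    · rintro ⟨a, rfl⟩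
      exact ⟨a, rfl⟩
  disjoint e := by
    -- Radius one is small enough: if `x` and `-x` were both in this ball, then `2 • e` would have
    -- norm less than two.
    refine ⟨Metric.ball e 1, Metric.ball_mem_nhds _ one_pos, ?_⟩
    rintro g ⟨_, ⟨x, hx, rfl⟩, hx'⟩
    have hg : |(g : ℝ)| = 1 := by
      rw [← Real.norm_eq_abs]
      exact norm_eq_of_mem_sphere g
    rcases (abs_eq zero_le_one).1 hg with hg | hg
    · exact Subtype.ext hg
    · exfalso
      rw [Metric.mem_ball, Subtype.dist_eq, dist_eq_norm] at hx hx'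
      have h1 : ((g • x : Metric.sphere (0 : Vec) 1) : Vec) = -x.1 := by
        change (g : ℝ) • x.1 = _
        rw [hg, neg_one_smul]
      simp only [h1] at hx'
      have h2 : ‖(2 : ℝ) • e.1‖ = 2 := by
        rw [norm_smul, norm_eq_of_mem_sphere]
        norm_num
      have h3 : (2 : ℝ) • e.1 = -(x.1 - e.1) - (-x.1 - e.1) := by
        rw [two_smul]
        abel
      have h4 := norm_sub_le (-(x.1 - e.1)) (-x.1 - e.1)
      rw [← h3, h2, norm_neg] at h4
      linarith

/-- A null-homotopic subset of the projective plane lifts to the space of vectors. -/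
lemma exists_lift {S : Set RP2} (h : (inclusion S).Nullhomotopic) :
    ∃ s : S → Vec, Continuous s ∧ ∀ x, ∃ h : s x ≠ 0, Projectivization.mk ℝ (s x) h = x := by
  obtain ⟨y, ⟨H⟩⟩ := h
  obtain ⟨e, he⟩ := sphereProj_surjective y
  have cov := isQuotientCoveringMap_sphereProj.isCoveringMap
  -- The homotopy is run backwards from the constant map, whose lift is the constant `e`.
  have h0 : ∀ a, H.symm.toContinuousMap (0, a) = sphereProj (ContinuousMap.const S e a) :=
    fun a => by
      change H.symm (0, a) = _
      rw [H.symm.apply_zero]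
      exact he.symm
  let L := cov.liftHomotopy H.symm.toContinuousMap (ContinuousMap.const S e) h0
  refine ⟨fun x => (L (1, x)).1, continuous_subtype_val.comp (L.continuous.comp (by fun_prop)),
    fun x => ⟨ne_zero_of_mem_unit_sphere _, ?_⟩⟩
  have h1 := congrFun (cov.liftHomotopy_lifts H.symm.toContinuousMap
    (ContinuousMap.const S e) h0) (1, x)
  refine h1.trans ?_
  change H.symm (1, x) = _
  rw [H.symm.apply_one]
  rfl

/-- A null-homotopic subset of the projective plane has a continuous choice of sign on the vectors
representing its points. -/
lemma exists_sign {S : Set RP2} (h : (inclusion S).Nullhomotopic) :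
    ∃ ε : Vec → SignType, (∀ v ∈ cone S, ε v ≠ 0) ∧ (∀ v ∈ cone S, ε (-v) = -ε v) ∧
      ∀ v ∈ cone S, ∀ᶠ w in 𝓝 v, w ∈ cone S → ε w = ε v := by
  classical
  obtain ⟨s, hs, hs'⟩ := exists_lift h
  -- The scalar product of `v` with the lift of its class. The two vectors are proportional, so it
  -- is nonzero, and its sign says whether `v` points the same way as the lift.
  let φ : cone S → ℝ := fun v =>
    ∑ i, v.1 i * s ⟨Projectivization.mk ℝ v.1 v.2.1, v.2.2⟩ i
  have hφ : Continuous φ := by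
    have h1 : Continuous fun v : cone S => s ⟨Projectivization.mk ℝ v.1 v.2.1, v.2.2⟩ :=
      hs.comp ((continuous_mk continuous_subtype_val _).subtype_mk _)
    exact continuous_finsetSum _ fun i _ =>
      ((continuous_apply i).comp continuous_subtype_val).mul ((continuous_apply i).comp h1)
  have hφ0 : ∀ v, φ v ≠ 0 := by
    intro v
    obtain ⟨h0, h1⟩ := hs' ⟨Projectivization.mk ℝ v.1 v.2.1, v.2.2⟩
    obtain ⟨c, hc⟩ := (Projectivization.mk_eq_mk_iff' ℝ _ _ _ _).1 h1
    have hc0 : c ≠ 0 := by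
      rintro rfl
      exact h0 (by rw [← hc, zero_smul])
    have : φ v = c * ∑ k, v.1 k ^ 2 := by
      simp only [φ, ← hc, Finset.mul_sum]
      exact Finset.sum_congr rfl fun i _ => by
        rw [Pi.smul_apply, smul_eq_mul]
        ring
    rw [this]
    exact mul_ne_zero hc0 (sum_sq_pos v.2.1).ne'
  have hsign : Continuous fun v => SignType.sign (φ v) := by
    refine continuous_iff_continuousAt.2 fun v => ?_
    exact (continuousAt_sign_of_ne_zero (hφ0 v)).comp hφ.continuousAt
  refine ⟨fun v => if hv : v ∈ cone S then SignType.sign (φ ⟨v, hv⟩) else 0, ?_, ?_, ?_⟩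
  · intro v hv
    simp only [dif_pos hv]
    simpa using hφ0 ⟨v, hv⟩
  · intro v hv
    have hv' : -v ∈ cone S := neg_mem_cone.2 hv
    simp only [dif_pos hv, dif_pos hv']
    rw [← Left.sign_neg]
    congr 1
    have hmk : Projectivization.mk ℝ (-v) hv'.1 = Projectivization.mk ℝ v hv.1 :=
      (Projectivization.mk_eq_mk_iff' ℝ _ _ _ _).2 ⟨-1, by simp⟩
    simp only [φ, hmk, Pi.neg_apply, neg_mul, Finset.sum_neg_distrib]
  · intro v hv
    have h1 := hsign.continuousAt (x := ⟨v, hv⟩)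
    have h2 : ∀ᶠ w in 𝓝 (⟨v, hv⟩ : cone S), SignType.sign (φ w) = SignType.sign (φ ⟨v, hv⟩) :=
      h1.eventually_mem ((isOpen_discrete {SignType.sign (φ ⟨v, hv⟩)}).mem_nhds rfl)
    rw [nhds_subtype_eq_comap, eventually_comap] at h2
    filter_upwards [h2] with w hw hwS
    simp only [dif_pos hv, dif_pos hwS]
    exact hw ⟨w, hwS⟩ rfl

/-! ### The odd sign function attached to the pseudo-line. -/

section

variable {m : ℕ} {F : MvPolynomial (Fin 3) ℝ}

/-- A relatively clopen subset of a nonsingular curve is two-sided upstairs. -/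
lemma exists_isFlip_curve (hF : IsNonsingularCurve m F) {A : Set Vec}
    (hA : A ⊆ cone (realPart F))
    (hclopen : ∀ p ∈ cone (realPart F), ∀ᶠ q in 𝓝 p, q ∈ cone (realPart F) → (q ∈ A ↔ p ∈ A)) :
    ∃ g, IsFlip (fun v => MvPolynomial.eval v F) A {v | v ≠ 0} g := by
  classical
  have hcont := continuous_eval F
  obtain ⟨b, hb, hb0⟩ := exists_eval_ne_zero hF
  have hnot : ∀ v, MvPolynomial.eval v F ≠ 0 → v ∉ A := fun v hv h =>
    hv ((mem_cone_realPart hF).1 (hA h)).2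
  have hsgn : ∀ v, MvPolynomial.eval v F ≠ 0 → ∃ c : SignType, c ≠ 0 ∧
      ∀ᶠ q in 𝓝 v, SignType.sign (MvPolynomial.eval q F) = c := by
    intro v hv
    refine ⟨SignType.sign (MvPolynomial.eval v F), by simpa using hv, ?_⟩
    have h1 := (continuousAt_sign_of_ne_zero hv).comp
      (f := fun v : Vec => MvPolynomial.eval v F) hcont.continuousAt
    exact h1.eventually_mem ((isOpen_discrete {SignType.sign (MvPolynomial.eval v F)}).mem_nhds rfl)
  refine exists_isFlip (fun p hp => ?_) (fun p hp => ?_) hb (hnot b hb0) (hnot (-b) ?_)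
  · obtain ⟨h1, h2⟩ := (mem_cone_realPart hF).1 (hA hp)
    exact frequently_eval_ne_zero hF h1 h2
  · have hev : ∀ᶠ q in 𝓝 p, q ≠ 0 := isOpen_ne.mem_nhds hp
    -- Near a point of `A` every point of the curve is in `A`, so the sign of `F` serves. Near any
    -- other point `A` is absent, and the constant `1` serves.
    by_cases hpA : p ∈ A
    · obtain ⟨r, hr, hball⟩ := Metric.eventually_nhds_iff_ball.1 (hev.and (hclopen p (hA hpA)))
      refine ⟨r, hr, fun q => SignType.sign (MvPolynomial.eval q F), fun q hq => ?_⟩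
      refine ⟨fun hqA => hsgn q fun h => hqA ?_, fun _ => ⟨1, by decide, by simp⟩⟩
      exact ((hball q hq).2 ((mem_cone_realPart hF).2 ⟨(hball q hq).1, h⟩)).2 hpA
    · have hev' : ∀ᶠ q in 𝓝 p, q ∉ A := by
        by_cases hp0 : MvPolynomial.eval p F = 0
        · filter_upwards [hclopen p ((mem_cone_realPart hF).2 ⟨hp, hp0⟩)] with q hq hqA
          exact hpA ((hq (hA hqA)).1 hqA)
        · filter_upwards [hcont.continuousAt.eventually_ne hp0] with q hq
          exact hnot q hq
      obtain ⟨r, hr, hball⟩ := Metric.eventually_nhds_iff_ball.1 hev'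
      exact ⟨r, hr, fun _ => 1, fun q hq => ⟨fun _ => ⟨1, by decide, by simp⟩,
        fun h => absurd h (hball q hq)⟩⟩
  · rw [← neg_one_smul ℝ b, hF.eval_smul]
    exact mul_ne_zero (pow_ne_zero _ (by norm_num)) hb0

end

variable {m : ℕ} {F : MvPolynomial (Fin 3) ℝ}

lemma mk_neg {v : Vec} (hv : v ≠ 0) :
    Projectivization.mk ℝ (-v) (neg_ne_zero.2 hv) = Projectivization.mk ℝ v hv :=
  (Projectivization.mk_eq_mk_iff' ℝ _ _ _ _).2 ⟨-1, by simp⟩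

lemma pseudoLine_subset : pseudoLine F ⊆ realPart F := fun _ ⟨_, hK, hp⟩ => hK.1.subset hp

lemma mem_pseudoLine_iff {p : RP2} (hp : p ∈ realPart F) :
    p ∈ pseudoLine F ↔ ¬ (inclusion (connectedComponentIn (realPart F) p)).Nullhomotopic := by
  constructor
  · rintro ⟨K, hK, hpK⟩
    rw [← hK.1.eq_connectedComponentIn hpK]
    exact hK.2
  · intro h
    exact ⟨_, ⟨isComponent_of_mem hp, h⟩, mem_connectedComponentIn hp⟩

lemma eventually_component_eq_cone (hF : IsNonsingularCurve m F) {p : Vec} (hp : p ≠ 0)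
    (hpF : Projectivization.mk ℝ p hp ∈ realPart F) :
    ∀ᶠ q in 𝓝 p, ∃ hq : q ≠ 0, Projectivization.mk ℝ q hq ∈ realPart F →
      connectedComponentIn (realPart F) (Projectivization.mk ℝ q hq) =
        connectedComponentIn (realPart F) (Projectivization.mk ℝ p hp) :=
  eventually_mem_cone hp (eventually_component_eq hF hpF)

lemma cone_mono {S T : Set RP2} (h : S ⊆ T) : cone S ⊆ cone T := fun _ ⟨h1, h2⟩ => ⟨h1, h h2⟩

lemma exists_isFlip_pseudoLine (hF : IsNonsingularCurve m F) :
    ∃ g, IsFlip (fun v => MvPolynomial.eval v F) (cone (pseudoLine F)) {v | v ≠ 0} g := by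
  refine exists_isFlip_curve hF (cone_mono pseudoLine_subset) ?_
  rintro p ⟨hp, hpF⟩
  filter_upwards [eventually_component_eq_cone hF hp hpF] with q ⟨hq, h⟩ ⟨_, hqF⟩
  rw [mem_cone hq, mem_cone hp, mem_pseudoLine_iff hqF, mem_pseudoLine_iff hpF, h hqF]

/-- The ovals lift to two antipodal copies upstairs. -/
lemma exists_half_ovals (hF : IsNonsingularCurve m F) :
    ∃ A : Set Vec, A ⊆ cone (realPart F) ∧ (∀ v ∈ A, v ∉ cone (pseudoLine F)) ∧
      (∀ v ∈ A, -v ∉ A) ∧ (∀ v ∈ cone (realPart F), v ∈ cone (pseudoLine F) ∨ v ∈ A ∨ -v ∈ A) ∧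
      ∀ p ∈ cone (realPart F), ∀ᶠ q in 𝓝 p, q ∈ cone (realPart F) → (q ∈ A ↔ p ∈ A) := by
  choose! ε hε0 hεneg hε using fun (S : Set RP2) (h : (inclusion S).Nullhomotopic) => exists_sign h
  have hself : ∀ {v : Vec} (h : v ≠ 0), Projectivization.mk ℝ v h ∈ realPart F →
      v ∈ cone (connectedComponentIn (realPart F) (Projectivization.mk ℝ v h)) :=
    fun h hv => ⟨h, mem_connectedComponentIn hv⟩
  -- Over each point of an oval, `A` keeps the one of the two opposite rays that the sign of this
  -- oval selects.
  refine ⟨{v | ∃ h : v ≠ 0, Projectivization.mk ℝ v h ∈ realPart F ∧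
    (inclusion (connectedComponentIn (realPart F) (Projectivization.mk ℝ v h))).Nullhomotopic ∧
    ε (connectedComponentIn (realPart F) (Projectivization.mk ℝ v h)) v = 1}, ?_, ?_, ?_, ?_, ?_⟩
  · rintro v ⟨h, hv, -⟩
    exact ⟨h, hv⟩
  · rintro v ⟨h, hv, hn, -⟩ ⟨_, hJ⟩
    exact (mem_pseudoLine_iff hv).1 hJ hn
  · rintro v ⟨h, hv, hn, h1⟩ ⟨h', hv', hn', h1'⟩
    rw [mk_neg h, hεneg _ hn v (hself h hv), h1] at h1'
    exact absurd h1' (by decide)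
  · rintro v ⟨h, hv⟩
    by_cases hn : (inclusion (connectedComponentIn (realPart F)
      (Projectivization.mk ℝ v h))).Nullhomotopic
    · right
      rcases sign_cases (hε0 _ hn v (hself h hv)) with h1 | h1
      · exact Or.inl ⟨h, hv, hn, h1⟩
      · refine Or.inr ⟨neg_ne_zero.2 h, ?_⟩
        rw [mk_neg h]
        refine ⟨hv, hn, ?_⟩
        rw [hεneg _ hn v (hself h hv), h1]
        decide
    · exact Or.inl ⟨h, (mem_pseudoLine_iff hv).2 hn⟩
  · rintro p ⟨hp, hpF⟩
    by_cases hn : (inclusion (connectedComponentIn (realPart F)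
      (Projectivization.mk ℝ p hp))).Nullhomotopic
    · filter_upwards [eventually_component_eq_cone hF hp hpF, hε _ hn p (hself hp hpF)]
        with q ⟨hq, h⟩ hqε ⟨_, hqF⟩
      have heq := h hqF
      have h2 := hqε (heq ▸ hself hq hqF)
      constructor
      · rintro ⟨_, _, _, h1⟩
        exact ⟨hp, hpF, hn, by rw [← h2, ← heq, h1]⟩
      · rintro ⟨_, _, _, h1⟩
        exact ⟨hq, hqF, by rwa [heq], by rw [heq, h2, h1]⟩
    · filter_upwards [eventually_component_eq_cone hF hp hpF] with q ⟨hq, h⟩ ⟨_, hqF⟩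
      have heq := h hqF
      constructor
      · rintro ⟨_, _, h1, _⟩
        exact absurd (heq ▸ h1) hn
      · rintro ⟨_, _, h1, _⟩
        exact absurd h1 hn

lemma eval_neg (hF : IsNonsingularCurve m F) (hm : Odd m) (v : Vec) :
    MvPolynomial.eval (-v) F = -MvPolynomial.eval v F := by
  rw [← neg_one_smul ℝ v, hF.eval_smul, hm.neg_one_pow, neg_one_mul]

lemma eventually_sign_eval {v : Vec} (hv : MvPolynomial.eval v F ≠ 0) :
    ∀ᶠ q in 𝓝 v, SignType.sign (MvPolynomial.eval q F) = SignType.sign (MvPolynomial.eval v F) :=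
  ((continuousAt_sign_of_ne_zero hv).comp
      (f := fun v : Vec => MvPolynomial.eval v F) (continuous_eval F).continuousAt).eventually_mem
    ((isOpen_discrete {SignType.sign (MvPolynomial.eval v F)}).mem_nhds rfl)

lemma isFlip_sign (hF : IsNonsingularCurve m F) :
    IsFlip (fun v => MvPolynomial.eval v F) (cone (realPart F)) {v | v ≠ 0}
      fun v => SignType.sign (MvPolynomial.eval v F) := by
  intro p hp
  refine ⟨fun h => ⟨SignType.sign (MvPolynomial.eval p F), ?_, ?_⟩,
    fun _ => ⟨1, by decide, by simp⟩⟩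
  · exact fun h0 => h ((mem_cone_realPart hF).2 ⟨hp, by simpa using h0⟩)
  · exact eventually_sign_eval fun h0 => h ((mem_cone_realPart hF).2 ⟨hp, by simpa using h0⟩)

/-- For a curve of odd degree, there is an odd sign function upstairs that flips across the
pseudo-line only. -/
theorem exists_odd_isFlip (hF : IsNonsingularCurve m F) (hm : Odd m) :
    ∃ σ : Vec → SignType,
      IsFlip (fun v => MvPolynomial.eval v F) (cone (pseudoLine F)) {v | v ≠ 0} σ ∧
      ∀ v ≠ 0, σ (-v) = -σ v := by
  obtain ⟨σ, hσ⟩ := exists_isFlip_pseudoLine hF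
  obtain ⟨A, hAF, hAJ, hAneg, hAcov, hAclopen⟩ := exists_half_ovals hF
  obtain ⟨g, hg⟩ := exists_isFlip_curve hF hAF hAclopen
  have hfreq : ∀ p ∈ {v : Vec | v ≠ 0}, p ∈ cone (realPart F) →
      ∃ᶠ q in 𝓝 p, MvPolynomial.eval q F ≠ 0 := fun p hp h =>
    frequently_eval_ne_zero hF hp ((mem_cone_realPart hF).1 h).2
  have hnegF : ∀ v : Vec, -v ∈ cone (realPart F) ↔ v ∈ cone (realPart F) := fun v => neg_mem_cone
  -- The factor `g v * g (-v)` flips across `A` and `-A`, that is, over the ovals. Its product with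
  -- `σ` flips across the whole curve, as the sign of `F` does, so by uniqueness the two are
  -- proportional.
  have hW : IsFlip (fun v => MvPolynomial.eval v F) (cone (realPart F)) {v | v ≠ 0}
      fun v => σ v * (g v * g (-v)) := by
    intro p hp
    have hp' : -p ∈ {v : Vec | v ≠ 0} := neg_ne_zero.2 hp
    have hcn : Tendsto (fun q : Vec => -q) (𝓝 p) (𝓝 (-p)) := continuous_neg.continuousAt
    constructor
    · intro h
      obtain ⟨c₁, hc₁, h₁⟩ := (hσ p hp).1 fun h' => h (cone_mono pseudoLine_subset h')
      obtain ⟨c₂, hc₂, h₂⟩ := (hg p hp).1 fun h' => h (hAF h')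
      obtain ⟨c₃, hc₃, h₃⟩ := (hg (-p) hp').1 fun h' => h ((hnegF p).1 (hAF h'))
      refine ⟨c₁ * (c₂ * c₃), by simp [hc₁, hc₂, hc₃], ?_⟩
      filter_upwards [h₁, h₂, hcn.eventually h₃] with q e₁ e₂ e₃
      rw [e₁, e₂, e₃]
    · intro h
      rcases hAcov p h with hJ | hA | hA
      · obtain ⟨c₁, hc₁, h₁⟩ := (hσ p hp).2 hJ
        obtain ⟨c₂, hc₂, h₂⟩ := (hg p hp).1 fun h' => hAJ p h' hJ
        obtain ⟨c₃, hc₃, h₃⟩ := (hg (-p) hp').1 fun h' => hAJ _ h' (neg_mem_cone.2 hJ)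
        refine ⟨c₁ * (c₂ * c₃), by simp [hc₁, hc₂, hc₃], ?_⟩
        filter_upwards [h₁, h₂, hcn.eventually h₃] with q e₁ e₂ e₃
        rw [e₁, e₂, e₃]
        ac_rfl
      · obtain ⟨c₁, hc₁, h₁⟩ := (hσ p hp).1 (hAJ p hA)
        obtain ⟨c₂, hc₂, h₂⟩ := (hg p hp).2 hA
        obtain ⟨c₃, hc₃, h₃⟩ := (hg (-p) hp').1 (hAneg p hA)
        refine ⟨c₁ * (c₂ * c₃), by simp [hc₁, hc₂, hc₃], ?_⟩
        filter_upwards [h₁, h₂, hcn.eventually h₃] with q e₁ e₂ e₃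
        rw [e₁, e₂, e₃]
        ac_rfl
      · obtain ⟨c₁, hc₁, h₁⟩ := (hσ p hp).1 fun h' => hAJ _ hA (neg_mem_cone.2 h')
        obtain ⟨c₂, hc₂, h₂⟩ := (hg p hp).1 fun h' => hAneg p h' hA
        obtain ⟨c₃, hc₃, h₃⟩ := (hg (-p) hp').2 hA
        refine ⟨c₁ * (c₂ * (-c₃)), by simp [hc₁, hc₂, hc₃], ?_⟩
        filter_upwards [h₁, h₂, hcn.eventually h₃] with q e₁ e₂ e₃
        rw [e₁, e₂, e₃, eval_neg hF hm, Left.sign_neg, mul_neg, ← neg_mul]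
        ac_rfl
  obtain ⟨c, hc, hcW⟩ := hW.eq_const_mul (isFlip_sign hF) isPreconnected_ne_zero hfreq
  -- The factor in `g` is even and `F` is odd, which leaves `σ` odd off the curve.
  have hodd : ∀ v ≠ 0, MvPolynomial.eval v F ≠ 0 → σ (-v) = -σ v := by
    intro v hv hv0
    have h1 := hcW v hv
    have h2 := hcW (-v) (neg_ne_zero.2 hv)
    have hvA : v ∉ A := fun h => hv0 ((mem_cone_realPart hF).1 (hAF h)).2
    have hvA' : -v ∉ A := fun h => hv0 ((mem_cone_realPart hF).1 ((hnegF v).1 (hAF h))).2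
    have hg1 := hg.ne_zero (show v ∈ {v : Vec | v ≠ 0} from hv) hvA
    have hg2 := hg.ne_zero (show -v ∈ {v : Vec | v ≠ 0} from neg_ne_zero.2 hv) hvA'
    rw [neg_neg, eval_neg hF hm, Left.sign_neg, mul_neg, ← h1, mul_comm (g (-v))] at h2
    have h3 : g v * g (-v) ≠ 0 := mul_ne_zero hg1 hg2
    rw [← neg_mul] at h2
    exact mul_right_cancel₀ h3 h2
  refine ⟨σ, hσ, ?_⟩
  -- To reach the points of the curve, uniqueness is used again: `σ (-v)` and `σ v` flip across the
  -- same set, hence are proportional, and one point off the curve shows that the factor is `-1`.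
  have hσneg : IsFlip (fun v => MvPolynomial.eval v F) (cone (pseudoLine F)) {v | v ≠ 0}
      fun v => σ (-v) := by
    intro p hp
    have hp' : -p ∈ {v : Vec | v ≠ 0} := neg_ne_zero.2 hp
    have hcn : Tendsto (fun q : Vec => -q) (𝓝 p) (𝓝 (-p)) := continuous_neg.continuousAt
    constructor
    · intro h
      obtain ⟨c₃, hc₃, h₃⟩ := (hσ (-p) hp').1 fun h' => h (neg_mem_cone.1 h')
      exact ⟨c₃, hc₃, hcn.eventually h₃⟩
    · intro h
      obtain ⟨c₃, hc₃, h₃⟩ := (hσ (-p) hp').2 (neg_mem_cone.2 h)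
      refine ⟨-c₃, by simp [hc₃], ?_⟩
      filter_upwards [hcn.eventually h₃] with q e₃
      rw [e₃, eval_neg hF hm, Left.sign_neg, mul_neg, ← neg_mul]
  obtain ⟨d, hd, hdσ⟩ := hσneg.eq_const_mul hσ isPreconnected_ne_zero fun p hp h =>
    hfreq p hp (cone_mono pseudoLine_subset h)
  obtain ⟨b, hb, hb0⟩ := exists_eval_ne_zero hF
  have h1 := hodd b hb hb0
  have h2 : σ b ≠ 0 := hσ.ne_zero hb fun h =>
    hb0 ((mem_cone_realPart hF).1 (cone_mono pseudoLine_subset h)).2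
  have h3 := hdσ b hb
  rw [h1, ← neg_one_mul] at h3
  have h4 : d = -1 := (mul_right_cancel₀ h2 h3).symm
  intro v hv
  rw [hdσ v hv, h4, neg_one_mul]

lemma IsFlip.eq_zero {σ : Vec → SignType}
    (hσ : IsFlip (fun v => MvPolynomial.eval v F) (cone (pseudoLine F)) {v | v ≠ 0} σ)
    (hF : IsNonsingularCurve m F) {v : Vec} (hv : v ∈ cone (pseudoLine F)) : σ v = 0 := by
  obtain ⟨c, -, h⟩ := (hσ v hv.1).2 hv
  rw [h.self_of_nhds]
  simp only [((mem_cone_realPart hF).1 (cone_mono pseudoLine_subset hv)).2, sign_zero, mul_zero]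

lemma IsFlip.eq_zero_iff {σ : Vec → SignType}
    (hσ : IsFlip (fun v => MvPolynomial.eval v F) (cone (pseudoLine F)) {v | v ≠ 0} σ)
    (hF : IsNonsingularCurve m F) {v : Vec} (h : v ≠ 0) : σ v = 0 ↔ v ∈ cone (pseudoLine F) := by
  refine ⟨fun h0 => ?_, hσ.eq_zero hF⟩
  by_contra hv
  exact hσ.ne_zero h hv h0

/-- An open ray lies in the cone of the pseudo-line or is disjoint from it; in the second case `σ`
flips nowhere on the ray. -/
lemma IsFlip.smul {σ : Vec → SignType}
    (hσ : IsFlip (fun v => MvPolynomial.eval v F) (cone (pseudoLine F)) {v | v ≠ 0} σ)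
    (hF : IsNonsingularCurve m F) {v : Vec} (hv : v ≠ 0) {r : ℝ} (hr : 0 < r) :
    σ (r • v) = σ v := by
  by_cases hJ : v ∈ cone (pseudoLine F)
  · rw [hσ.eq_zero hF hJ, hσ.eq_zero hF ((smul_mem_cone hr.ne').2 hJ)]
  · let R : Set Vec := (fun t : ℝ => t • v) '' Ioi 0
    have hR : IsPreconnected R := (isPreconnected_Ioi).image _ (by fun_prop)
    have hR0 : R ⊆ {v | v ≠ 0} := by
      rintro _ ⟨t, ht, rfl⟩
      exact smul_ne_zero (ne_of_gt ht) hv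
    refine (hσ.mono hR0).const_of_disjoint hR ?_ ⟨r, hr, rfl⟩ ⟨1, mem_Ioi.2 one_pos, one_smul ℝ v⟩
    rw [disjoint_left]
    rintro _ ⟨t, ht, rfl⟩ h
    exact hJ ((smul_mem_cone (ne_of_gt ht)).1 h)

/-- Without a pseudo-line, the odd function `σ` would flip nowhere, hence be constant on a connected
set containing `b` and `-b`. -/
lemma exists_isPseudoLine (hF : IsNonsingularCurve m F) (hm : Odd m) : ∃ K, IsPseudoLine F K := by
  obtain ⟨σ, hσ, hodd⟩ := exists_odd_isFlip hF hm
  by_contra hcon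
  have hJ : cone (pseudoLine F) = ∅ := by
    rw [eq_empty_iff_forall_notMem]
    rintro v ⟨h, K, hK, -⟩
    exact hcon ⟨K, hK⟩
  obtain ⟨b, hb, -⟩ := exists_eval_ne_zero hF
  have h1 := hσ.const_of_disjoint isPreconnected_ne_zero (by rw [hJ]; exact disjoint_empty _)
    hb (neg_ne_zero.2 hb)
  have h2 : σ b ≠ 0 := hσ.ne_zero hb (by simp [hJ])
  rw [hodd b hb] at h1
  generalize σ b = x at h1 h2
  cases x <;> simp_all

/-! ### Parity of crossings and principal segments. -/

lemma eventually_sign_polynomial {f : Polynomial ℝ} {s : ℝ} (h : f.eval s ≠ 0) :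
    ∀ᶠ t in 𝓝 s, SignType.sign (f.eval t) = SignType.sign (f.eval s) :=
  ((continuousAt_sign_of_ne_zero h).comp
      (f := fun t : ℝ => f.eval t) f.continuous.continuousAt).eventually_mem
    ((isOpen_discrete {SignType.sign (f.eval s)}).mem_nhds rfl)

lemma sign_prod_neg (M : Multiset ℝ) (h : ∀ a ∈ M, 0 < a) :
    SignType.sign (M.map fun a => 0 - a).prod = (-1) ^ Multiset.card M := by
  induction M using Multiset.induction_on with
  | empty => simp
  | cons a M ih =>
    rw [Multiset.map_cons, Multiset.prod_cons, sign_mul, Multiset.card_cons, pow_succ',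
      ih fun b hb => h b (Multiset.mem_cons_of_mem hb)]
    congr 1
    have := h a (Multiset.mem_cons_self a M)
    rw [sign_eq_neg_one_iff]
    linarith

open scoped Classical in
/-- The values at the end points of a sign function that flips across some of the roots of a
polynomial are determined by the parity of the number of these roots. -/
lemma even_card_roots_iff {f : Polynomial ℝ} (hf : f ≠ 0) {A : Set ℝ} {h : ℝ → SignType}
    (hh : IsFlip (fun t => f.eval t) A (Icc 0 1) h) (h0 : (0 : ℝ) ∉ A) (h1 : (1 : ℝ) ∉ A) :
    Even (Multiset.card (f.roots.filter fun t => 0 < t ∧ t < 1 ∧ t ∈ A)) ↔ h 0 = h 1 := by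
  set M := f.roots.filter fun t => 0 < t ∧ t < 1 ∧ t ∈ A with hM
  -- `P` collects, with multiplicity, the roots to be counted. The cofactor `q` has no zero on the
  -- part of `A` in the interval, so `h` flips there like `P` and is a constant times its sign.
  set P : Polynomial ℝ := (M.map fun a => Polynomial.X - Polynomial.C a).prod with hP
  have hMmem : ∀ a ∈ M, 0 < a ∧ a < 1 ∧ a ∈ A := fun a ha => (Multiset.mem_filter.1 ha).2
  have hPf : P ∣ f :=
    (Multiset.prod_dvd_prod_of_le (Multiset.map_le_map (Multiset.filter_le _ _))).trans
      (Polynomial.prod_multiset_X_sub_C_dvd f)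
  obtain ⟨q, hq⟩ := hPf
  have hPq : P * q ≠ 0 := hq ▸ hf
  have hP0 : P ≠ 0 := left_ne_zero_of_mul hPq
  have hq0 : q ≠ 0 := right_ne_zero_of_mul hPq
  have hPeval : ∀ t, P.eval t = (M.map fun a => t - a).prod := by
    intro t
    rw [hP, Polynomial.eval_multiset_prod, Multiset.map_map]
    simp
  have hin : ∀ s ∈ Icc (0 : ℝ) 1, s ∈ A → 0 < s ∧ s < 1 := fun s hs hsA =>
    ⟨hs.1.lt_of_ne fun h => h0 (h ▸ hsA), hs.2.lt_of_ne fun h => h1 (h ▸ hsA)⟩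
  have hqs : ∀ s ∈ Icc (0 : ℝ) 1, s ∈ A → q.eval s ≠ 0 := by
    intro s hs hsA
    have e1 : f.rootMultiplicity s = P.rootMultiplicity s + q.rootMultiplicity s := by
      rw [hq, Polynomial.rootMultiplicity_mul hPq]
    have e2 : P.rootMultiplicity s = f.rootMultiplicity s := by
      rw [← Polynomial.count_roots, ← Polynomial.count_roots, hP,
        Polynomial.roots_multiset_prod_X_sub_C, hM, Multiset.count_filter,
        if_pos ⟨(hin s hs hsA).1, (hin s hs hsA).2, hsA⟩]
    have e3 : q.rootMultiplicity s = 0 := by omega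
    intro h
    exact (Polynomial.rootMultiplicity_pos hq0).2 h |>.ne' e3
  have hPs : ∀ s, s ∉ A → P.eval s ≠ 0 := by
    intro s hsA h
    rw [hPeval, Multiset.prod_eq_zero_iff, Multiset.mem_map] at h
    obtain ⟨a, ha, h⟩ := h
    exact hsA ((sub_eq_zero.1 h) ▸ (hMmem a ha).2.2)
  have hh' : IsFlip (fun t => P.eval t) A (Icc 0 1) h := by
    intro s hs
    refine ⟨(hh s hs).1, fun hsA => ?_⟩
    obtain ⟨c, hc, hev⟩ := (hh s hs).2 hsA
    have hqs' := hqs s hs hsA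
    refine ⟨c * SignType.sign (q.eval s), mul_ne_zero hc (by simpa using hqs'), ?_⟩
    filter_upwards [hev, eventually_sign_polynomial hqs'] with t e1 e2
    rw [e1, hq, Polynomial.eval_mul, sign_mul, e2]
    ac_rfl
  have hPflip : IsFlip (fun t => P.eval t) A (Icc 0 1) fun t => SignType.sign (P.eval t) :=
    fun s _ => ⟨fun hsA => ⟨_, by simpa using hPs s hsA, eventually_sign_polynomial (hPs s hsA)⟩,
      fun _ => ⟨1, by decide, by simp⟩⟩
  obtain ⟨c, hc, hcP⟩ := hh'.eq_const_mul hPflip isPreconnected_Icc fun s _ _ => by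
    have : {t | P.eval t ≠ 0} ∈ 𝓝[≠] s := by
      have hfin : {t | P.IsRoot t}.Finite := Polynomial.finite_setOfPred_isRoot hP0
      have := (hfin.subset (sdiff_subset (t := {s}))).isClosed.isOpen_compl.mem_nhds
        (x := s) (by simp)
      filter_upwards [mem_nhdsWithin_of_mem_nhds this, self_mem_nhdsWithin] with t ht hts h
      exact ht ⟨h, hts⟩
    exact (Eventually.frequently this).filter_mono nhdsWithin_le_nhds
  -- All roots of `P` lie strictly between `0` and `1`: every factor is positive at `1` and negative
  -- at `0`.
  have hs1 : SignType.sign (P.eval 1) = 1 := by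
    rw [sign_eq_one_iff, hPeval]
    refine Multiset.prod_pos fun x hx => ?_
    obtain ⟨a, ha, rfl⟩ := Multiset.mem_map.1 hx
    linarith [(hMmem a ha).2.1]
  have hs0 : SignType.sign (P.eval 0) = (-1) ^ Multiset.card M := by
    rw [hPeval, sign_prod_neg M fun a ha => (hMmem a ha).1]
  rw [hcP 0 (by simp), hcP 1 (by simp), hs1, hs0]
  rcases Nat.even_or_odd (Multiset.card M) with he | ho
  · simp [he]
  · have : ¬ Even (Multiset.card M) := Nat.not_even_iff_odd.2 ho
    simp only [this, false_iff, ho.neg_one_pow]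
    rcases sign_cases hc with rfl | rfl <;> decide

lemma eval_restrictToLine (u v : Vec) (t : ℝ) :
    (restrictToLine F u v).eval t = MvPolynomial.eval ((1 - t) • u + t • v) F := by
  have h := MvPolynomial.map_aeval
    (fun i => (1 - Polynomial.X) * Polynomial.C (u i) + Polynomial.X * Polynomial.C (v i))
    (Polynomial.evalRingHom t) F
  rw [Polynomial.coe_evalRingHom] at h
  rw [restrictToLine, h, MvPolynomial.eval, MvPolynomial.coe_eval₂Hom]
  congr 1
  · ext x
    simp
  · ext i
    simp [mul_comm t]

lemma lineMap_ne_zero {u v : Vec} (huv : LinearIndependent ℝ ![u, v]) (t : ℝ) :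
    (1 - t) • u + t • v ≠ 0 := by
  intro h
  obtain ⟨h1, h2⟩ := LinearIndependent.pair_iff.1 huv _ _ h
  linarith

/-- Along the segment from `u` to `v`, `σ` flips at the roots that `cutNumber` counts, so the parity
of their number compares its end values. -/
lemma isPrincipal_iff (hF : IsNonsingularCurve m F) {σ : Vec → SignType}
    (hσ : IsFlip (fun v => MvPolynomial.eval v F) (cone (pseudoLine F)) {v | v ≠ 0} σ)
    {u v : Vec} (huv : LinearIndependent ℝ ![u, v]) (hu : MvPolynomial.eval u F ≠ 0)
    (hv : MvPolynomial.eval v F ≠ 0) : IsPrincipal F u v ↔ σ u = σ v := by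
  have hφ : Continuous fun t : ℝ => (1 - t) • u + t • v := by fun_prop
  have h1 := hσ.comp hφ
  have hJ : ∀ w, w ∈ cone (pseudoLine F) → MvPolynomial.eval w F = 0 := fun w hw =>
    ((mem_cone_realPart hF).1 (cone_mono pseudoLine_subset hw)).2
  have h2 := even_card_roots_iff (f := restrictToLine F u v)
    (A := (fun t : ℝ => (1 - t) • u + t • v) ⁻¹' cone (pseudoLine F))
    (h := σ ∘ fun t : ℝ => (1 - t) • u + t • v) ?_ ?_ ?_ ?_
  · have e0 : (σ ∘ fun t : ℝ => (1 - t) • u + t • v) 0 = σ u := by simp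
    have e1 : (σ ∘ fun t : ℝ => (1 - t) • u + t • v) 1 = σ v := by simp
    rw [e0, e1] at h2
    rw [IsPrincipal, cutNumber]
    convert h2
    exact Iff.rfl
  · intro h
    have := eval_restrictToLine (F := F) u v 0
    rw [h] at this
    simp at this
    exact hu this.symm
  · have : (fun t => (restrictToLine F u v).eval t) =
        (fun v => MvPolynomial.eval v F) ∘ fun t : ℝ => (1 - t) • u + t • v := by
      ext t
      exact eval_restrictToLine u v t
    rw [this]
    exact h1.mono fun t _ => lineMap_ne_zero huv t
  · intro h
    exact hu (by simpa using hJ _ h)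
  · intro h
    exact hv (by simpa using hJ _ h)

/-! ### Complements of ovals and the disc bounded by the nonempty oval. -/

instance : LocallyConnectedSpace RP2 := by
  have : LocallyConnectedSpace {v : Vec // v ≠ 0} :=
    (isOpen_ne (x := (0 : Vec))).locallyConnectedSpace
  exact isQuotientMap_mk'.isCoinducing.locallyConnectedSpace

lemma connectedComponentIn_eq_of_preconnected {X : Type*} [TopologicalSpace X] {U S : Set X}
    {p q : X} (hS : IsPreconnected S) (hSU : S ⊆ U) (hp : p ∈ S) (hq : q ∈ S) :
    connectedComponentIn U p = connectedComponentIn U q :=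
  connectedComponentIn_eq (hS.subset_connectedComponentIn hp hSU hq)

lemma subset_component_of_inter {X : Type*} [TopologicalSpace X] {U S : Set X} {p q : X}
    (hS : IsPreconnected S) (hSU : S ⊆ U) (hq : q ∈ S) (hqp : q ∈ connectedComponentIn U p) :
    S ⊆ connectedComponentIn U p := by
  rw [connectedComponentIn_eq hqp]
  exact hS.subset_connectedComponentIn hq hSU

lemma component_eq_of_inter {X : Type*} [TopologicalSpace X] {U : Set X} {p q r : X}
    (hp : r ∈ connectedComponentIn U p) (hq : r ∈ connectedComponentIn U q) :
    connectedComponentIn U p = connectedComponentIn U q :=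
  (connectedComponentIn_eq hp).trans (connectedComponentIn_eq hq).symm

lemma isPreconnected_insert {X : Type*} [TopologicalSpace X] {S : Set X} {x : X}
    (hS : IsPreconnected S) (hx : x ∈ closure S) : IsPreconnected (insert x S) :=
  hS.subset_closure (subset_insert _ _) (insert_subset_iff.2 ⟨hx, subset_closure⟩)

/-- A component of the complement of a nonempty closed set is adherent to this set. -/
lemma exists_mem_closure_component {K : Set RP2} (hK : IsClosed K) (hK0 : K.Nonempty) {p : RP2}
    (hp : p ∉ K) : ∃ k ∈ K, k ∈ closure (connectedComponentIn Kᶜ p) := by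
  by_contra! hcon
  set V := connectedComponentIn Kᶜ p
  have hsub : closure V ⊆ Kᶜ := fun x hx hxK => hcon x hxK hx
  have hpV : p ∈ V := mem_connectedComponentIn hp
  have hcl : closure V ⊆ V := isPreconnected_connectedComponentIn.closure.subset_connectedComponentIn
    (subset_closure hpV) hsub
  have hclopen : IsClopen V := ⟨isClosed_of_closure_subset hcl, hK.isOpen_compl.connectedComponentIn⟩
  obtain ⟨k, hk⟩ := hK0
  have := hclopen.eq_univ ⟨p, hpV⟩
  exact connectedComponentIn_subset _ _ (this ▸ mem_univ k : k ∈ V) hk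

/-- Near `x` the complement of `O` consists of two connected sides `S` and `T`. A component of the
complement adherent to `x` meets one of them and hence contains it. -/
lemma exists_two_sides (hF : IsNonsingularCurve m F) {O : Set RP2} (hO : IsComponent F O) {x : RP2}
    (hx : x ∈ O) : ∃ S T : Set RP2, S.Nonempty ∧ T.Nonempty ∧
      (∀ p ∉ O, x ∈ closure (connectedComponentIn Oᶜ p) →
        S ⊆ connectedComponentIn Oᶜ p ∨ T ⊆ connectedComponentIn Oᶜ p) ∧
      ∃ N, IsOpen N ∧ x ∈ N ∧ N ∩ O ⊆ closure S ∩ closure T := by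
  obtain ⟨N, hNU, hNo, hxN, -, S, T, hST, hS, hT, hcl⟩ := exists_proj_chart hF (hO.subset hx)
    (hO.eventually_mem_iff hF (hO.subset hx))
  have hNO : ∀ y ∈ N, y ∈ realPart F → y ∈ O := fun y hy hyF => (hNU hy hyF).2 hx
  have hSO : S ⊆ Oᶜ := fun y hy h =>
    ((hST.symm ▸ Or.inl hy : y ∈ N \ realPart F)).2 (hO.subset h)
  have hTO : T ⊆ Oᶜ := fun y hy h =>
    ((hST.symm ▸ Or.inr hy : y ∈ N \ realPart F)).2 (hO.subset h)
  have hxcl := hcl ⟨hxN, hO.subset hx⟩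
  refine ⟨S, T, closure_nonempty_iff.1 ⟨x, hxcl.1⟩, closure_nonempty_iff.1 ⟨x, hxcl.2⟩, ?_,
    N, hNo, hxN, fun y hy => hcl ⟨hy.1, hO.subset hy.2⟩⟩
  intro p hp hxp
  obtain ⟨y, hyN, hyV⟩ := mem_closure_iff.1 hxp N hNo hxN
  have hyO : y ∉ O := connectedComponentIn_subset _ _ hyV
  have hy : y ∈ S ∪ T := hST ▸ ⟨hyN, fun h => hyO (hNO y hyN h)⟩
  rcases hy with hy | hy
  · exact Or.inl (subset_component_of_inter hS hSO hy hyV)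
  · exact Or.inr (subset_component_of_inter hT hTO hy hyV)

/-- A component of the curve lies in the closure of every component of its complement. -/
lemma subset_closure_component (hF : IsNonsingularCurve m F) {O : Set RP2} (hO : IsComponent F O)
    {p : RP2} (hp : p ∉ O) : O ⊆ closure (connectedComponentIn Oᶜ p) := by
  set V := connectedComponentIn Oᶜ p
  have key : ∀ x ∈ O, x ∈ closure V → ∃ N, IsOpen N ∧ x ∈ N ∧ N ∩ O ⊆ closure V := by
    intro x hx hxV
    obtain ⟨S, T, -, -, hside, N, hNo, hxN, hN⟩ := exists_two_sides hF hO hx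
    rcases hside p hp hxV with h | h
    · exact ⟨N, hNo, hxN, fun y hy => closure_mono h (hN hy).1⟩
    · exact ⟨N, hNo, hxN, fun y hy => closure_mono h (hN hy).2⟩
  -- The points of `O` adherent to the component form a relatively open and closed, nonempty subset
  -- of the connected set `O`.
  let W : Set RP2 := ⋃₀ {N | IsOpen N ∧ N ∩ O ⊆ closure V}
  have hW : IsOpen W := isOpen_sUnion fun N hN => hN.1
  have hWV : ∀ y ∈ O, y ∈ W → y ∈ closure V := by
    rintro y hy ⟨N, hN, hyN⟩
    exact hN.2 ⟨hyN, hy⟩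
  obtain ⟨k, hk, hkV⟩ := exists_mem_closure_component (hO.isClosed hF) hO.nonempty hp
  have hcov : O ⊆ W ∪ (closure V)ᶜ := by
    intro x hx
    by_cases hxV : x ∈ closure V
    · obtain ⟨N, hNo, hxN, hN⟩ := key x hx hxV
      exact Or.inl ⟨N, ⟨hNo, hN⟩, hxN⟩
    · exact Or.inr hxV
  have hdisj : O ∩ (W ∩ (closure V)ᶜ) = ∅ := by
    rw [eq_empty_iff_forall_notMem]
    rintro x ⟨hx, hxW, hxV⟩
    exact hxV (hWV x hx hxW)
  rcases isPreconnected_iff_subset_of_disjoint.1 hO.isPreconnected W (closure V)ᶜ hW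
    isClosed_closure.isOpen_compl hcov hdisj with h | h
  · exact fun x hx => hWV x hx (h hx)
  · exact absurd hkV (h hk)

/-- The complement of a component of the curve has at most two components. -/
lemma component_compl_cases (hF : IsNonsingularCurve m F) {O : Set RP2} (hO : IsComponent F O)
    {p q r : RP2} (hp : p ∉ O) (hq : q ∉ O) (hr : r ∉ O) :
    connectedComponentIn Oᶜ p = connectedComponentIn Oᶜ q ∨
      connectedComponentIn Oᶜ q = connectedComponentIn Oᶜ r ∨
      connectedComponentIn Oᶜ p = connectedComponentIn Oᶜ r := by
  obtain ⟨x, hx⟩ := hO.nonempty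
  obtain ⟨S, T, ⟨s, hs⟩, ⟨t, ht⟩, hside, -⟩ := exists_two_sides hF hO hx
  -- Three components share two sides, so two of them contain the same side.
  rcases hside p hp (subset_closure_component hF hO hp hx) with h1 | h1 <;>
  rcases hside q hq (subset_closure_component hF hO hq hx) with h2 | h2 <;>
  rcases hside r hr (subset_closure_component hF hO hr hx) with h3 | h3
  · exact Or.inl (component_eq_of_inter (h1 hs) (h2 hs))
  · exact Or.inl (component_eq_of_inter (h1 hs) (h2 hs))
  · exact Or.inr (Or.inr (component_eq_of_inter (h1 hs) (h3 hs)))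
  · exact Or.inr (Or.inl (component_eq_of_inter (h2 ht) (h3 ht)))
  · exact Or.inr (Or.inl (component_eq_of_inter (h2 hs) (h3 hs)))
  · exact Or.inr (Or.inr (component_eq_of_inter (h1 ht) (h3 ht)))
  · exact Or.inl (component_eq_of_inter (h1 ht) (h2 ht))
  · exact Or.inl (component_eq_of_inter (h1 ht) (h2 ht))

lemma nullhomotopic_of_subset_disc {S V : Set RP2} (hSV : S ⊆ V)
    (hV : Nonempty (V ≃ₜ Metric.ball (0 : EuclideanSpace ℝ (Fin 2)) 1)) :
    (inclusion S).Nullhomotopic := by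
  obtain ⟨e⟩ := hV
  have : ContractibleSpace (Metric.ball (0 : EuclideanSpace ℝ (Fin 2)) 1) :=
    Metric.contractibleSpace_ball one_pos
  have : ContractibleSpace V := e.contractibleSpace
  exact ((id_nullhomotopic V).comp_right (inclusion V)).comp_left
    ⟨Set.inclusion hSV, continuous_inclusion hSV⟩

lemma component_subset_ovalInterior {K : Set RP2} {p : RP2} (hp : p ∈ ovalInterior K) :
    connectedComponentIn Kᶜ p ⊆ ovalInterior K := by
  intro q hq
  refine ⟨connectedComponentIn_subset _ _ hq, ?_⟩
  rw [← connectedComponentIn_eq hq]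
  exact hp.2

/-- A component of the curve that meets the interior of `K` is an oval contained in it. -/
lemma isOval_of_mem_ovalInterior {K L : Set RP2} (hL : IsComponent F L) (hKL : Disjoint K L)
    {p : RP2} (hpL : p ∈ L) (hp : p ∈ ovalInterior K) :
    IsOval F L ∧ L ⊆ connectedComponentIn Kᶜ p := by
  have h := hL.isPreconnected.subset_connectedComponentIn hpL
    (subset_compl_iff_disjoint_left.2 hKL)
  exact ⟨⟨hL, nullhomotopic_of_subset_disc h hp.2⟩, h⟩

section

variable {O : Set RP2}

/-- An interior oval containing another oval would be `O`, which is not in its own interior. -/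
lemma not_subset_interior (huniq : ∀ K, IsNonemptyOval F K → K = O)
    {K L : Set RP2} (hK : K ∈ interiorOvals F O) (hL : IsOval F L)
    (hLK : L ⊆ ovalInterior K) : False := by
  have h := huniq K ⟨hK.1, L, hL, hLK⟩
  obtain ⟨k, hk⟩ := hK.1.1.nonempty
  have := hK.2 hk
  rw [← h] at this
  exact this.1 hk

/-- Neither oval lies inside the other, so at a common point the two complementary regions contain
each other and coincide. A point of `K` adherent to this region avoids `L`, hence belongs to the
region, which is absurd. -/
lemma disjoint_ovalInterior (huniq : ∀ K, IsNonemptyOval F K → K = O)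
    (hF : IsNonsingularCurve m F) {K L : Set RP2}
    (hK : K ∈ interiorOvals F O) (hL : L ∈ interiorOvals F O) (hKL : K ≠ L) :
    Disjoint (ovalInterior K) (ovalInterior L) := by
  rw [disjoint_left]
  intro p hpK hpL
  have hd : Disjoint K L := (hK.1.1.eq_or_disjoint hL.1.1).resolve_left hKL
  have key : ∀ {K L : Set RP2}, K ∈ interiorOvals F O → L ∈ interiorOvals F O → Disjoint K L →
      p ∈ ovalInterior K → p ∈ ovalInterior L →
      connectedComponentIn Lᶜ p ⊆ connectedComponentIn Kᶜ p := by
    intro K L hK hL hd hpK hpL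
    refine isPreconnected_connectedComponentIn.subset_connectedComponentIn
      (mem_connectedComponentIn hpL.1) fun k hk hkK => ?_
    refine not_subset_interior huniq hL hK.1 ((isOval_of_mem_ovalInterior hK.1.1 hd.symm hkK
      (component_subset_ovalInterior hpL hk)).2.trans ?_)
    exact component_subset_ovalInterior (component_subset_ovalInterior hpL hk)
  have heq := (key hK hL hd hpK hpL).antisymm (key hL hK hd.symm hpL hpK)
  obtain ⟨k, hk, hkV⟩ := exists_mem_closure_component (hK.1.1.isClosed hF) hK.1.1.nonempty hpK.1
  have hcl := isPreconnected_insert (isPreconnected_connectedComponentIn (F := Kᶜ) (x := p)) hkV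
  have hsub : insert k (connectedComponentIn Kᶜ p) ⊆ Lᶜ := by
    rw [insert_subset_iff, ← heq]
    exact ⟨disjoint_left.1 hd hk, connectedComponentIn_subset _ _⟩
  have := hcl.subset_connectedComponentIn (mem_insert_of_mem k (mem_connectedComponentIn hpK.1))
    hsub (mem_insert k _)
  rw [heq] at this
  exact connectedComponentIn_subset _ _ this hk

/-- The component of the curve through such a point would be another oval inside `K`. -/
lemma notMem_realPart_of_mem_ovalInterior (huniq : ∀ K, IsNonemptyOval F K → K = O)
    {K : Set RP2}
    (hK : K ∈ interiorOvals F O) {p : RP2} (hp : p ∈ ovalInterior K) : p ∉ realPart F := by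
  intro hpF
  have hL := isComponent_of_mem hpF
  have hpL := mem_connectedComponentIn hpF
  have hd := (hK.1.1.eq_or_disjoint hL).resolve_left fun h => hp.1 (h ▸ hpL)
  obtain ⟨h1, h2⟩ := isOval_of_mem_ovalInterior hL hd hpL hp
  exact not_subset_interior huniq hK h1 (h2.trans (component_subset_ovalInterior hp))

/-- The disc bounded by the nonempty oval. -/
theorem exists_disc (huniq : ∀ K, IsNonemptyOval F K → K = O)
    (hF : IsNonsingularCurve m F) (hm : Odd m) (hO : IsNonemptyOval F O) :
    ∃ D : Set RP2, IsOpen D ∧ IsPreconnected D ∧ Disjoint D O ∧ Disjoint D (pseudoLine F) ∧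
      (∀ S : Set RP2, IsPreconnected S → Disjoint S O → (S ∩ D).Nonempty → S ⊆ D) ∧
      ∀ K ∈ interiorOvals F O, ovalInterior K ⊆ D := by
  obtain ⟨K₀, hK₀, hK₀O⟩ := hO.2
  obtain ⟨k₀, hk₀⟩ := hK₀.1.nonempty
  have hk₀O := hK₀O hk₀
  have hOc := hO.1.1
  -- A pseudo-line meeting a disc region would lie in it and be null-homotopic. As there are at most
  -- two regions and one contains the pseudo-line, only one is a disc.
  have hdisc : ∀ p ∈ ovalInterior O, ∀ q ∈ pseudoLine F, q ∉ connectedComponentIn Oᶜ p := by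
    rintro p hp q ⟨J, hJ, hqJ⟩ hq
    have hd : Disjoint O J := (hOc.eq_or_disjoint hJ.1).resolve_left fun h => hJ.2 (h ▸ hO.1.2)
    exact hJ.2 (isOval_of_mem_ovalInterior hJ.1 hd hqJ (component_subset_ovalInterior hp hq)).1.2
  obtain ⟨J, hJ⟩ := exists_isPseudoLine hF hm
  obtain ⟨j, hj⟩ := hJ.1.nonempty
  have hjO : j ∉ O := fun h => hJ.2 (by
    rw [hJ.1.eq_connectedComponentIn hj, ← hOc.eq_connectedComponentIn h]
    exact hO.1.2)
  have hone : ∀ p ∈ ovalInterior O, connectedComponentIn Oᶜ p = connectedComponentIn Oᶜ k₀ := by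
    intro p hp
    have hjmem := mem_connectedComponentIn (F := Oᶜ) hjO
    rcases component_compl_cases hF hOc hp.1 hk₀O.1 hjO with h | h | h
    · exact h
    · exact absurd (h ▸ hjmem) (hdisc k₀ hk₀O j ⟨J, hJ, hj⟩)
    · exact absurd (h ▸ hjmem) (hdisc p hp j ⟨J, hJ, hj⟩)
  refine ⟨connectedComponentIn Oᶜ k₀, (hOc.isClosed hF).isOpen_compl.connectedComponentIn,
    isPreconnected_connectedComponentIn, disjoint_left.2 fun x hx => connectedComponentIn_subset _ _ hx,
    disjoint_right.2 fun q hq => hdisc k₀ hk₀O q hq, ?_, ?_⟩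
  · rintro S hS hSO ⟨x, hxS, hxD⟩
    exact subset_component_of_inter hS (subset_compl_iff_disjoint_right.2 hSO) hxS hxD
  · intro K hK p hp
    -- The region inside `K` avoids `O` and is adherent to a point of `K`, which lies in the disc;
    -- so the region lies in the disc as well.
    have hVO : connectedComponentIn Kᶜ p ⊆ Oᶜ := by
      intro x hx hxO
      have hd : Disjoint K O := by
        rw [disjoint_left]
        exact fun y hy hyO => (hK.2 hy).1 hyO
      refine not_subset_interior huniq hK hO.1 ((isOval_of_mem_ovalInterior hOc hd hxO
        (component_subset_ovalInterior hp hx)).2.trans ?_)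
      exact component_subset_ovalInterior (component_subset_ovalInterior hp hx)
    obtain ⟨k, hk, hkV⟩ := exists_mem_closure_component (hK.1.1.isClosed hF) hK.1.1.nonempty hp.1
    have hcl := isPreconnected_insert (isPreconnected_connectedComponentIn (F := Kᶜ) (x := p)) hkV
    have hpV : p ∈ connectedComponentIn Kᶜ p := mem_connectedComponentIn hp.1
    have h1 := connectedComponentIn_eq_of_preconnected hcl
      (insert_subset_iff.2 ⟨(hK.2 hk).1, hVO⟩) (mem_insert k _) (mem_insert_of_mem k hpV)
    rw [← hone k (hK.2 hk), h1]
    exact mem_connectedComponentIn (hVO hpV)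

end

/-! ### The half cone over the disc and the thirteen intersection points. -/

/-- The vectors representing the points of a disc off the pseudo-line that have a given sign form a
connected set. -/
lemma isPreconnected_half_cone (hF : IsNonsingularCurve m F) {σ : Vec → SignType}
    (hσ : IsFlip (fun v => MvPolynomial.eval v F) (cone (pseudoLine F)) {v | v ≠ 0} σ)
    (hodd : ∀ v ≠ 0, σ (-v) = -σ v) {D : Set RP2} (hDo : IsOpen D) (hD : IsPreconnected D)
    (hDJ : Disjoint D (pseudoLine F)) {s : SignType} (hs : s ≠ 0) :
    IsPreconnected {v | v ∈ cone D ∧ σ v = s} := by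
  set H : Set Vec := {v | v ∈ cone D ∧ σ v = s}
  have hJ : ∀ v ∈ cone D, v ∉ cone (pseudoLine F) := fun v hv hv' =>
    disjoint_left.1 hDJ hv.2 hv'.2
  have hHo : IsOpen H := by
    refine isOpen_iff_mem_nhds.2 fun v hv => ?_
    obtain ⟨c, -, hc⟩ := (hσ v hv.1.1).1 (hJ v hv.1)
    filter_upwards [(isOpen_cone hDo).mem_nhds hv.1, hc] with w h1 h2
    exact ⟨h1, by rw [h2, ← hc.self_of_nhds, hv.2]⟩
  have hcov : ∀ p ∈ D, ∃ v, ∃ h : v ≠ 0, v ∈ H ∧ p = Projectivization.mk ℝ v h := by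
    intro p hp
    induction p using Projectivization.ind with
    | h v hv =>
    have hvD : v ∈ cone D := ⟨hv, hp⟩
    have h0 : σ v ≠ 0 := hσ.ne_zero hv (hJ v hvD)
    by_cases h : σ v = s
    · exact ⟨v, hv, ⟨hvD, h⟩, rfl⟩
    · refine ⟨-v, neg_ne_zero.2 hv, ⟨neg_mem_cone.2 hvD, ?_⟩, (mk_neg hv).symm⟩
      rw [hodd v hv]
      rcases sign_cases h0 with h1 | h1 <;> rcases sign_cases hs with h2 | h2 <;>
        simp_all
  intro U V hU hV hUV ⟨x, hxH, hxU⟩ ⟨y, hyH, hyV⟩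
  have hne : ∀ v ∈ H, v ≠ 0 := fun v hv => hv.1.1
  -- The fibres of `H` over `D` are open rays. Open sets covering `H` have open images covering the
  -- connected `D`; over a common point of the images there is a ray meeting both sets, and rays are
  -- connected.
  obtain ⟨p, hpD, ⟨v, hv, hv0, rfl⟩, ⟨w, hw, hw0, he⟩⟩ := hD (projImage (H ∩ U)) (projImage (H ∩ V))
    (isOpen_projImage (hHo.inter hU)) (isOpen_projImage (hHo.inter hV)) (by
      intro p hp
      obtain ⟨v, hv0, hv, rfl⟩ := hcov p hp
      rcases hUV hv with h | h
      · exact Or.inl ⟨v, ⟨hv, h⟩, hv0, rfl⟩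
      · exact Or.inr ⟨v, ⟨hv, h⟩, hv0, rfl⟩)
    ⟨_, hxH.1.2, x, ⟨hxH, hxU⟩, hxH.1.1, rfl⟩ ⟨_, hyH.1.2, y, ⟨hyH, hyV⟩, hyH.1.1, rfl⟩
  obtain ⟨c, hc⟩ := (Projectivization.mk_eq_mk_iff' ℝ _ _ _ _).1 he.symm
  -- A negative factor would reverse the sign, but both vectors have sign `s`.
  have hc0 : 0 < c := by
    by_contra hcon
    rcases (not_lt.1 hcon).eq_or_lt with h | h
    · exact hw0 (by rw [← hc, h, zero_smul])
    · have h1 : w = -((-c) • v) := by rw [← hc, neg_smul, neg_neg]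
      have h2 : (0 : ℝ) < -c := by linarith
      have h3 := hodd _ (smul_ne_zero h2.ne' hv0)
      rw [← h1, hσ.smul hF hv0 h2, hw.1.2, hv.1.2] at h3
      rcases sign_cases hs with h4 | h4 <;> rw [h4] at h3 <;> exact absurd h3 (by decide)
  have hray : IsPreconnected ((fun t : ℝ => t • v) '' Ioi 0) :=
    isPreconnected_Ioi.image _ (by fun_prop)
  have hrayH : (fun t : ℝ => t • v) '' Ioi 0 ⊆ H := by
    rintro _ ⟨t, ht, rfl⟩
    exact ⟨(smul_mem_cone (ne_of_gt ht)).2 hv.1.1, (hσ.smul hF hv0 ht).trans hv.1.2⟩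
  obtain ⟨r, hr, hrUV⟩ := hray U V hU hV (hrayH.trans hUV)
    ⟨v, ⟨1, mem_Ioi.2 one_pos, one_smul ℝ v⟩, hv.2⟩ ⟨w, ⟨c, hc0, hc⟩, hw.2⟩
  exact ⟨r, hrayH hr, hrUV⟩

/-- The great circle through `u` and `v`. -/
def circleVec (u v : Vec) (θ : ℝ) : Vec := Real.cos θ • u + Real.sin θ • v

lemma continuous_circleVec (u v : Vec) : Continuous (circleVec u v) := by
  unfold circleVec
  fun_prop

lemma circleVec_ne_zero {u v : Vec} (huv : LinearIndependent ℝ ![u, v]) (θ : ℝ) :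
    circleVec u v θ ≠ 0 := by
  intro h
  obtain ⟨h1, h2⟩ := LinearIndependent.pair_iff.1 huv _ _ h
  have := Real.cos_sq_add_sin_sq θ
  rw [h1, h2] at this
  norm_num at this

/-- The points of the line through `u` and `v`, parametrized by an angle. -/
def circlePoint {u v : Vec} (huv : LinearIndependent ℝ ![u, v]) (θ : ℝ) : RP2 :=
  Projectivization.mk ℝ _ (circleVec_ne_zero huv θ)

lemma continuous_circlePoint {u v : Vec} (huv : LinearIndependent ℝ ![u, v]) :
    Continuous (circlePoint huv) := continuous_mk (continuous_circleVec u v) _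

/-- Half a turn goes once round the projective line, so counting angles in the open interval counts
points. -/
lemma injOn_circlePoint {u v : Vec} (huv : LinearIndependent ℝ ![u, v]) :
    InjOn (circlePoint huv) (Ioo 0 Real.pi) := by
  intro x hx y hy h
  obtain ⟨c, hc⟩ := (Projectivization.mk_eq_mk_iff' ℝ _ _ _ _).1 h
  have h0 : (c * Real.cos y - Real.cos x) • u + (c * Real.sin y - Real.sin x) • v = 0 := by
    rw [sub_smul, sub_smul, mul_smul, mul_smul, sub_add_sub_comm, sub_eq_zero, ← smul_add]
    exact hc
  obtain ⟨h1, h2⟩ := LinearIndependent.pair_iff.1 huv _ _ h0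
  have h3 : Real.sin (x - y) = 0 := by
    rw [Real.sin_sub, ← sub_eq_zero.1 h1, ← sub_eq_zero.1 h2]
    ring
  have := (Real.sin_eq_zero_iff_of_lt_of_lt (by linarith [hx.1, hy.2]) (by linarith [hx.2, hy.1])).1 h3
  linarith

lemma one_le_encard_of_exists {A : Set ℝ} {a b : ℝ} (h : ∃ c ∈ Ioo a b, c ∈ A) :
    1 ≤ (A ∩ Ioo a b).encard := by
  obtain ⟨c, hc, hA⟩ := h
  exact one_le_encard_iff_nonempty.2 ⟨c, hA, hc⟩

lemma encard_inter_Ioo_add {A : Set ℝ} {a b c : ℝ} {k l : ℕ∞} (hab : a ≤ b) (hbc : b ≤ c)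
    (h₁ : k ≤ (A ∩ Ioo a b).encard) (h₂ : l ≤ (A ∩ Ioo b c).encard) :
    k + l ≤ (A ∩ Ioo a c).encard := by
  have hd : Disjoint (A ∩ Ioo a b) (A ∩ Ioo b c) := by
    rw [disjoint_left]
    rintro x ⟨-, -, h⟩ ⟨-, h', -⟩
    exact absurd h (not_lt.2 h'.le)
  calc k + l ≤ (A ∩ Ioo a b).encard + (A ∩ Ioo b c).encard := add_le_add h₁ h₂
    _ = ((A ∩ Ioo a b) ∪ (A ∩ Ioo b c)).encard := (encard_union_eq hd).symm
    _ ≤ _ := encard_le_encard (union_subset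
      (inter_subset_inter_right _ (Ioo_subset_Ioo le_rfl hbc))
      (inter_subset_inter_right _ (Ioo_subset_Ioo hab le_rfl)))

/-- A path from a point inside `V` to a point outside crosses the boundary. -/
lemma exists_crossing {γ : ℝ → RP2} (hγ : Continuous γ) {V K : Set RP2}
    (hV : ∀ S : Set RP2, IsPreconnected S → Disjoint S K → (S ∩ V).Nonempty → S ⊆ V) {a b : ℝ}
    (hab : a < b) (ha : γ a ∉ K) (hb : γ b ∉ K) (h : γ a ∈ V ∧ γ b ∉ V ∨ γ a ∉ V ∧ γ b ∈ V) :
    ∃ c ∈ Ioo a b, c ∈ γ ⁻¹' K := by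
  by_contra! hcon
  have hS : IsPreconnected (γ '' Icc a b) := isPreconnected_Icc.image _ hγ.continuousOn
  have haS : γ a ∈ γ '' Icc a b := mem_image_of_mem _ (left_mem_Icc.2 hab.le)
  have hbS : γ b ∈ γ '' Icc a b := mem_image_of_mem _ (right_mem_Icc.2 hab.le)
  have hd : Disjoint (γ '' Icc a b) K := by
    rw [disjoint_left]
    rintro _ ⟨c, hc, rfl⟩ hcK
    refine hcon c ⟨hc.1.lt_of_ne ?_, hc.2.lt_of_ne ?_⟩ hcK
    · rintro rfl
      exact ha hcK
    · rintro rfl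
      exact hb hcK
  rcases h with ⟨h1, h2⟩ | ⟨h1, h2⟩
  · exact h2 (hV _ hS hd ⟨_, haS, h1⟩ hbS)
  · exact h1 (hV _ hS hd ⟨_, hbS, h2⟩ haS)

lemma IsFlip.exists_crossing {σ : Vec → SignType}
    (hσ : IsFlip (fun v => MvPolynomial.eval v F) (cone (pseudoLine F)) {v | v ≠ 0} σ)
    {u v : Vec} (huv : LinearIndependent ℝ ![u, v]) {a b : ℝ} (hab : a < b)
    (ha : σ (circleVec u v a) ≠ 0) (hb : σ (circleVec u v b) ≠ 0)
    (h : σ (circleVec u v a) ≠ σ (circleVec u v b)) (hF : IsNonsingularCurve m F) :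
    ∃ c ∈ Ioo a b, c ∈ circlePoint huv ⁻¹' pseudoLine F := by
  by_contra! hcon
  have hS : IsPreconnected (circleVec u v '' Icc a b) :=
    isPreconnected_Icc.image _ (continuous_circleVec u v).continuousOn
  refine h ((hσ.mono ?_).const_of_disjoint hS ?_ (mem_image_of_mem _ (left_mem_Icc.2 hab.le))
    (mem_image_of_mem _ (right_mem_Icc.2 hab.le)))
  · rintro _ ⟨c, -, rfl⟩
    exact circleVec_ne_zero huv c
  · rw [disjoint_left]
    rintro _ ⟨c, hc, rfl⟩ hcJ
    refine hcon c ⟨hc.1.lt_of_ne ?_, hc.2.lt_of_ne ?_⟩ hcJ.2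
    · rintro rfl
      exact ha (hσ.eq_zero hF hcJ)
    · rintro rfl
      exact hb (hσ.eq_zero hF hcJ)

/-- If a segment joins points of the disc `D` of the same sign and contains a point of `D` of the
opposite sign, then the line containing it meets the curve in many points. -/
theorem thirteen_le_encard (hF : IsNonsingularCurve m F) {σ : Vec → SignType}
    (hσ : IsFlip (fun v => MvPolynomial.eval v F) (cone (pseudoLine F)) {v | v ≠ 0} σ)
    (hodd : ∀ v ≠ 0, σ (-v) = -σ v) {O D : Set RP2} (hO : IsOval F O)
    (hDO : Disjoint D O) (hDJ : Disjoint D (pseudoLine F))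
    (hD : ∀ S : Set RP2, IsPreconnected S → Disjoint S O → (S ∩ D).Nonempty → S ⊆ D)
    {K L : Set RP2} (hK : K ∈ interiorOvals F O) (hL : L ∈ interiorOvals F O) (hKL : K ≠ L)
    {u v : Vec} (huv : LinearIndependent ℝ ![u, v]) (huD : u ∈ cone D) (hvD : v ∈ cone D)
    (hu1 : σ u = 1) (hv1 : σ v = 1) (huF : MvPolynomial.eval u F ≠ 0)
    (hvF : MvPolynomial.eval v F ≠ 0) (huK : u ∈ cone (ovalInterior K))
    (hvK : v ∉ cone (ovalInterior K)) (hvL : v ∈ cone (ovalInterior L))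
    (huL : u ∉ cone (ovalInterior L)) {a b : ℝ} (ha : 0 < a) (hb : 0 < b)
    (hzD : a • u + b • v ∈ cone D) (hz1 : σ (a • u + b • v) = -1) :
    13 ≤ (realPart F ∩ projLine (Submodule.span ℝ {u, v})).encard := by
  set γ := circlePoint huv with hγdef
  have hγ : Continuous γ := continuous_circlePoint huv
  have hγmem : ∀ (S : Set RP2) (θ : ℝ), γ θ ∈ S ↔ circleVec u v θ ∈ cone S := fun S θ =>
    (mem_cone (circleVec_ne_zero huv θ)).symm
  have hpi := Real.pi_pos
  -- the positions of the three special points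
  have e0 : circleVec u v 0 = u := by simp [circleVec]
  have e1 : circleVec u v (Real.pi / 2) = v := by simp [circleVec]
  have e2 : circleVec u v Real.pi = -u := by simp [circleVec]
  -- The circle crosses the ray of `a • u + b • v` at the angle `θ₀` whose tangent is `b / a`.
  set x := b / a with hx
  have hx0 : 0 < x := div_pos hb ha
  set θ₀ := Real.arctan x with hθ₀
  have hθ0 : 0 < θ₀ := Real.arctan_pos.2 hx0
  have hθ1 : θ₀ < Real.pi / 2 := Real.arctan_lt_pi_div_two x
  obtain ⟨r, hr, ez⟩ : ∃ r : ℝ, 0 < r ∧ circleVec u v θ₀ = r • (a • u + b • v) := by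
    have hs : 0 < √(1 + x ^ 2) := Real.sqrt_pos.2 (by positivity)
    refine ⟨1 / (√(1 + x ^ 2) * a), by positivity, ?_⟩
    rw [circleVec, hθ₀, Real.cos_arctan, Real.sin_arctan, smul_add, smul_smul, smul_smul]
    congr 2
    · field_simp
    · rw [hx]
      field_simp
  have hz0 : a • u + b • v ≠ 0 := hzD.1
  have s0 : σ (circleVec u v 0) = 1 := by rw [e0, hu1]
  have s1 : σ (circleVec u v (Real.pi / 2)) = 1 := by rw [e1, hv1]
  have s2 : σ (circleVec u v Real.pi) = -1 := by rw [e2, hodd u huD.1, hu1]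
  have sz : σ (circleVec u v θ₀) = -1 := by rw [ez, hσ.smul hF hz0 hr, hz1]
  have d0 : γ 0 ∈ D := by rwa [hγmem, e0]
  have d1 : γ (Real.pi / 2) ∈ D := by rwa [hγmem, e1]
  have d2 : γ Real.pi ∈ D := by rwa [hγmem, e2, neg_mem_cone]
  have dz : γ θ₀ ∈ D := by rwa [hγmem, ez, smul_mem_cone hr.ne']
  -- the intersections with the pseudo-line
  have hJO : Disjoint (pseudoLine F) O := by
    rw [disjoint_left]
    rintro p ⟨J, hJ, hp⟩ hpO
    have := (hJ.1.eq_or_disjoint hO.1).resolve_right (not_disjoint_iff.2 ⟨p, hp, hpO⟩)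
    exact hJ.2 (this ▸ hO.2)
  -- The signs at the angles `0`, `θ₀`, `π / 2`, `π` alternate.
  obtain ⟨j₁, hj₁, j₁J⟩ := hσ.exists_crossing huv hθ0 (by rw [s0]; decide) (by rw [sz]; decide)
    (by rw [s0, sz]; decide) hF
  obtain ⟨j₂, hj₂, j₂J⟩ := hσ.exists_crossing huv hθ1 (by rw [sz]; decide) (by rw [s1]; decide)
    (by rw [sz, s1]; decide) hF
  obtain ⟨j₃, hj₃, j₃J⟩ := hσ.exists_crossing huv (by linarith : Real.pi / 2 < Real.pi)
    (by rw [s1]; decide) (by rw [s2]; decide) (by rw [s1, s2]; decide) hF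
  -- between points of `D` and of the pseudo-line there are points of `O`
  have cDJ : ∀ {s t : ℝ}, s < t → γ s ∈ D → γ t ∈ pseudoLine F →
      1 ≤ (γ ⁻¹' O ∩ Ioo s t).encard := fun hst hs ht => one_le_encard_of_exists
    (exists_crossing hγ hD hst (disjoint_left.1 hDO hs) (disjoint_left.1 hJO ht)
      (Or.inl ⟨hs, disjoint_right.1 hDJ ht⟩))
  have cJD : ∀ {s t : ℝ}, s < t → γ s ∈ pseudoLine F → γ t ∈ D →
      1 ≤ (γ ⁻¹' O ∩ Ioo s t).encard := fun hst hs ht => one_le_encard_of_exists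
    (exists_crossing hγ hD hst (disjoint_left.1 hJO hs) (disjoint_left.1 hDO ht)
      (Or.inr ⟨disjoint_right.1 hDJ hs, ht⟩))
  -- Each of the three points of the pseudo-line has a crossing of `O` before and after it.
  have nO : 6 ≤ (γ ⁻¹' O ∩ Ioo 0 Real.pi).encard := by
    have h1 := encard_inter_Ioo_add hj₁.1.le hj₁.2.le (cDJ hj₁.1 d0 j₁J) (cJD hj₁.2 j₁J dz)
    have h2 := encard_inter_Ioo_add hj₂.1.le hj₂.2.le (cDJ hj₂.1 dz j₂J) (cJD hj₂.2 j₂J d1)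
    have h3 := encard_inter_Ioo_add hj₃.1.le hj₃.2.le (cDJ hj₃.1 d1 j₃J) (cJD hj₃.2 j₃J d2)
    have h4 := encard_inter_Ioo_add (by linarith) (by linarith)
      (encard_inter_Ioo_add hθ0.le hθ1.le h1 h2) h3
    convert h4 using 1
    norm_num
  have nJ : 3 ≤ (γ ⁻¹' pseudoLine F ∩ Ioo 0 Real.pi).encard := by
    have h4 := encard_inter_Ioo_add (by linarith) (by linarith)
      (encard_inter_Ioo_add hθ0.le hθ1.le (one_le_encard_of_exists ⟨j₁, hj₁, j₁J⟩)
      (one_le_encard_of_exists ⟨j₂, hj₂, j₂J⟩)) (one_le_encard_of_exists ⟨j₃, hj₃, j₃J⟩)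
    convert h4 using 1
    norm_num
  have hZ : ∀ p, circleVec u v p = u ∨ circleVec u v p = v ∨ circleVec u v p = -u →
      γ p ∉ realPart F := by
    intro p hp h
    rw [hγmem, mem_cone_realPart hF] at h
    rcases hp with hp | hp | hp
    · exact huF (hp ▸ h.2)
    · exact hvF (hp ▸ h.2)
    · rw [hp] at h
      have := ((mem_cone_realPart hF).1 (neg_mem_cone.1 ((mem_cone_realPart hF).2 h))).2
      exact huF this
  have z0 := hZ 0 (Or.inl e0)
  have z1 := hZ _ (Or.inr (Or.inl e1))
  have z2 := hZ _ (Or.inr (Or.inr e2))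
  have hcomp : ∀ (M : Set RP2) (q : RP2) (S : Set RP2), IsPreconnected S → Disjoint S M →
      (S ∩ connectedComponentIn Mᶜ q).Nonempty → S ⊆ connectedComponentIn Mᶜ q := by
    rintro M q S hS hSM ⟨y, hyS, hy⟩
    exact subset_component_of_inter hS (subset_compl_iff_disjoint_right.2 hSM) hyS hy
  -- The angles `0` and `π` give the same point, inside `K`, while `π / 2` gives a point outside:
  -- the line leaves `K` and comes back. The oval `L` is entered and left around `π / 2`.
  have nK : 2 ≤ (γ ⁻¹' K ∩ Ioo 0 Real.pi).encard := by
    have k0 : γ 0 ∈ ovalInterior K := by rwa [hγmem, e0]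
    have i0 : γ 0 ∈ connectedComponentIn Kᶜ (γ 0) := mem_connectedComponentIn k0.1
    have i1 : γ (Real.pi / 2) ∉ connectedComponentIn Kᶜ (γ 0) := fun h => hvK (by
      have := component_subset_ovalInterior k0 h
      rwa [hγmem, e1] at this)
    have e02 : γ Real.pi = γ 0 := by
      change Projectivization.mk ℝ _ _ = Projectivization.mk ℝ _ _
      rw [Projectivization.mk_eq_mk_iff']
      exact ⟨-1, by rw [e0, e2, neg_one_smul]⟩
    have i2 : γ Real.pi ∈ connectedComponentIn Kᶜ (γ 0) := by rwa [e02]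
    have hKF := hK.1.1.subset
    have h4 := encard_inter_Ioo_add (by linarith) (by linarith)
      (one_le_encard_of_exists (exists_crossing hγ (hcomp K (γ 0)) (by linarith : 0 < Real.pi / 2)
        (fun h => z0 (hKF h)) (fun h => z1 (hKF h)) (Or.inl ⟨i0, i1⟩)))
      (one_le_encard_of_exists (exists_crossing hγ (hcomp K (γ 0))
        (by linarith : Real.pi / 2 < Real.pi)
        (fun h => z1 (hKF h)) (fun h => z2 (hKF h)) (Or.inr ⟨i1, i2⟩)))
    convert h4 using 1
    norm_num
  have nL : 2 ≤ (γ ⁻¹' L ∩ Ioo 0 Real.pi).encard := by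
    have k1 : γ (Real.pi / 2) ∈ ovalInterior L := by rwa [hγmem, e1]
    have i1 : γ (Real.pi / 2) ∈ connectedComponentIn Lᶜ (γ (Real.pi / 2)) :=
      mem_connectedComponentIn k1.1
    have i0 : γ 0 ∉ connectedComponentIn Lᶜ (γ (Real.pi / 2)) := fun h => huL (by
      have := component_subset_ovalInterior k1 h
      rwa [hγmem, e0] at this)
    have i2 : γ Real.pi ∉ connectedComponentIn Lᶜ (γ (Real.pi / 2)) := fun h => huL (by
      have := component_subset_ovalInterior k1 h
      rwa [hγmem, e2, neg_mem_cone] at this)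
    have hLF := hL.1.1.subset
    have h4 := encard_inter_Ioo_add (by linarith) (by linarith)
      (one_le_encard_of_exists (exists_crossing hγ (hcomp L (γ (Real.pi / 2)))
        (by linarith : 0 < Real.pi / 2)
        (fun h => z0 (hLF h)) (fun h => z1 (hLF h)) (Or.inr ⟨i0, i1⟩)))
      (one_le_encard_of_exists (exists_crossing hγ (hcomp L (γ (Real.pi / 2)))
        (by linarith : Real.pi / 2 < Real.pi)
        (fun h => z1 (hLF h)) (fun h => z2 (hLF h)) (Or.inl ⟨i1, i2⟩)))
    convert h4 using 1
    norm_num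
  have dKO : ∀ M ∈ interiorOvals F O, Disjoint M O := fun M hM =>
    disjoint_left.2 fun y hy => (hM.2 hy).1
  have dJ : ∀ M, IsOval F M → Disjoint (pseudoLine F) M := by
    intro M hM
    rw [disjoint_left]
    rintro p ⟨J, hJ, hp⟩ hpM
    have := (hJ.1.eq_or_disjoint hM.1).resolve_right (not_disjoint_iff.2 ⟨p, hp, hpM⟩)
    exact hJ.2 (this ▸ hM.2)
  have dKL : Disjoint K L := (hK.1.1.eq_or_disjoint hL.1.1).resolve_left hKL
  have dpre : ∀ {A B : Set RP2}, Disjoint A B →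
      Disjoint (γ ⁻¹' A ∩ Ioo 0 Real.pi) (γ ⁻¹' B ∩ Ioo 0 Real.pi) := fun h =>
    (h.preimage γ).mono inter_subset_left inter_subset_left
  have hsum : 13 ≤ (γ ⁻¹' realPart F ∩ Ioo 0 Real.pi).encard := by
    have hsub : ∀ {A : Set RP2}, A ⊆ realPart F →
        γ ⁻¹' A ∩ Ioo 0 Real.pi ⊆ γ ⁻¹' realPart F ∩ Ioo 0 Real.pi := fun h =>
      inter_subset_inter_left _ (preimage_mono h)
    calc (13 : ℕ∞) = 6 + 3 + 2 + 2 := by norm_num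
      _ ≤ _ := add_le_add (add_le_add (add_le_add nO nJ) nK) nL
      _ = (γ ⁻¹' O ∩ Ioo 0 Real.pi ∪ γ ⁻¹' pseudoLine F ∩ Ioo 0 Real.pi ∪
          γ ⁻¹' K ∩ Ioo 0 Real.pi ∪ γ ⁻¹' L ∩ Ioo 0 Real.pi).encard := by
        rw [encard_union_eq, encard_union_eq, encard_union_eq]
        · exact dpre hJO.symm
        · exact disjoint_union_left.2 ⟨dpre (dKO K hK).symm, dpre (dJ K hK.1)⟩
        · exact disjoint_union_left.2 ⟨disjoint_union_left.2
            ⟨dpre (dKO L hL).symm, dpre (dJ L hL.1)⟩, dpre dKL⟩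
      _ ≤ _ := encard_le_encard (union_subset (union_subset (union_subset (hsub hO.1.subset)
          (hsub pseudoLine_subset)) (hsub hK.1.1.subset)) (hsub hL.1.1.subset))
  rw [← ((injOn_circlePoint huv).mono inter_subset_right).encard_image] at hsum
  refine hsum.trans (encard_le_encard ?_)
  rintro _ ⟨θ, ⟨hθ, -⟩, rfl⟩
  refine ⟨hθ, ?_⟩
  change (Projectivization.mk ℝ _ _).submodule ≤ _
  rw [Projectivization.submodule_mk, Submodule.span_singleton_le_iff_mem, circleVec]
  exact Submodule.add_mem _ (Submodule.smul_mem _ _ (Submodule.subset_span (by simp)))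
    (Submodule.smul_mem _ _ (Submodule.subset_span (by simp)))

/-! ### The case where the origin is in the convex hull. -/

lemma linearIndependent_pair_of_mk_ne {u v : Vec} (hu : u ≠ 0) (hv : v ≠ 0)
    (h : Projectivization.mk ℝ u hu ≠ Projectivization.mk ℝ v hv) :
    LinearIndependent ℝ ![u, v] := by
  rw [LinearIndependent.pair_iff' hu]
  intro a ha
  exact h ((Projectivization.mk_eq_mk_iff' ℝ _ _ _ _).2
    ⟨a⁻¹, by rw [← ha, inv_smul_smul₀]; rintro rfl; exact hv (by rw [← ha, zero_smul])⟩)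

lemma finrank_span_pair {u v : Vec} (huv : LinearIndependent ℝ ![u, v]) :
    Module.finrank ℝ (Submodule.span ℝ {u, v}) = 2 := by
  have h := finrank_span_eq_card huv
  have hr : range ![u, v] = {u, v} := by
    ext w
    simp [eq_comm, or_comm]
  rw [hr] at h
  simpa using h

lemma mk_mem_projLine {v : Vec} (hv : v ≠ 0) {l : Submodule ℝ Vec} :
    Projectivization.mk ℝ v hv ∈ projLine l ↔ v ∈ l := by
  change (Projectivization.mk ℝ v hv).submodule ≤ l ↔ _
  rw [Projectivization.submodule_mk, Submodule.span_singleton_le_iff_mem]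

/-- If the origin is a convex combination of the representatives of the interior ovals of sign `1`,
then some line through two of them meets the curve in at least 13 points. -/
theorem exists_line_of_zero_mem_convexHull (hF : IsNonsingularCurve m F) {σ : Vec → SignType}
    (hσ : IsFlip (fun v => MvPolynomial.eval v F) (cone (pseudoLine F)) {v | v ≠ 0} σ)
    (hodd : ∀ v ≠ 0, σ (-v) = -σ v) {O D : Set RP2} (hO : IsNonemptyOval F O)
    (huniq : ∀ K, IsNonemptyOval F K → K = O) (hDo : IsOpen D) (hDc : IsPreconnected D)
    (hDO : Disjoint D O) (hDJ : Disjoint D (pseudoLine F))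
    (hD : ∀ S : Set RP2, IsPreconnected S → Disjoint S O → (S ∩ D).Nonempty → S ⊆ D)
    (hDI : ∀ K ∈ interiorOvals F O, ovalInterior K ⊆ D) {x : Set RP2 → Vec}
    (hx : ∀ K ∈ interiorOvals F O, x K ∈ cone (ovalInterior K))
    (hx1 : ∀ K ∈ interiorOvals F O, σ (x K) = 1)
    (h0 : (0 : Vec) ∈ convexHull ℝ (x '' interiorOvals F O)) :
    ∃ K ∈ interiorOvals F O, ∃ L ∈ interiorOvals F O, K ≠ L ∧
      LinearIndependent ℝ ![x K, x L] ∧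
      13 ≤ (realPart F ∩ projLine (Submodule.span ℝ {x K, x L})).encard := by
  set H : Set Vec := {v | v ∈ cone D ∧ σ v = -1}
  have hH : IsPreconnected H := isPreconnected_half_cone hF hσ hodd hDo hDc hDJ (by decide)
  have hne : ∀ K ∈ interiorOvals F O, x K ≠ 0 := fun K hK => (hx K hK).1
  have hnot : ∀ K ∈ interiorOvals F O, ∀ L ∈ interiorOvals F O, K ≠ L →
      x K ∉ cone (ovalInterior L) := fun K hK L hL hKL h =>
    disjoint_left.1 (disjoint_ovalInterior huniq hF hK hL hKL) (hx K hK).2 h.2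
  have hxF : ∀ K ∈ interiorOvals F O, MvPolynomial.eval (x K) F ≠ 0 := fun K hK h =>
    notMem_realPart_of_mem_ovalInterior huniq hK (hx K hK).2 ((mk_mem_realPart hF (hne K hK)).2 h)
  have hind : ∀ K ∈ interiorOvals F O, ∀ L ∈ interiorOvals F O, K ≠ L →
      LinearIndependent ℝ ![x K, x L] := by
    intro K hK L hL hKL
    refine linearIndependent_pair_of_mk_ne (hne K hK) (hne L hL) fun h => hnot K hK L hL hKL ?_
    exact ⟨hne K hK, h ▸ (hx L hL).2⟩
  have hneg : ∀ K ∈ interiorOvals F O, -x K ∈ H := fun K hK =>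
    ⟨neg_mem_cone.2 (cone_mono (hDI K hK) (hx K hK)), by rw [hodd _ (hne K hK), hx1 K hK]⟩
  by_contra! hcon
  -- If no such line exists, `H` avoids every cone on two representatives: the edges carry sign `1`,
  -- and `thirteen_le_encard` excludes the interior.
  have hC : ∀ K ∈ interiorOvals F O, ∀ L ∈ interiorOvals F O, K ≠ L → ∀ a b : ℝ, 0 ≤ a → 0 ≤ b →
      a • x K + b • x L ∉ H := by
    intro K hK L hL hKL a b ha hb hab
    have hsingle : ∀ M ∈ interiorOvals F O, ∀ c : ℝ, 0 ≤ c → c • x M ∉ H := by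
      rintro M hM c hc ⟨h1, h2⟩
      rcases hc.eq_or_lt with rfl | hc
      · exact cone_ne_zero h1 (zero_smul ℝ _)
      · rw [hσ.smul hF (hne M hM) hc, hx1 M hM] at h2
        exact absurd h2 (by decide)
    rcases ha.eq_or_lt with rfl | ha
    · exact hsingle L hL b hb (by simpa using hab)
    rcases hb.eq_or_lt with rfl | hb
    · exact hsingle K hK a ha.le (by simpa using hab)
    exact absurd (thirteen_le_encard hF hσ hodd hO.1 hDO hDJ hD hK hL hKL (hind K hK L hL hKL)
      (cone_mono (hDI K hK) (hx K hK)) (cone_mono (hDI L hL) (hx L hL)) (hx1 K hK) (hx1 L hL)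
      (hxF K hK) (hxF L hL) (hx K hK) (hnot L hL K hK hKL.symm) (hx L hL) (hnot K hK L hL hKL)
      ha hb hab.1 hab.2) (not_le.2 (hcon K hK L hL hKL (hind K hK L hL hKL)))
  -- Carathéodory's theorem; affine independence in three-space leaves at most four vectors.
  obtain ⟨ι, _, z', w', hz', haff', hw', hsum', hzero'⟩ := eq_pos_convex_span_of_mem_convexHull h0
  let e := Fintype.equivFin ι
  obtain ⟨n, hn⟩ : ∃ n, n = Fintype.card ι := ⟨_, rfl⟩
  have hcard : n ≤ 4 := by
    have h1 := haff'.card_le_finrank_succ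
    have h2 := (Submodule.finrank_le (vectorSpan ℝ (range z')))
    rw [Module.finrank_fin_fun] at h2
    exact hn.le.trans (h1.trans (Nat.add_le_add_right h2 1))
  obtain ⟨z, w, hz, haff, hw, hsum, hzero⟩ : ∃ (z : Fin n → Vec) (w : Fin n → ℝ),
      (∀ i, ∃ K ∈ interiorOvals F O, x K = z i) ∧ AffineIndependent ℝ z ∧ (∀ i, 0 < w i) ∧
      ∑ i, w i = 1 ∧ ∑ i, w i • z i = 0 := by
    subst hn
    refine ⟨z' ∘ e.symm, w' ∘ e.symm, fun i => hz' ⟨_, rfl⟩, haff'.comp_embedding e.symm.toEmbedding,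
      fun i => hw' _, ?_, ?_⟩
    · rw [← hsum']
      exact e.symm.sum_comp w'
    · rw [← hzero']
      exact e.symm.sum_comp fun i => w' i • z' i
  choose K hKI hKz using hz
  have hKne : ∀ i j, i ≠ j → K i ≠ K j := fun i j hij h =>
    hij (haff.injective (by rw [← hKz, ← hKz, h]))
  have hC' : ∀ i j, i ≠ j → ∀ a b : ℝ, 0 ≤ a → 0 ≤ b → a • z i + b • z j ∉ H := by
    intro i j hij a b ha hb
    rw [← hKz, ← hKz]
    exact hC _ (hKI i) _ (hKI j) (hKne i j hij) a b ha hb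
  have hneg' : ∀ i, -z i ∈ H := fun i => hKz i ▸ hneg _ (hKI i)
  -- every vertex is opposite to a nonnegative combination of the others
  interval_cases n
  · simp at hsum
  · have h1 := hneg' 0
    simp only [Finset.univ_unique, Fin.default_eq_zero, Fin.isValue, Finset.sum_singleton] at hzero
    have h2 := (smul_eq_zero.1 hzero).resolve_left (hw 0).ne'
    rw [h2, neg_zero] at h1
    exact cone_ne_zero h1.1 rfl
  · rw [Fin.sum_univ_two] at hzero
    have h1 : -z 0 = (0 : ℝ) • z 0 + (w 1 / w 0) • z 1 := by
      rw [zero_smul, zero_add, ← smul_right_injective Vec (hw 0).ne' |>.eq_iff, smul_smul,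
        mul_div_cancel₀ _ (hw 0).ne', smul_neg]
      exact neg_eq_of_add_eq_zero_right hzero
    have h2 := hneg' 0
    rw [h1] at h2
    exact hC' 0 1 (by decide) _ _ le_rfl (div_pos (hw 1) (hw 0)).le h2
  · rw [Fin.sum_univ_three] at hzero
    have h1 : -z 2 = (w 0 / w 2) • z 0 + (w 1 / w 2) • z 1 := by
      rw [← smul_right_injective Vec (hw 2).ne' |>.eq_iff, smul_add, smul_smul, smul_smul,
        mul_div_cancel₀ _ (hw 2).ne', mul_div_cancel₀ _ (hw 2).ne', smul_neg]
      exact neg_eq_of_add_eq_zero_left hzero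
    have h2 := hneg' 2
    rw [h1] at h2
    exact hC' 0 1 (by decide) _ _ (div_pos (hw 0) (hw 2)).le (div_pos (hw 1) (hw 2)).le h2
  · rw [Fin.sum_univ_four] at hzero hsum
    have hli : LinearIndependent ℝ ![z 0, z 1, z 2] := by
      rw [Fintype.linearIndependent_iff]
      intro g hg
      rw [Fin.sum_univ_three] at hg
      simp only [Matrix.cons_val_zero, Matrix.cons_val_one, Matrix.cons_val] at hg
      -- Subtracting `s` times `∑ i, w i • z i = 0` turns a linear relation among three vectors into
      -- an affine relation among four. It must be trivial, and `w 3 ≠ 0` then forces `s = 0`.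
      set s := g 0 + g 1 + g 2 with hs
      have h1 := (affineIndependent_iff.1 haff) Finset.univ
        ![g 0 - s * w 0, g 1 - s * w 1, g 2 - s * w 2, -(s * w 3)] (by
          rw [Fin.sum_univ_four]
          simp only [Matrix.cons_val_zero, Matrix.cons_val_one, Matrix.cons_val]
          linear_combination -s * hsum - hs) (by
          rw [Fin.sum_univ_four]
          simp only [Matrix.cons_val_zero, Matrix.cons_val_one, Matrix.cons_val]
          have : (g 0 - s * w 0) • z 0 + (g 1 - s * w 1) • z 1 + (g 2 - s * w 2) • z 2 +
              (-(s * w 3)) • z 3 = (g 0 • z 0 + g 1 • z 1 + g 2 • z 2) -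
              s • (w 0 • z 0 + w 1 • z 1 + w 2 • z 2 + w 3 • z 3) := by module
          rw [this, hg, hzero, smul_zero, sub_zero])
      have h3 := h1 3 (Finset.mem_univ _)
      simp only [Matrix.cons_val, neg_eq_zero] at h3
      have hs0 : s = 0 := (mul_eq_zero.1 h3).resolve_right (hw 3).ne'
      intro i
      fin_cases i
      · simpa [hs0] using h1 0 (Finset.mem_univ _)
      · simpa [hs0] using h1 1 (Finset.mem_univ _)
      · simpa [hs0] using h1 2 (Finset.mem_univ _)
    let B : Module.Basis (Fin 3) ℝ Vec := basisOfLinearIndependentOfCardEqFinrank hli (by simp)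
    have hB : ∀ i, B i = ![z 0, z 1, z 2] i := fun i => by
      rw [coe_basisOfLinearIndependentOfCardEqFinrank]
    have hrepr : ∀ v, v = B.coord 0 v • z 0 + B.coord 1 v • z 1 + B.coord 2 v • z 2 := by
      intro v
      conv_lhs => rw [← B.sum_repr v]
      rw [Fin.sum_univ_three, hB, hB, hB]
      rfl
    have hcoord : ∀ i, Continuous (B.coord i) := fun i => LinearMap.continuous_of_finiteDimensional _
    -- The least coordinate is positive at `-z 3` and negative at `-z 0`, so it vanishes somewhere
    -- on the connected `H`, at a point of the cone on two of the vectors.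
    let f : Vec → ℝ := fun v => min (B.coord 0 v) (min (B.coord 1 v) (B.coord 2 v))
    have hf : Continuous f := (hcoord 0).min ((hcoord 1).min (hcoord 2))
    have hBz : ∀ i j, B.coord i (![z 0, z 1, z 2] j) = if i = j then 1 else 0 := by
      intro i j
      rw [← hB, Module.Basis.coord_apply, Module.Basis.repr_self, Finsupp.single_apply]
      simp only [eq_comm]
    have hf3 : 0 < f (-z 3) := by
      have h1 : -z 3 = (w 0 / w 3) • z 0 + (w 1 / w 3) • z 1 + (w 2 / w 3) • z 2 := by
        rw [← smul_right_injective Vec (hw 3).ne' |>.eq_iff, smul_add, smul_add, smul_smul,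
          smul_smul, smul_smul, mul_div_cancel₀ _ (hw 3).ne', mul_div_cancel₀ _ (hw 3).ne',
          mul_div_cancel₀ _ (hw 3).ne', smul_neg]
        exact neg_eq_of_add_eq_zero_left hzero
      have hc : ∀ i, B.coord i (-z 3) = ![w 0 / w 3, w 1 / w 3, w 2 / w 3] i := by
        intro i
        have h00 := hBz i 0
        have h01 := hBz i 1
        have h02 := hBz i 2
        simp only [Matrix.cons_val_zero, Matrix.cons_val_one, Matrix.cons_val] at h00 h01 h02
        rw [h1, map_add, map_add, map_smul, map_smul, map_smul, h00, h01, h02]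
        fin_cases i <;> simp
      simp only [f, hc, lt_min_iff]
      exact ⟨div_pos (hw 0) (hw 3), div_pos (hw 1) (hw 3), div_pos (hw 2) (hw 3)⟩
    have hf0 : f (-z 0) < 0 := by
      have h00 := hBz 0 0
      simp only [Matrix.cons_val_zero, if_true] at h00
      refine min_lt_of_left_lt ?_
      rw [map_neg, h00]
      norm_num
    obtain ⟨v, hvH, hv0⟩ := hH.intermediate_value (hneg' 0) (hneg' 3) hf.continuousOn
      ⟨hf0.le, hf3.le⟩
    have hc0 : 0 ≤ B.coord 0 v := hv0 ▸ min_le_left _ _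
    have hc1 : 0 ≤ B.coord 1 v := hv0 ▸ (min_le_right _ _).trans (min_le_left _ _)
    have hc2 : 0 ≤ B.coord 2 v := hv0 ▸ (min_le_right _ _).trans (min_le_right _ _)
    rw [hrepr v] at hvH
    rcases min_choice (B.coord 0 v) (min (B.coord 1 v) (B.coord 2 v)) with h | h
    · have h' : B.coord 0 v = 0 := h.symm.trans hv0
      rw [h', zero_smul, zero_add] at hvH
      exact hC' 1 2 (by decide) _ _ hc1 hc2 hvH
    · have h' : min (B.coord 1 v) (B.coord 2 v) = 0 := h.symm.trans hv0
      rcases min_choice (B.coord 1 v) (B.coord 2 v) with h2 | h2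
      · rw [h2.symm.trans h', zero_smul, add_zero] at hvH
        exact hC' 0 2 (by decide) _ _ hc0 hc2 hvH
      · rw [h2.symm.trans h', zero_smul, add_zero] at hvH
        exact hC' 0 1 (by decide) _ _ hc0 hc1 hvH

/-! ### Convex polygons in the Euclidean plane. -/

/-- The Euclidean plane. -/
abbrev Plane : Type := EuclideanSpace ℝ (Fin 2)

/-- Twice the signed area of a triangle. -/
def area (a b c : Plane) : ℝ := (b 0 - a 0) * (c 1 - a 1) - (b 1 - a 1) * (c 0 - a 0)

lemma area_rotate (a b c : Plane) : area a b c = area b c a := by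
  unfold area
  ring

lemma area_combo (a b y z : Plane) {s t : ℝ} (hst : s + t = 1) :
    area a b (s • y + t • z) = s * area a b y + t * area a b z := by
  have : t = 1 - s := by linarith
  subst this
  simp only [area, PiLp.add_apply, PiLp.smul_apply, smul_eq_mul]
  ring

lemma area_self_left (a b : Plane) : area a b a = 0 := by
  simp [area]

lemma area_self_right (a b : Plane) : area a b b = 0 := by
  unfold area
  ring

/-- Cramer's rule for `x - a` in terms of `b - a` and `c - a`. -/
lemma area_smul_sub (a b c x : Plane) :
    area a b c • (x - a) = area a x c • (b - a) + area a b x • (c - a) := by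
  ext i
  fin_cases i <;> simp [area] <;> ring

lemma convex_area_nonneg (a b : Plane) : Convex ℝ {x | 0 ≤ area a b x} := by
  intro y hy z hz s t hs ht hst
  rw [mem_ofPred_eq, area_combo _ _ _ _ hst]
  exact add_nonneg (mul_nonneg hs hy) (mul_nonneg ht hz)

lemma area_eq_zero_of_mem_segment {a b x : Plane} (hx : x ∈ segment ℝ a b) : area a b x = 0 := by
  obtain ⟨s, t, -, -, hst, rfl⟩ := hx
  rw [area_combo _ _ _ _ hst, area_self_left, area_self_right]
  simp

lemma exists_weights_of_mem_convexHull_range {ι E : Type*} [Fintype ι] [AddCommGroup E] [Module ℝ E]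
    {p : ι → E} {x : E} (hx : x ∈ convexHull ℝ (range p)) :
    ∃ w : ι → ℝ, (∀ i, 0 ≤ w i) ∧ ∑ i, w i = 1 ∧ ∑ i, w i • p i = x := by
  classical
  have hsub : convexHull ℝ (range p) ⊆
      {x | ∃ w : ι → ℝ, (∀ i, 0 ≤ w i) ∧ ∑ i, w i = 1 ∧ ∑ i, w i • p i = x} := by
    refine convexHull_min ?_ ?_
    · rintro _ ⟨i, rfl⟩
      refine ⟨Pi.single i 1, fun j => ?_, by simp, by simp [Pi.single_apply]⟩
      by_cases h : j = i
      · subst h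
        simp
      · simp [h]
    · rintro _ ⟨w, hw0, hw1, rfl⟩ _ ⟨w', hw0', hw1', rfl⟩ s t hs ht hst
      refine ⟨fun i => s * w i + t * w' i, fun i => add_nonneg (mul_nonneg hs (hw0 i))
        (mul_nonneg ht (hw0' i)), ?_, ?_⟩
      · rw [Finset.sum_add_distrib, ← Finset.mul_sum, ← Finset.mul_sum, hw1, hw1', mul_one, mul_one,
          hst]
      · simp only [add_smul, mul_smul, Finset.sum_add_distrib, Finset.smul_sum]
  exact hsub hx

/-- The vertices of a strictly convex polygon, in counterclockwise order. -/
def IsConvexCycle {n : ℕ} (p : ZMod n → Plane) : Prop :=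
  ∀ i j, j ≠ i → j ≠ i + 1 → 0 < area (p i) (p (i + 1)) (p j)

section cycle

variable {n : ℕ} {p : ZMod n → Plane}

lemma zmod_add_two_ne (hn : 3 ≤ n) (i : ZMod n) : i + 1 + 1 ≠ i := by
  intro h
  rw [add_assoc, add_eq_left] at h
  have h2 : ((2 : ℕ) : ZMod n) = 0 := by
    push_cast
    rw [← h]
    norm_num
  rw [ZMod.natCast_eq_zero_iff] at h2
  exact absurd (Nat.le_of_dvd (by norm_num) h2) (by omega)

lemma zmod_add_one_ne (hn : 3 ≤ n) (i : ZMod n) : i + 1 ≠ i := by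
  intro h
  have : i + 1 + 1 = i := by rw [h, h]
  exact zmod_add_two_ne hn i this

lemma IsConvexCycle.inter_succ (hp : IsConvexCycle p) (hn : 3 ≤ n) (i : ZMod n) :
    segment ℝ (p i) (p (i + 1)) ∩ segment ℝ (p (i + 1)) (p (i + 1 + 1)) = {p (i + 1)} := by
  refine Subset.antisymm ?_ (singleton_subset_iff.2
    ⟨right_mem_segment ℝ _ _, left_mem_segment ℝ _ _⟩)
  rintro x ⟨hx, s, t, hs, ht, hst, rfl⟩
  have h := area_eq_zero_of_mem_segment hx
  rw [area_combo _ _ _ _ hst, area_self_right, mul_zero, zero_add] at h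
  have hpos := hp i (i + 1 + 1) (zmod_add_two_ne hn i) (zmod_add_one_ne hn _)
  have ht0 : t = 0 := (mul_eq_zero.1 h).resolve_right hpos.ne'
  have hs1 : s = 1 := by linarith
  rw [ht0, hs1, zero_smul, one_smul, add_zero]
  rfl

/-- The area over the first edge vanishes on that edge and is positive at both ends of the second.
-/
lemma IsConvexCycle.disjoint (hp : IsConvexCycle p) {i j : ZMod n} (h₁ : j ≠ i) (h₂ : j ≠ i + 1)
    (h₃ : i ≠ j + 1) :
    Disjoint (segment ℝ (p i) (p (i + 1))) (segment ℝ (p j) (p (j + 1))) := by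
  rw [disjoint_left]
  rintro x hx ⟨s, t, hs, ht, hst, rfl⟩
  have h := area_eq_zero_of_mem_segment hx
  rw [area_combo _ _ _ _ hst] at h
  have hpos := hp i j h₁ h₂
  have hpos' := hp i (j + 1) h₃.symm fun h => h₁ (add_right_cancel h)
  rcases hs.eq_or_lt with rfl | hs
  · have : t = 1 := by linarith
    subst this
    linarith
  · have := mul_pos hs hpos
    have := mul_nonneg ht hpos'.le
    linarith

lemma IsConvexCycle.ne_succ (hp : IsConvexCycle p) (hn : 3 ≤ n) (i : ZMod n) :
    p i ≠ p (i + 1) := by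
  intro h
  have hpos := hp i (i + 1 + 1) (zmod_add_two_ne hn i) (zmod_add_one_ne hn _)
  rw [← h] at hpos
  simp [area] at hpos

lemma IsConvexCycle.area_nonneg (hp : IsConvexCycle p) (i : ZMod n) {x : Plane}
    (hx : x ∈ convexHull ℝ (range p)) : 0 ≤ area (p i) (p (i + 1)) x := by
  refine convexHull_min ?_ (convex_area_nonneg _ _) hx
  rintro _ ⟨j, rfl⟩
  by_cases h1 : j = i
  · subst h1
    exact (area_self_left _ _).ge
  by_cases h2 : j = i + 1
  · subst h2
    exact (area_self_right _ _).ge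
  exact (hp i j h1 h2).le

/-- Pushing a point of the edge slightly away from a third vertex makes the area over the edge
negative, so the point leaves the hull. -/
lemma IsConvexCycle.segment_subset_frontier (hp : IsConvexCycle p) (hn : 3 ≤ n) (i : ZMod n) :
    segment ℝ (p i) (p (i + 1)) ⊆ frontier (convexHull ℝ (range p)) := by
  intro x hx
  have hxC : x ∈ convexHull ℝ (range p) := (convex_convexHull ℝ (range p)).segment_subset
    (subset_convexHull ℝ _ ⟨i, rfl⟩) (subset_convexHull ℝ _ ⟨i + 1, rfl⟩) hx
  refine ⟨subset_closure hxC, fun hint => ?_⟩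
  set q := p (i + 1 + 1)
  have hq : 0 < area (p i) (p (i + 1)) q :=
    hp i (i + 1 + 1) (zmod_add_two_ne hn i) (zmod_add_one_ne hn _)
  have hcont : Tendsto (fun ε : ℝ => (1 + ε) • x + (-ε) • q) (𝓝[>] 0) (𝓝 x) := by
    have : Continuous fun ε : ℝ => (1 + ε) • x + (-ε) • q := by fun_prop
    have h := this.tendsto 0
    simp only [add_zero, one_smul, neg_zero, zero_smul] at h
    exact h.mono_left nhdsWithin_le_nhds
  obtain ⟨ε, hε, hε0⟩ := ((hcont.eventually (mem_interior_iff_mem_nhds.1 hint)).and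
    self_mem_nhdsWithin).exists
  have h := hp.area_nonneg i hε
  rw [area_combo _ _ _ _ (by ring), area_eq_zero_of_mem_segment hx] at h
  have := mul_pos (mem_Ioi.1 hε0) hq
  linarith

/-- Take a supporting linear form at `x`. By Cramer's rule at a vertex where it is maximal, a
second, non-adjacent maximal vertex would make both neighbours maximal, then all vertices, against
the nonempty interior. So the weights of `x` sit on two consecutive vertices. -/
lemma IsConvexCycle.frontier_subset [NeZero n] (hp : IsConvexCycle p) (hn : 3 ≤ n)
    (hint : (interior (convexHull ℝ (range p))).Nonempty) :
    frontier (convexHull ℝ (range p)) ⊆ ⋃ i, segment ℝ (p i) (p (i + 1)) := by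
  intro x hx
  have hconv := convex_convexHull ℝ (range p)
  have hclosed : IsClosed (convexHull ℝ (range p)) := (finite_range p).isClosed_convexHull (𝕜 := ℝ)
  have hxC : x ∈ convexHull ℝ (range p) := hclosed.closure_eq ▸ hx.1
  obtain ⟨f, hf⟩ := geometric_hahn_banach_open_point hconv.interior isOpen_interior hx.2
  have hle : ∀ y ∈ convexHull ℝ (range p), f y ≤ f x := by
    intro y hy
    have : y ∈ closure (interior (convexHull ℝ (range p))) := by
      rw [hconv.closure_interior_eq_closure_of_nonempty_interior hint]
      exact subset_closure hy
    exact closure_minimal (fun z hz => (hf z hz).le) (isClosed_le f.continuous continuous_const)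
      this
  have hlep : ∀ i, f (p i) ≤ f x := fun i => hle _ (subset_convexHull ℝ _ ⟨i, rfl⟩)
  have hnot : ¬ ∀ i, f (p i) = f x := by
    intro h
    obtain ⟨y, hy⟩ := hint
    have hsub : convexHull ℝ (range p) ⊆ {z | f z = f x} := by
      refine convexHull_min ?_ (convex_hyperplane f.isLinear _)
      rintro _ ⟨i, rfl⟩
      exact h i
    exact (hf y hy).ne (hsub (interior_subset hy))
  have hcone : ∀ i j, area (p i) (p (i + 1)) (p (i - 1)) * (f (p j) - f (p i)) =
      area (p (i - 1)) (p i) (p j) * (f (p (i + 1)) - f (p i)) +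
      area (p i) (p (i + 1)) (p j) * (f (p (i - 1)) - f (p i)) := by
    intro i j
    have h := congrArg f (area_smul_sub (p i) (p (i + 1)) (p (i - 1)) (p j))
    rw [← area_rotate (p (i - 1)) (p i) (p j)] at h
    simpa using h
  have hpred : ∀ i : ZMod n, i - 1 ≠ i ∧ i - 1 ≠ i + 1 := by
    intro i
    constructor
    · intro h
      exact zmod_add_one_ne hn (i - 1) (by rw [sub_add_cancel]; exact h.symm)
    · intro h
      exact zmod_add_two_ne hn (i - 1) (by rw [sub_add_cancel]; exact h.symm)
  have hpos : ∀ i, 0 < area (p i) (p (i + 1)) (p (i - 1)) := fun i =>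
    hp i (i - 1) (hpred i).1 (hpred i).2
  have hboth : ∀ i, f (p i) = f x → ¬ (f (p (i + 1)) = f x ∧ f (p (i - 1)) = f x) := by
    rintro i hi ⟨h1, h2⟩
    refine hnot fun j => ?_
    have h := hcone i j
    rw [h1, h2, hi, sub_self, mul_zero, mul_zero, add_zero] at h
    linarith [(mul_eq_zero.1 h).resolve_left (hpos i).ne']
  have hface : ∀ i j, f (p i) = f x → f (p j) = f x → j = i ∨ j = i + 1 ∨ j = i - 1 := by
    intro i j hi hj
    by_contra! hcon
    obtain ⟨h0, h1, h2⟩ := hcon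
    have h := hcone i j
    have a1 : 0 < area (p i) (p (i + 1)) (p j) := hp i j h0 h1
    have a2 : 0 < area (p (i - 1)) (p i) (p j) := by
      have := hp (i - 1) j h2
      rw [sub_add_cancel] at this
      exact this h0
    rw [hi, hj, sub_self, mul_zero] at h
    have b1 := mul_nonneg a2.le (sub_nonneg.2 (hlep (i + 1)))
    have b2 := mul_nonneg a1.le (sub_nonneg.2 (hlep (i - 1)))
    have c1 : area (p (i - 1)) (p i) (p j) * (f x - f (p (i + 1))) = 0 := by linarith
    have c2 : area (p i) (p (i + 1)) (p j) * (f x - f (p (i - 1))) = 0 := by linarith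
    refine hboth i hi ⟨?_, ?_⟩
    · linarith [(mul_eq_zero.1 c1).resolve_left a2.ne']
    · linarith [(mul_eq_zero.1 c2).resolve_left a1.ne']
  obtain ⟨w, hw0, hw1, hwx⟩ : ∃ w : ZMod n → ℝ, (∀ i, 0 ≤ w i) ∧ ∑ i, w i = 1 ∧
      ∑ i, w i • p i = x := exists_weights_of_mem_convexHull_range hxC
  have hwface : ∀ i, w i ≠ 0 → f (p i) = f x := by
    intro i hi
    have h1 : ∑ j, w j * (f x - f (p j)) = 0 := by
      have h2 := congrArg f hwx
      simp only [map_sum, map_smul, smul_eq_mul] at h2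
      simp only [mul_sub, Finset.sum_sub_distrib, ← Finset.sum_mul, hw1, h2, one_mul, sub_self]
    rw [Finset.sum_eq_zero_iff_of_nonneg fun j _ =>
      mul_nonneg (hw0 j) (sub_nonneg.2 (hlep j))] at h1
    linarith [(mul_eq_zero.1 (h1 i (Finset.mem_univ i))).resolve_left hi]
  have hedge : ∀ i, (∀ j, w j ≠ 0 → j = i ∨ j = i + 1) →
      x ∈ ⋃ i, segment ℝ (p i) (p (i + 1)) := by
    intro i hi
    have hsub : ∀ j ∉ ({i, i + 1} : Finset (ZMod n)), w j = 0 := by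
      intro j hj
      by_contra h
      exact hj (by simpa using hi j h)
    have hii : i ∉ ({i + 1} : Finset (ZMod n)) := by
      simpa using (zmod_add_one_ne hn i).symm
    have s1 := Finset.sum_subset (Finset.subset_univ ({i, i + 1} : Finset (ZMod n)))
      fun j _ hj => hsub j hj
    have s2 := Finset.sum_subset (f := fun j => w j • p j)
      (Finset.subset_univ ({i, i + 1} : Finset (ZMod n)))
      fun j _ hj => by rw [hsub j hj, zero_smul]
    rw [Finset.sum_insert hii, Finset.sum_singleton] at s1 s2
    exact mem_iUnion.2 ⟨i, w i, w (i + 1), hw0 _, hw0 _, s1.trans hw1, s2.trans hwx⟩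
  obtain ⟨i, hi⟩ : ∃ i, w i ≠ 0 := by
    by_contra! h
    simp [h] at hw1
  have hfi := hwface i hi
  by_cases h : f (p (i + 1)) = f x
  · refine hedge i fun j hj => ?_
    rcases hface i j hfi (hwface j hj) with h1 | h1 | h1
    · exact Or.inl h1
    · exact Or.inr h1
    · exact absurd ⟨h, h1 ▸ hwface j hj⟩ (hboth i hfi)
  · refine hedge (i - 1) fun j hj => ?_
    rw [sub_add_cancel]
    rcases hface i j hfi (hwface j hj) with h1 | h1 | h1
    · exact Or.inr h1
    · exact absurd (h1 ▸ hwface j hj) h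
    · exact Or.inl h1

end cycle

lemma exists_sorted_enumeration {X : Type*} {S : Set X} (hS : S.Finite) {key : X → ℝ}
    (hkey : InjOn key S) : ∃ (k : ℕ) (e : Fin k → X), StrictMono (key ∘ e) ∧ range e = S := by
  classical
  let s := hS.toFinset.image key
  let o := s.orderEmbOfFin rfl
  have ho : ∀ i, ∃ x ∈ S, key x = o i := fun i => by
    obtain ⟨x, hx, hxe⟩ := Finset.mem_image.1 (s.orderEmbOfFin_mem rfl i)
    exact ⟨x, hS.mem_toFinset.1 hx, hxe⟩
  choose e he hek using ho
  refine ⟨s.card, e, fun i j hij => ?_, ?_⟩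
  · simp only [Function.comp_apply, hek]
    exact o.strictMono hij
  · refine Subset.antisymm (range_subset_iff.2 he) fun x hx => ?_
    have : key x ∈ range o := by
      rw [Finset.range_orderEmbOfFin]
      simpa [s] using ⟨x, hx, rfl⟩
    obtain ⟨i, hi⟩ := this
    exact ⟨i, hkey (he i) hx ((hek i).trans hi)⟩

lemma plane_functional (f : StrongDual ℝ Plane) (x y : Plane) : f y - f x =
    f (EuclideanSpace.single 0 1) * (y 0 - x 0) + f (EuclideanSpace.single 1 1) * (y 1 - x 1) := by
  have h : y - x = (y 0 - x 0) • EuclideanSpace.single 0 (1 : ℝ) +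
      (y 1 - x 1) • EuclideanSpace.single 1 (1 : ℝ) := by
    ext i
    fin_cases i <;> simp
  rw [← map_sub, h]
  simp only [map_add, map_smul, smul_eq_mul]
  ring

/-- The vertices of a convex polygon with nonempty interior, in counterclockwise order. -/
theorem exists_isConvexCycle {Y : Set Plane} (hY : Y.Finite)
    (hint : (interior (convexHull ℝ Y)).Nonempty) :
    ∃ n, 3 ≤ n ∧ ∃ p : ZMod n → Plane, IsConvexCycle p ∧
      convexHull ℝ (range p) = convexHull ℝ Y := by
  set C := convexHull ℝ Y with hC
  have hCconv : Convex ℝ C := convex_convexHull ℝ Y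
  have hCcomp : IsCompact C := hY.isCompact_convexHull ℝ
  set V := C.extremePoints ℝ with hV
  have hVfin : V.Finite := hY.subset extremePoints_convexHull_subset
  have hVC : convexHull ℝ V = C := by
    rw [← closure_convexHull_extremePoints hCcomp hCconv]
    exact (hVfin.isClosed_convexHull ℝ).closure_eq.symm
  have hindep : ∀ p ∈ V, p ∉ convexHull ℝ (V \ {p}) :=
    (convexIndependent_set_iff_notMem_convexHull_sdiff).1 hCconv.convexIndependent_extremePoints
  have hCne : C.Nonempty := hint.mono interior_subset
  obtain ⟨p₀, hp₀⟩ : V.Nonempty := hCcomp.extremePoints_nonempty hCne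
  -- Separating `p₀` strictly from the other vertices puts them in an open half-plane seen from
  -- `p₀`; there `key` is the tangent of the angle of sight, and sorting by it gives the cyclic
  -- order.
  obtain ⟨f, u, hfu, hfV⟩ := geometric_hahn_banach_point_closed (convex_convexHull ℝ (V \ {p₀}))
    ((hVfin.subset sdiff_subset).isClosed_convexHull ℝ) (hindep p₀ hp₀)
  have hfpos : ∀ q ∈ V \ {p₀}, 0 < f q - f p₀ := fun q hq => by
    linarith [hfV q (subset_convexHull ℝ _ hq)]
  set α := f (EuclideanSpace.single 0 1)
  set β := f (EuclideanSpace.single 1 1)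
  let g : Plane → ℝ := fun q => -β * (q 0 - p₀ 0) + α * (q 1 - p₀ 1)
  let key : Plane → ℝ := fun q => g q / (f q - f p₀)
  have hffun : ∀ q, f q - f p₀ = α * (q 0 - p₀ 0) + β * (q 1 - p₀ 1) := plane_functional f p₀
  have hαβ : ∀ q ∈ V \ {p₀}, 0 < α ^ 2 + β ^ 2 := by
    intro q hq
    have h := hfpos q hq
    rw [hffun] at h
    rcases eq_or_ne α 0 with h1 | h1
    · rcases eq_or_ne β 0 with h2 | h2
      · rw [h1, h2] at h
        simp at h
      · positivity
    · positivity
  have harea : ∀ q r, (α ^ 2 + β ^ 2) * area p₀ q r =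
      g r * (f q - f p₀) - g q * (f r - f p₀) := by
    intro q r
    rw [hffun, hffun]
    simp only [area, g]
    ring
  have hkeylt : ∀ q ∈ V \ {p₀}, ∀ r ∈ V \ {p₀}, key q < key r → 0 < area p₀ q r := by
    intro q hq r hr h
    rw [div_lt_div_iff₀ (hfpos q hq) (hfpos r hr)] at h
    have h2 := harea q r
    refine pos_of_mul_pos_right (a := α ^ 2 + β ^ 2) ?_ (hαβ q hq).le
    linarith
  have hkeyinj : InjOn key (V \ {p₀}) := by
    -- Of two vertices seen from `p₀` in the same direction, the nearer would lie on the segment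
    -- from `p₀` to the farther, so it would not be extreme.
    have main : ∀ q ∈ V \ {p₀}, ∀ r ∈ V \ {p₀}, f q - f p₀ ≤ f r - f p₀ → key q = key r → q = r := by
      intro q hq r hr hle h
      rw [div_eq_div_iff (hfpos q hq).ne' (hfpos r hr).ne'] at h
      by_contra hne
      have hd := hfpos q hq
      have he := hfpos r hr
      refine hindep q hq.1 ?_
      have hp₀q : p₀ ∈ V \ {q} := ⟨hp₀, fun h => hq.2 h.symm⟩
      have hrq : r ∈ V \ {q} := ⟨hr.1, fun h => hne h.symm⟩
      refine (convex_convexHull ℝ _).segment_subset (subset_convexHull ℝ _ hp₀q)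
        (subset_convexHull ℝ _ hrq) ?_
      have hpos := hαβ q hq
      have h0 : (f r - f p₀) * (q 0 - p₀ 0) = (f q - f p₀) * (r 0 - p₀ 0) := by
        refine mul_left_cancel₀ hpos.ne' ?_
        have e1 := hffun q
        have e2 := hffun r
        simp only [g] at h
        linear_combination (-β) * h + (f r - f p₀) * α * (-e1) + (f q - f p₀) * α * e2
      have h1 : (f r - f p₀) * (q 1 - p₀ 1) = (f q - f p₀) * (r 1 - p₀ 1) := by
        refine mul_left_cancel₀ hpos.ne' ?_
        have e1 := hffun q
        have e2 := hffun r
        simp only [g] at h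
        linear_combination α * h + (f r - f p₀) * β * (-e1) + (f q - f p₀) * β * e2
      refine ⟨1 - (f q - f p₀) / (f r - f p₀), (f q - f p₀) / (f r - f p₀), ?_, by positivity,
        by ring, ?_⟩
      · rw [sub_nonneg, div_le_one he]
        exact hle
      · ext i
        fin_cases i
        · simp only [Fin.zero_eta, Fin.isValue, PiLp.add_apply, PiLp.smul_apply, smul_eq_mul]
          field_simp
          linear_combination -h0
        · simp only [Fin.mk_one, Fin.isValue, PiLp.add_apply, PiLp.smul_apply, smul_eq_mul]
          field_simp
          linear_combination -h1
    intro q hq r hr h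
    rcases le_total (f q - f p₀) (f r - f p₀) with h' | h'
    · exact main q hq r hr h' h
    · exact (main r hr q hq h' h.symm).symm
  obtain ⟨k, e, hemono, herange⟩ := exists_sorted_enumeration (hVfin.subset sdiff_subset) hkeyinj
  have heV : ∀ i, e i ∈ V \ {p₀} := fun i => herange ▸ mem_range_self i
  let p : Fin (k + 1) → Plane := Fin.cons p₀ e
  have hp0 : p 0 = p₀ := rfl
  have hps : ∀ i : Fin k, p i.succ = e i := fun i => rfl
  have hprange : range p = V := by
    rw [Fin.range_cons, herange, insert_sdiff_singleton, insert_eq_of_mem hp₀]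
  have hpinj : Function.Injective p := Fin.cons_injective_iff.2
    ⟨fun h => by rw [herange] at h; exact h.2 rfl, fun i j h => hemono.injective (congrArg key h)⟩
  have hpV : ∀ i, p i ∈ V := fun i => hprange ▸ mem_range_self i
  have hzero : ∀ j l : Fin (k + 1), 0 < j → j < l → 0 < area (p 0) (p j) (p l) := by
    intro j l hj hl
    obtain ⟨j, rfl⟩ := Fin.exists_succ_eq.2 hj.ne'
    obtain ⟨l, rfl⟩ := Fin.exists_succ_eq.2 (hj.trans hl).ne'
    exact hkeylt _ (heV j) _ (heV l) (hemono (Fin.succ_lt_succ_iff.1 hl))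
  -- If the orientation were not positive, `p j` would be in the triangle of `p 0`, `p i`, `p l`,
  -- with the ratios of areas as barycentric weights.
  have hchi : ∀ i j l : Fin (k + 1), i < j → j < l → 0 < area (p i) (p j) (p l) := by
    intro i j l hij hjl
    rcases (Fin.zero_le i).eq_or_lt with rfl | hi
    · exact hzero j l hij hjl
    by_contra hcon
    have hneg := not_lt.1 hcon
    have h1 := hzero i j hi hij
    have h2 := hzero j l (hi.trans hij) hjl
    have h3 := hzero i l hi (hij.trans hjl)
    refine hindep (p j) (hpV j) ?_
    have hmem : ∀ a : Fin (k + 1), a ≠ j → p a ∈ convexHull ℝ (V \ {p j}) := fun a ha =>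
      subset_convexHull ℝ _ ⟨hpV a, fun h => ha (hpinj h)⟩
    have hsum : area (p 0) (p i) (p l) =
        -area (p i) (p j) (p l) + area (p 0) (p j) (p l) + area (p 0) (p i) (p j) := by
      unfold area
      ring
    have heq : p j = (-area (p i) (p j) (p l) / area (p 0) (p i) (p l)) • p 0 +
        (area (p 0) (p j) (p l) / area (p 0) (p i) (p l)) • p i +
        (area (p 0) (p i) (p j) / area (p 0) (p i) (p l)) • p l := by
      have hne := h3.ne'
      have hcoord : ∀ t : Fin 2, area (p 0) (p i) (p l) * p j t =
          -area (p i) (p j) (p l) * p 0 t + area (p 0) (p j) (p l) * p i t +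
          area (p 0) (p i) (p j) * p l t := by
        intro t
        fin_cases t <;> simp only [area, Fin.zero_eta, Fin.mk_one, Fin.isValue] <;> ring
      ext t
      have := hcoord t
      simp only [PiLp.add_apply, PiLp.smul_apply, smul_eq_mul]
      field_simp
      linarith
    have := (convex_convexHull ℝ (V \ {p j})).sum_mem (t := Finset.univ)
      (w := ![-area (p i) (p j) (p l) / area (p 0) (p i) (p l),
        area (p 0) (p j) (p l) / area (p 0) (p i) (p l),
        area (p 0) (p i) (p j) / area (p 0) (p i) (p l)]) (z := ![p 0, p i, p l])
      (by
        intro a _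
        fin_cases a
        · exact div_nonneg (neg_nonneg.2 hneg) h3.le
        · exact (div_pos h2 h3).le
        · exact (div_pos h1 h3).le)
      (by
        rw [Fin.sum_univ_three]
        simp only [Matrix.cons_val_zero, Matrix.cons_val_one, Matrix.cons_val]
        rw [← add_div, ← add_div, ← hsum, div_self h3.ne'])
      (by
        intro a _
        fin_cases a
        · exact hmem 0 (hi.trans hij).ne
        · exact hmem i hij.ne
        · exact hmem l hjl.ne')
    rw [Fin.sum_univ_three] at this
    exact Eq.mpr (congrArg (· ∈ convexHull ℝ (V \ {p j})) heq) this
  have hk : 2 ≤ k := by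
    have h1 : affineSpan ℝ (range p) = ⊤ := by
      rw [← affineSpan_convexHull, hprange, hVC]
      exact hCconv.interior_nonempty_iff_affineSpan_eq_top.1 hint
    have h2 := finrank_vectorSpan_range_le ℝ p (Fintype.card_fin (k + 1))
    rw [← direction_affineSpan, h1, AffineSubspace.direction_top, finrank_top,
      finrank_euclideanSpace_fin] at h2
    exact h2
  have hcycle : ∀ i j : Fin (k + 1), j ≠ i → j ≠ i + 1 → 0 < area (p i) (p (i + 1)) (p j) := by
    intro i j hji hji'
    have hval := Fin.val_add_one i
    by_cases hi : i = Fin.last k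
    · rw [if_pos hi] at hval
      have h0 : i + 1 = 0 := Fin.ext hval
      rw [h0] at hji' ⊢
      rw [area_rotate]
      refine hchi 0 j i (Fin.pos_iff_ne_zero.2 hji') ?_
      exact lt_of_le_of_ne (hi ▸ Fin.le_last j) hji
    · rw [if_neg hi] at hval
      have hlt : i < i + 1 := Fin.lt_def.2 (by omega)
      rcases lt_or_gt_of_ne hji with h | h
      · rw [← area_rotate]
        exact hchi j i (i + 1) h hlt
      · refine hchi i (i + 1) j hlt (lt_of_le_of_ne ?_ hji'.symm)
        rw [Fin.le_def, hval]
        exact Fin.lt_def.1 h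
  -- `ZMod (k + 1)` is by definition `Fin (k + 1)`, whose successor is cyclic.
  refine ⟨k + 1, by omega, p, hcycle, ?_⟩
  rw [← hVC, ← hprange]
  rfl

/-! ### Affine charts and the polygonal disc. -/

/-- The affine chart of the projective plane given by an affine plane `w + ker φ` that misses the
origin, with `Λ` a linear parametrization of `ker φ`. -/
def chartVec (w : Vec) (Λ : Plane →L[ℝ] Vec) (s : Plane) : Vec := w + Λ s

lemma exists_chartVec {φ : StrongDual ℝ Vec} {v : Vec} (hv : φ v ≠ 0) :
    ∃ (w : Vec) (Λ : Plane →L[ℝ] Vec), Function.Injective Λ ∧ (∀ s, φ (chartVec w Λ s) = 1) ∧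
      ∀ u, φ u ≠ 0 → ∃ s, chartVec w Λ s = (φ u)⁻¹ • u := by
  have hsurj : Function.Surjective φ.toLinearMap :=
    LinearMap.surjective_of_ne_zero (fun h => hv (congrArg (· v) h))
  have hrank : Module.finrank ℝ Plane = Module.finrank ℝ (LinearMap.ker φ.toLinearMap) := by
    have h := LinearMap.finrank_range_add_finrank_ker φ.toLinearMap
    rw [LinearMap.range_eq_top.2 hsurj, finrank_top, Module.finrank_self, Module.finrank_fin_fun] at h
    rw [finrank_euclideanSpace_fin]
    omega
  let e : Plane ≃L[ℝ] LinearMap.ker φ.toLinearMap := ContinuousLinearEquiv.ofFinrankEq hrank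
  have hker : ∀ s, φ (e s) = 0 := fun s => (e s).2
  refine ⟨(φ v)⁻¹ • v, (LinearMap.ker φ.toLinearMap).subtypeL.comp e.toContinuousLinearMap,
    fun s t h => e.injective (Subtype.ext h), fun s => ?_, fun u hu => ?_⟩
  · change φ ((φ v)⁻¹ • v + e s) = 1
    rw [map_add, hker, map_smul, smul_eq_mul, inv_mul_cancel₀ hv, add_zero]
  · refine ⟨e.symm ⟨(φ u)⁻¹ • u - (φ v)⁻¹ • v, ?_⟩, ?_⟩
    · change φ ((φ u)⁻¹ • u - (φ v)⁻¹ • v) = 0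
      rw [map_sub, map_smul, map_smul, smul_eq_mul, smul_eq_mul, inv_mul_cancel₀ hv,
        inv_mul_cancel₀ hu, sub_self]
    · change (φ v)⁻¹ • v + (e (e.symm _) : Vec) = _
      rw [e.apply_symm_apply]
      exact add_sub_cancel _ _

lemma sum_smul_chartVec {ι : Type*} (t : Finset ι) (w : Vec) (Λ : Plane →L[ℝ] Vec) (c : ι → ℝ)
    (s : ι → Plane) : ∑ i ∈ t, c i • chartVec w Λ (s i) =
      (∑ i ∈ t, c i) • w + Λ (∑ i ∈ t, c i • s i) := by
  simp only [chartVec, smul_add, Finset.sum_add_distrib, ← Finset.sum_smul, map_sum, map_smul]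

/-- Carathéodory's theorem may return fewer than three vectors, whereas a triangle needs three
independent vertices; this completes them within `S`. -/
lemma exists_basis_of_linearIndepOn {S t : Set Vec} (hspan : Submodule.span ℝ S = ⊤) (hts : t ⊆ S)
    (ht : LinearIndepOn ℝ id t) :
    ∃ b : Module.Basis (Fin 3) ℝ Vec, t ⊆ range b ∧ range b ⊆ S := by
  have hli := ht.linearIndepOn_extend hts
  let B := Module.Basis.mk (v := ((↑) : ht.extend hts → Vec)) hli (by
    rw [Subtype.range_coe, ← hspan, Submodule.span_le]
    exact ht.subset_span_extend hts)
  have hrange : range B = ht.extend hts :=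
    (congrArg range (Module.Basis.coe_mk _ _)).trans Subtype.range_coe
  have : Finite (ht.extend hts) := Module.Finite.finite_basis B
  have := Fintype.ofFinite (ht.extend hts)
  have hcard : Fintype.card (ht.extend hts) = 3 := by
    rw [← Module.finrank_eq_card_basis B, Module.finrank_fin_fun]
  refine ⟨B.reindex (Fintype.equivFinOfCardEq hcard), ?_, ?_⟩
  · rw [Module.Basis.range_reindex, hrange]
    exact ht.subset_extend hts
  · rw [Module.Basis.range_reindex, hrange]
    exact ht.extend_subset hts

section chart

variable {φ : StrongDual ℝ Vec} {w : Vec} {Λ : Plane →L[ℝ] Vec}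

lemma chartVec_ne_zero (hφ : ∀ s, φ (chartVec w Λ s) = 1) (s : Plane) : chartVec w Λ s ≠ 0 := by
  intro h
  have := hφ s
  rw [h, map_zero] at this
  exact zero_ne_one this

lemma mk_chartVec_injective (hφ : ∀ s, φ (chartVec w Λ s) = 1) (hΛ : Function.Injective Λ) :
    Function.Injective fun s => Projectivization.mk ℝ _ (chartVec_ne_zero hφ s) := by
  intro s t h
  obtain ⟨c, hc⟩ := (Projectivization.mk_eq_mk_iff' ℝ _ _ _ _).1 h
  have h1 := congrArg φ hc
  rw [map_smul, hφ, hφ, smul_eq_mul, mul_one] at h1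
  rw [h1, one_smul] at hc
  exact (hΛ (add_left_cancel hc)).symm

lemma continuous_mk_chartVec (hφ : ∀ s, φ (chartVec w Λ s) = 1) :
    Continuous fun s => Projectivization.mk ℝ _ (chartVec_ne_zero hφ s) :=
  continuous_mk (continuous_const.add Λ.continuous) _

lemma image_segment_chart (hφ : ∀ s, φ (chartVec w Λ s) = 1) (a b : Plane) :
    (fun s => Projectivization.mk ℝ _ (chartVec_ne_zero hφ s)) '' segment ℝ a b =
      projSegment (chartVec w Λ a) (chartVec w Λ b) := by
  have hcombo : ∀ s t : ℝ, s + t = 1 →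
      chartVec w Λ (s • a + t • b) = s • chartVec w Λ a + t • chartVec w Λ b := by
    intro s t hst
    have : s = 1 - t := by linarith
    subst this
    simp only [chartVec, map_add, map_smul]
    module
  refine Subset.antisymm ?_ ?_
  · rintro _ ⟨_, ⟨s, t, hs, ht, hst, rfl⟩, rfl⟩
    refine ⟨s, t, ?_, hs, ht, ?_⟩
    · rw [← hcombo s t hst]
      exact chartVec_ne_zero hφ _
    · simp only [hcombo s t hst]
  · rintro _ ⟨s, t, h, hs, ht, rfl⟩
    have hpos : 0 < s + t := by
      refine lt_of_le_of_ne (add_nonneg hs ht) fun h0 => h ?_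
      have hs0 : s = 0 := by linarith
      have ht0 : t = 0 := by linarith
      rw [hs0, ht0, zero_smul, zero_smul, add_zero]
    refine ⟨(s / (s + t)) • a + (t / (s + t)) • b, ⟨_, _, by positivity, by positivity, by
      rw [← add_div, div_self hpos.ne'], rfl⟩, ?_⟩
    refine (Projectivization.mk_eq_mk_iff' ℝ _ _ _ _).2 ⟨(s + t)⁻¹, ?_⟩
    rw [hcombo _ _ (by rw [← add_div, div_self hpos.ne']), smul_add, smul_smul, smul_smul]
    simp only [div_eq_inv_mul]

/-- The chart embeds the plane and takes segments to projective segments. A homeomorphism of the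
plane takes the hull to the closed ball and its frontier to the sphere, and the frontier is the
cycle of edges. -/
theorem isPolygonalDisc_image_chart (hφ : ∀ s, φ (chartVec w Λ s) = 1) (hΛ : Function.Injective Λ)
    {Y : Set Plane} (hY : Y.Finite) (hint : (interior (convexHull ℝ Y)).Nonempty) :
    IsPolygonalDisc
      ((fun s => Projectivization.mk ℝ _ (chartVec_ne_zero hφ s)) '' convexHull ℝ Y) := by
  set j : Plane → RP2 := fun s => Projectivization.mk ℝ _ (chartVec_ne_zero hφ s) with hj
  have hjinj : Function.Injective j := mk_chartVec_injective hφ hΛ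
  set C := convexHull ℝ Y
  have hCcomp : IsCompact C := hY.isCompact_convexHull ℝ
  obtain ⟨h, -, hcl, hfr⟩ := exists_homeomorph_image_interior_closure_frontier_eq_unitBall
    (convex_convexHull ℝ Y) hint hCcomp.isBounded
  rw [hCcomp.isClosed.closure_eq] at hcl
  let g : Metric.closedBall (0 : Plane) 1 → RP2 := fun x => j (h.symm x)
  have hg : IsEmbedding g := ((continuous_mk_chartVec hφ).comp
    (h.symm.continuous.comp continuous_subtype_val)).isClosedEmbedding
      (hjinj.comp (h.symm.injective.comp Subtype.val_injective)) |>.isEmbedding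
  have hrange : range g = j '' C := by
    ext p
    constructor
    · rintro ⟨⟨x, hx⟩, rfl⟩
      rw [← hcl] at hx
      obtain ⟨s, hs, rfl⟩ := hx
      exact ⟨s, hs, by simp [g]⟩
    · rintro ⟨s, hs, rfl⟩
      exact ⟨⟨h s, hcl ▸ mem_image_of_mem h hs⟩, by simp [g]⟩
  rw [← hrange]
  refine ⟨hg.toHomeomorph, ?_⟩
  have hboundary : {p | ∃ x : Metric.closedBall (0 : EuclideanSpace ℝ (Fin 2)) 1,
      ‖(x : EuclideanSpace ℝ (Fin 2))‖ = 1 ∧ p = (hg.toHomeomorph x : RP2)} = j '' frontier C := by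
    ext p
    constructor
    · rintro ⟨⟨x, hx⟩, hx1, rfl⟩
      have hx' : x ∈ h '' frontier C := hfr ▸ mem_sphere_zero_iff_norm.2 hx1
      obtain ⟨s, hs, rfl⟩ := hx'
      exact ⟨s, hs, by simp [g]⟩
    · rintro ⟨s, hs, rfl⟩
      have hx1 : h s ∈ Metric.sphere (0 : Plane) 1 := hfr ▸ mem_image_of_mem h hs
      exact ⟨⟨h s, Metric.sphere_subset_closedBall hx1⟩, mem_sphere_zero_iff_norm.1 hx1,
        by simp [g]⟩
  rw [hboundary]
  obtain ⟨n, hn, p, hp, hpC⟩ := exists_isConvexCycle hY hint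
  have : NeZero n := ⟨by omega⟩
  refine ⟨n, fun i => j (p i), fun i => j '' segment ℝ (p i) (p (i + 1)), hn, fun i => ?_,
    fun i => ?_, fun i k h1 h2 h3 => ?_, ?_⟩
  · exact ⟨hjinj.ne (hp.ne_succ hn i), _, _, chartVec_ne_zero hφ _, chartVec_ne_zero hφ _, rfl, rfl,
      image_segment_chart hφ _ _⟩
  · rw [← image_inter hjinj, hp.inter_succ hn, image_singleton]
  · exact (disjoint_image_iff hjinj).2 (hp.disjoint h1 h2 h3)
  · rw [← image_iUnion]
    congr 1
    refine Subset.antisymm ?_ (iUnion_subset fun i => ?_)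
    · rw [show C = convexHull ℝ (range p) from hpC.symm]
      exact hp.frontier_subset hn (by rwa [hpC])
    · exact (hp.segment_subset_frontier hn i).trans_eq (by rw [hpC])

end chart

/-- The triangles spanned by a finite set of points in an affine chart fill a polygonal disc. -/
theorem isPolygonalDisc_iUnion_projTriangle {S : Set Vec} (hS : S.Finite)
    (h0 : (0 : Vec) ∉ convexHull ℝ S) (hspan : Submodule.span ℝ S = ⊤) :
    IsPolygonalDisc {p | ∃ u ∈ S, ∃ v ∈ S, ∃ w ∈ S, LinearIndependent ℝ ![u, v, w] ∧
      p ∈ projTriangle u v w} := by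
  obtain ⟨φ, r, hφr, hφS⟩ := geometric_hahn_banach_point_closed (convex_convexHull ℝ S)
    (hS.isClosed_convexHull ℝ) h0
  rw [map_zero] at hφr
  have hpos : ∀ u ∈ S, 0 < φ u := fun u hu => hφr.trans (hφS u (subset_convexHull ℝ S hu))
  obtain ⟨b₀, -, hb₀⟩ := exists_basis_of_linearIndepOn hspan (empty_subset S)
    (linearIndepOn_empty ℝ id)
  have hb₀S : ∀ i, b₀ i ∈ S := fun i => hb₀ (mem_range_self i)
  obtain ⟨w, Λ, hΛ, hφ, hex⟩ := exists_chartVec (hpos _ (hb₀S 0)).ne'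
  -- The default `0` is harmless, as `φ` is positive on `S`.
  have hex' : ∀ u, ∃ s, φ u ≠ 0 → chartVec w Λ s = (φ u)⁻¹ • u := fun u => by
    by_cases h : φ u = 0
    · exact ⟨0, fun h' => absurd h h'⟩
    · exact (hex u h).imp fun s hs _ => hs
  choose ρ hρ using hex'
  have hρS : ∀ u ∈ S, u = φ u • chartVec w Λ (ρ u) := fun u hu => by
    rw [hρ u (hpos u hu).ne', smul_smul, mul_inv_cancel₀ (hpos u hu).ne', one_smul]
  have hint : (interior (convexHull ℝ (ρ '' S))).Nonempty := by
    rw [interior_convexHull_nonempty_iff_affineSpan_eq_top]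
    have hind : AffineIndependent ℝ (ρ ∘ b₀) := by
      rw [affineIndependent_iff]
      intro t g hg0 hg i hi
      have h1 := sum_smul_chartVec t w Λ g (ρ ∘ b₀)
      rw [hg0, hg, zero_smul, map_zero, add_zero] at h1
      have h2 : ∑ i ∈ t, (g i * (φ (b₀ i))⁻¹) • b₀ i = 0 := by
        rw [← h1]
        refine Finset.sum_congr rfl fun i _ => ?_
        rw [Function.comp_apply, hρ _ (hpos _ (hb₀S i)).ne', smul_smul]
      have h3 := linearIndependent_iff'.1 b₀.linearIndependent t _ h2 i hi
      exact (mul_eq_zero.1 h3).resolve_right (inv_ne_zero (hpos _ (hb₀S i)).ne')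
    have htop : affineSpan ℝ (range (ρ ∘ b₀)) = ⊤ := by
      rw [hind.affineSpan_eq_top_iff_card_eq_finrank_add_one, finrank_euclideanSpace_fin,
        Fintype.card_fin]
    rw [eq_top_iff, ← htop]
    refine affineSpan_mono ℝ ?_
    rintro _ ⟨i, rfl⟩
    exact mem_image_of_mem ρ (hb₀S i)
  convert isPolygonalDisc_image_chart hφ hΛ (hS.image ρ) hint using 1
  refine Subset.antisymm ?_ ?_
  · rintro _ ⟨u, hu, v, hv, x, hx, -, a, b, c, h, ha, hb, hc, rfl⟩
    have hu0 := hpos u hu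
    have hv0 := hpos v hv
    have hx0 := hpos x hx
    -- `T` is the value of `φ` at the combination; dividing by it brings the vector to the plane `φ
    -- = 1`.
    set T := a * φ u + b * φ v + c * φ x with hT
    have hT0 : 0 < T := by
      refine lt_of_le_of_ne (by positivity) fun hT0 => h ?_
      have h1 : 0 ≤ a * φ u := by positivity
      have h2 : 0 ≤ b * φ v := by positivity
      have h3 : 0 ≤ c * φ x := by positivity
      have ha0 : a = 0 := (mul_eq_zero.1 (by linarith : a * φ u = 0)).resolve_right hu0.ne'
      have hb0 : b = 0 := (mul_eq_zero.1 (by linarith : b * φ v = 0)).resolve_right hv0.ne'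
      have hc0 : c = 0 := (mul_eq_zero.1 (by linarith : c * φ x = 0)).resolve_right hx0.ne'
      simp [ha0, hb0, hc0]
    let wt : Fin 3 → ℝ := ![a * φ u / T, b * φ v / T, c * φ x / T]
    let pt : Fin 3 → Plane := ![ρ u, ρ v, ρ x]
    have hwt1 : ∑ i, wt i = 1 := by
      rw [Fin.sum_univ_three]
      simp only [wt, Matrix.cons_val_zero, Matrix.cons_val_one, Matrix.cons_val]
      rw [← add_div, ← add_div, div_self hT0.ne']
    refine ⟨∑ i, wt i • pt i, (convex_convexHull ℝ _).sum_mem (fun i _ => ?_) hwt1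
      (fun i _ => subset_convexHull ℝ _ ?_), ?_⟩
    · fin_cases i
      · exact div_nonneg (mul_nonneg ha hu0.le) hT0.le
      · exact div_nonneg (mul_nonneg hb hv0.le) hT0.le
      · exact div_nonneg (mul_nonneg hc hx0.le) hT0.le
    · fin_cases i
      · exact mem_image_of_mem ρ hu
      · exact mem_image_of_mem ρ hv
      · exact mem_image_of_mem ρ hx
    · refine (Projectivization.mk_eq_mk_iff' ℝ _ _ _ _).2 ⟨T⁻¹, ?_⟩
      have h1 := sum_smul_chartVec Finset.univ w Λ wt pt
      rw [hwt1, one_smul] at h1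
      change _ = w + Λ _
      rw [← h1, Fin.sum_univ_three]
      simp only [wt, pt, Matrix.cons_val_zero, Matrix.cons_val_one, Matrix.cons_val]
      conv_lhs => rw [hρS u hu, hρS v hv, hρS x hx]
      simp only [smul_add, smul_smul, div_eq_inv_mul]
  · rintro _ ⟨s, hs, rfl⟩
    -- Affinely independent points of the chart lift to linearly independent vectors of `S`. In a
    -- basis from `S` extending these, the coordinates of the point are the Carathéodory weights up
    -- to positive factors, and zero elsewhere.
    obtain ⟨ι, _, z, c, hz, haff, hc, hc1, hcs⟩ := eq_pos_convex_span_of_mem_convexHull hs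
    have hz' : ∀ i, ∃ u ∈ S, ρ u = z i := fun i => hz (mem_range_self i)
    choose u huS huz using hz'
    have hli : LinearIndependent ℝ u := by
      rw [linearIndependent_iff']
      intro t g hg i hi
      have h1 := sum_smul_chartVec t w Λ (fun i => g i * φ (u i)) z
      have h2 : ∑ i ∈ t, (g i * φ (u i)) • chartVec w Λ (z i) = 0 := by
        rw [← hg]
        refine Finset.sum_congr rfl fun i _ => ?_
        rw [mul_smul, ← huz, ← hρS _ (huS i)]
      have h3 : ∑ i ∈ t, g i * φ (u i) = 0 := by
        have := congrArg φ hg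
        simpa only [map_sum, map_smul, smul_eq_mul, map_zero] using this
      rw [h2, h3, zero_smul, zero_add] at h1
      have h4 : ∑ i ∈ t, (g i * φ (u i)) • z i = 0 := hΛ (by rw [← h1, map_zero])
      have h5 := affineIndependent_iff.1 haff t _ h3 h4 i hi
      exact (mul_eq_zero.1 h5).resolve_right (hpos _ (huS i)).ne'
    obtain ⟨b, hub, hbS⟩ := exists_basis_of_linearIndepOn hspan (range_subset_iff.2 huS)
      hli.linearIndepOn_id
    have hbS' : ∀ i, b i ∈ S := fun i => hbS (mem_range_self i)
    have hcoord : ∀ k, 0 ≤ b.repr (chartVec w Λ s) k := by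
      intro k
      have h1 := sum_smul_chartVec Finset.univ w Λ c z
      rw [hc1, one_smul, hcs] at h1
      rw [show chartVec w Λ s = w + Λ s from rfl, ← h1, map_sum, Finsupp.finsetSum_apply]
      refine Finset.sum_nonneg fun i _ => ?_
      rw [← huz, hρ _ (hpos _ (huS i)).ne']
      obtain ⟨l, hl⟩ := hub (mem_range_self i)
      rw [← hl, map_smul, map_smul, Module.Basis.repr_self, Finsupp.smul_apply, Finsupp.smul_apply,
        Finsupp.single_apply, smul_eq_mul, smul_eq_mul]
      have := hpos _ (hbS' l)
      have := hc i
      split_ifs <;> positivity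
    have hrepr := b.sum_repr (chartVec w Λ s)
    rw [Fin.sum_univ_three] at hrepr
    refine ⟨b 0, hbS' 0, b 1, hbS' 1, b 2, hbS' 2, ?_, _, _, _, ?_, hcoord 0, hcoord 1, hcoord 2,
      ?_⟩
    · convert b.linearIndependent
      ext i
      fin_cases i <;> rfl
    · rw [hrepr]
      exact chartVec_ne_zero hφ s
    · simp only [hrepr]

/-! ### The degree bound and the conclusion. -/

lemma natDegree_restrictToLine_le (hF : F.IsHomogeneous m) (u v : Vec) :
    (restrictToLine F u v).natDegree ≤ m := by
  have h := MvPolynomial.aeval_natDegree_le (m := m) (n := 1) F (hF.totalDegree_le)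
    (fun i => (1 - Polynomial.X) * Polynomial.C (u i) + Polynomial.X * Polynomial.C (v i))
    (fun i => by compute_degree)
  rwa [mul_one] at h

/-- The parametrization by `t` misses only the point `[u - v]`, whence the `+ 1`. This crude bound
suffices, as it is at most 12 for `m ≤ 11`. -/
lemma encard_realPart_inter_projLine_le (hF : IsNonsingularCurve m F) {u v : Vec}
    (huv : LinearIndependent ℝ ![u, v]) (hu : MvPolynomial.eval u F ≠ 0) :
    (realPart F ∩ projLine (Submodule.span ℝ {u, v})).encard ≤ m + 1 := by
  classical
  have hne : u - v ≠ 0 := fun h => by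
    have := (LinearIndependent.pair_iff.1 huv 1 (-1) (by rw [← h]; module)).1
    norm_num at this
  set f := restrictToLine F u v
  have hf : f ≠ 0 := fun h => hu (by
    have := eval_restrictToLine (F := F) u v 0
    rw [show restrictToLine F u v = 0 from h] at this
    simpa using this.symm)
  let j : ℝ → RP2 := fun t => Projectivization.mk ℝ _ (lineMap_ne_zero huv t)
  have hsub : realPart F ∩ projLine (Submodule.span ℝ {u, v}) ⊆
      insert (Projectivization.mk ℝ _ hne) (j '' (f.roots.toFinset : Set ℝ)) := by
    rintro p ⟨hp, hpl⟩
    induction p using Projectivization.ind with | h z hz => ?_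
    obtain ⟨a, b, rfl⟩ := Submodule.mem_span_pair.1 ((mk_mem_projLine hz).1 hpl)
    have hzF := (mk_mem_realPart hF hz).1 hp
    by_cases hab : a + b = 0
    · left
      refine (Projectivization.mk_eq_mk_iff' ℝ _ _ _ _).2 ⟨a, ?_⟩
      have hb : b = -a := by linarith
      rw [hb]
      module
    · right
      have h1 : (1 - b / (a + b)) • u + (b / (a + b)) • v = (a + b)⁻¹ • (a • u + b • v) := by
        rw [smul_add, smul_smul, smul_smul]
        congr 2 <;> field_simp
        ring
      refine ⟨b / (a + b), ?_, ?_⟩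
      · rw [Finset.mem_coe, Multiset.mem_toFinset, Polynomial.mem_roots hf, Polynomial.IsRoot.def,
          eval_restrictToLine, h1, hF.eval_smul, hzF, mul_zero]
      · exact (Projectivization.mk_eq_mk_iff' ℝ _ _ _ _).2 ⟨(a + b)⁻¹, h1.symm⟩
  refine (encard_le_encard hsub).trans ((encard_insert_le _ _).trans ?_)
  gcongr
  refine (encard_image_le _ _).trans ?_
  rw [encard_coe_eq_coe_finsetCard]
  exact_mod_cast (Multiset.toFinset_card_le _).trans
    ((Polynomial.card_roots' f).trans (natDegree_restrictToLine_le hF.homogeneous u v))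

/-- With the vertices lifted to vectors of sign `1`, the principal triangles are the triangles
spanned by these vectors. -/
theorem triangleUnion_eq (hF : IsNonsingularCurve m F) {σ : Vec → SignType}
    (hσ : IsFlip (fun v => MvPolynomial.eval v F) (cone (pseudoLine F)) {v | v ≠ 0} σ)
    (hodd : ∀ v ≠ 0, σ (-v) = -σ v) {O : Set RP2} {X : Set RP2 → RP2} {x : Set RP2 → Vec}
    (hx0 : ∀ K ∈ interiorOvals F O, x K ≠ 0)
    (hxX : ∀ K, ∀ hK : K ∈ interiorOvals F O, X K = Projectivization.mk ℝ (x K) (hx0 K hK))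
    (hxF : ∀ K ∈ interiorOvals F O, MvPolynomial.eval (x K) F ≠ 0)
    (hx1 : ∀ K ∈ interiorOvals F O, σ (x K) = 1) :
    triangleUnion F O X = {p | ∃ u ∈ x '' interiorOvals F O, ∃ v ∈ x '' interiorOvals F O,
      ∃ w ∈ x '' interiorOvals F O, LinearIndependent ℝ ![u, v, w] ∧ p ∈ projTriangle u v w} := by
  have hpairs : ∀ u v w : Vec, LinearIndependent ℝ ![u, v, w] → LinearIndependent ℝ ![u, v] ∧
      LinearIndependent ℝ ![u, w] ∧ LinearIndependent ℝ ![v, w] := by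
    intro u v w h
    have h' := Fintype.linearIndependent_iff.1 h
    simp only [LinearIndependent.pair_iff]
    refine ⟨fun s t hst => ?_, fun s t hst => ?_, fun s t hst => ?_⟩
    · have := h' ![s, t, 0] (by simpa [Fin.sum_univ_three] using hst)
      exact ⟨this 0, this 1⟩
    · have := h' ![s, 0, t] (by simpa [Fin.sum_univ_three] using hst)
      exact ⟨this 0, this 2⟩
    · have := h' ![0, s, t] (by simpa [Fin.sum_univ_three] using hst)
      exact ⟨this 1, this 2⟩
  have hlift : ∀ K, ∀ hK : K ∈ interiorOvals F O, ∀ u : Vec, ∀ hu : u ≠ 0,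
      X K = Projectivization.mk ℝ u hu → ∃ r : ℝ, r ≠ 0 ∧ u = r • x K ∧
        MvPolynomial.eval u F ≠ 0 ∧ σ u = SignType.sign r := by
    intro K hK u hu h
    rw [hxX K hK] at h
    obtain ⟨r, hr⟩ := (Projectivization.mk_eq_mk_iff' ℝ _ _ _ _).1 h.symm
    have hr0 : r ≠ 0 := fun h0 => hu (by rw [← hr, h0, zero_smul])
    refine ⟨r, hr0, hr.symm, ?_, ?_⟩
    · rw [← hr, hF.eval_smul]
      exact mul_ne_zero (pow_ne_zero _ hr0) (hxF K hK)
    · rw [← hr]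
      rcases lt_or_gt_of_ne hr0 with hneg | hpos
      · rw [show r • x K = -((-r) • x K) by module,
          hodd _ (smul_ne_zero (neg_ne_zero.2 hr0) (hx0 K hK)),
          hσ.smul hF (hx0 K hK) (neg_pos.2 hneg), hx1 K hK, sign_neg hneg]
      · rw [hσ.smul hF (hx0 K hK) hpos, hx1 K hK, sign_pos hpos]
  ext p
  constructor
  · rintro ⟨K, hK, L, hL, M, hM, T, ⟨u, v, w, hu, hv, hw, hKu, hLv, hMw, hli, huv, huw, hvw, rfl⟩,
      a, b, c, h, ha, hb, hc, rfl⟩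
    obtain ⟨r, hr0, hru, huF, hur⟩ := hlift K hK u hu hKu
    obtain ⟨s, hs0, hsv, hvF, hvs⟩ := hlift L hL v hv hLv
    obtain ⟨t, ht0, htw, hwF, hwt⟩ := hlift M hM w hw hMw
    obtain ⟨h1, h2, h3⟩ := hpairs u v w hli
    rw [isPrincipal_iff hF hσ h1 huF hvF, hur, hvs] at huv
    rw [isPrincipal_iff hF hσ h2 huF hwF, hur, hwt] at huw
    refine ⟨_, mem_image_of_mem x hK, _, mem_image_of_mem x hL, _, mem_image_of_mem x hM, ?_, ?_⟩
    · rw [Fintype.linearIndependent_iff] at hli ⊢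
      intro g hg
      have := hli ![g 0 * r⁻¹, g 1 * s⁻¹, g 2 * t⁻¹] (by
        rw [Fin.sum_univ_three] at hg ⊢
        simpa [hru, hsv, htw, smul_smul, hr0, hs0, ht0] using hg)
      intro i
      fin_cases i
      · exact (mul_eq_zero.1 (this 0)).resolve_right (inv_ne_zero hr0)
      · exact (mul_eq_zero.1 (this 1)).resolve_right (inv_ne_zero hs0)
      · exact (mul_eq_zero.1 (this 2)).resolve_right (inv_ne_zero ht0)
    -- Principality gives `r`, `s`, `t` the same sign. It factors out and disappears projectively,
    -- while the absolute values go into the coefficients.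
    · have habs : ∀ q : ℝ, SignType.sign r = SignType.sign q →
          q = (SignType.sign r : ℝ) * |q| := fun q hq => by rw [hq, sign_mul_abs]
      have hsign : (SignType.sign r : ℝ) ≠ 0 := by
        rcases lt_or_gt_of_ne hr0 with h | h <;> simp [h]
      have hcombo : a • u + b • v + c • w = (SignType.sign r : ℝ) •
          ((a * |r|) • x K + (b * |s|) • x L + (c * |t|) • x M) := by
        conv_lhs => rw [hru, hsv, htw, habs r rfl, habs s huv, habs t huw]
        module
      have hne : (a * |r|) • x K + (b * |s|) • x L + (c * |t|) • x M ≠ 0 := fun h0 =>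
        h (by rw [hcombo, h0, smul_zero])
      exact ⟨_, _, _, hne, by positivity, by positivity, by positivity,
        (Projectivization.mk_eq_mk_iff' ℝ _ _ _ _).2 ⟨_, hcombo.symm⟩⟩
  · rintro ⟨_, ⟨K, hK, rfl⟩, _, ⟨L, hL, rfl⟩, _, ⟨M, hM, rfl⟩, hli, hp⟩
    obtain ⟨h1, h2, h3⟩ := hpairs _ _ _ hli
    refine ⟨K, hK, L, hL, M, hM, _, ⟨x K, x L, x M, hx0 K hK, hx0 L hL, hx0 M hM, hxX K hK, hxX L hL,
      hxX M hM, hli, ?_, ?_, ?_, rfl⟩, hp⟩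
    · rw [isPrincipal_iff hF hσ h1 (hxF K hK) (hxF L hL), hx1 K hK, hx1 L hL]
    · rw [isPrincipal_iff hF hσ h2 (hxF K hK) (hxF M hM), hx1 K hK, hx1 M hM]
    · rw [isPrincipal_iff hF hσ h3 (hxF L hL) (hxF M hM), hx1 L hL, hx1 M hM]

/-- A proper subspace lies in the kernel of a nonzero form, which is a plane; so non-collinear
points have spanning representatives. -/
lemma span_eq_top_of_forall_finrank {S : Set Vec}
    (h : ∀ l : Submodule ℝ Vec, Module.finrank ℝ l = 2 → ¬ S ⊆ l) : Submodule.span ℝ S = ⊤ := by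
  by_contra hne
  have hlt : Module.finrank ℝ (Submodule.span ℝ S) < 3 := by
    have := Submodule.finrank_lt hne
    rwa [Module.finrank_fin_fun] at this
  obtain ⟨f, hf0, hf⟩ := Submodule.exists_le_ker_of_lt_top _ (lt_top_iff_ne_top.2 hne)
  refine h (LinearMap.ker f) ?_ fun v hv => hf (Submodule.subset_span hv)
  have hr := LinearMap.finrank_range_add_finrank_ker f
  rw [LinearMap.range_eq_top.2 (LinearMap.surjective_of_ne_zero hf0), finrank_top,
    Module.finrank_self, Module.finrank_fin_fun] at hr
  omega

/-- The dichotomy is whether the origin lies in the convex hull of the representatives. The upper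
bound is kept beside the lower one, since their comparison settles low degrees. -/
theorem hasConvexHull_or_exists_line (hm : Odd m) (hF : IsNonsingularCurve m F)
    {O : Set RP2} (hO : IsNonemptyOval F O) (hO_unique : ∀ K, IsNonemptyOval F K → K = O)
    {X : Set RP2 → RP2} (hX : ∀ K ∈ interiorOvals F O, X K ∈ ovalInterior K)
    (hX_line : ∀ l : Submodule ℝ Vec, Module.finrank ℝ l = 2 →
      ∃ K ∈ interiorOvals F O, X K ∉ projLine l) :
    HasConvexHull F O X ∨ ∃ l : Submodule ℝ Vec, Module.finrank ℝ l = 2 ∧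
      (∃ K ∈ interiorOvals F O, ∃ L ∈ interiorOvals F O,
        K ≠ L ∧ X K ∈ projLine l ∧ X L ∈ projLine l) ∧
      13 ≤ (realPart F ∩ projLine l).encard ∧ (realPart F ∩ projLine l).encard ≤ m + 1 := by
  obtain ⟨σ, hσ, hodd⟩ := exists_odd_isFlip hF hm
  obtain ⟨D, hDo, hDc, hDO, hDJ, hD, hDI⟩ := exists_disc hO_unique hF hm hO
  have hlift : ∀ K, ∃ v : Vec, K ∈ interiorOvals F O →
      ∃ hv : v ≠ 0, X K = Projectivization.mk ℝ v hv ∧ σ v = 1 := by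
    intro K
    by_cases hK : K ∈ interiorOvals F O
    · obtain ⟨v, hv, hXv⟩ : ∃ v, ∃ hv : v ≠ 0, X K = Projectivization.mk ℝ v hv :=
        ⟨(X K).rep, (X K).rep_nonzero, (X K).mk_rep.symm⟩
      have hJ : v ∉ cone (pseudoLine F) := fun h =>
        notMem_realPart_of_mem_ovalInterior hO_unique hK (hX K hK) (hXv ▸ pseudoLine_subset h.2)
      have h0 := (hσ.eq_zero_iff hF hv).not.2 hJ
      -- The constructors come in the order zero, negative, positive: the first is excluded off the
      -- pseudo-line, the second is mended by passing to `-v`.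
      rcases hs : σ v with _ | _ | _
      · exact absurd hs h0
      · exact ⟨-v, fun _ => ⟨neg_ne_zero.2 hv, by rw [hXv, mk_neg], by rw [hodd v hv, hs]; rfl⟩⟩
      · exact ⟨v, fun _ => ⟨hv, hXv, hs⟩⟩
    · exact ⟨0, fun h => absurd h hK⟩
  choose x hx using hlift
  have hx0 : ∀ K ∈ interiorOvals F O, x K ≠ 0 := fun K hK => (hx K hK).1
  have hxX : ∀ K, ∀ hK : K ∈ interiorOvals F O, X K = Projectivization.mk ℝ (x K) (hx0 K hK) :=
    fun K hK => (hx K hK).2.1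
  have hx1 : ∀ K ∈ interiorOvals F O, σ (x K) = 1 := fun K hK => (hx K hK).2.2
  have hxF : ∀ K ∈ interiorOvals F O, MvPolynomial.eval (x K) F ≠ 0 := fun K hK h =>
    notMem_realPart_of_mem_ovalInterior hO_unique hK (hX K hK)
      (hxX K hK ▸ (mk_mem_realPart hF (hx0 K hK)).2 h)
  by_cases h0 : (0 : Vec) ∈ convexHull ℝ (x '' interiorOvals F O)
  · right
    obtain ⟨K, hK, L, hL, hKL, hli, h13⟩ := exists_line_of_zero_mem_convexHull hF hσ hodd hO
      hO_unique hDo hDc hDO hDJ hD hDI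
      (fun K hK => ⟨hx0 K hK, hxX K hK ▸ hX K hK⟩) hx1 h0
    refine ⟨_, finrank_span_pair hli, ⟨K, hK, L, hL, hKL, ?_, ?_⟩, h13,
      encard_realPart_inter_projLine_le hF hli (hxF K hK)⟩
    · rw [hxX K hK, mk_mem_projLine]
      exact Submodule.subset_span (mem_insert _ _)
    · rw [hxX L hL, mk_mem_projLine]
      exact Submodule.subset_span (mem_insert_of_mem _ rfl)
  · left
    have hfin : (interiorOvals F O).Finite := (finite_components hF).subset fun K hK => hK.1.1
    rw [HasConvexHull, triangleUnion_eq hF hσ hodd hx0 hxX hxF hx1]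
    refine isPolygonalDisc_iUnion_projTriangle (hfin.image x) h0
      (span_eq_top_of_forall_finrank fun l hl hsub => ?_)
    obtain ⟨K, hK, hKl⟩ := hX_line l hl
    rw [hxX K hK, mk_mem_projLine] at hKl
    exact hKl (hsub (mem_image_of_mem x hK))

end RealCurve

end

theorem lemma1 (m : ℕ) (hm : Odd m) (F : MvPolynomial (Fin 3) ℝ)
    (hF : RealCurve.IsNonsingularCurve m F)
    (O : Set RealCurve.RP2) (hO : RealCurve.IsNonemptyOval F O)
    (hO_unique : ∀ K, RealCurve.IsNonemptyOval F K → K = O)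
    (X : Set RealCurve.RP2 → RealCurve.RP2)
    (hX : ∀ K ∈ RealCurve.interiorOvals F O, X K ∈ RealCurve.ovalInterior K)
    (hX_line : ∀ l : Submodule ℝ (Fin 3 → ℝ), Module.finrank ℝ l = 2 →
      ∃ K ∈ RealCurve.interiorOvals F O, X K ∉ RealCurve.projLine l) :
    (m ≤ 11 → RealCurve.HasConvexHull F O X) ∧
    (¬ RealCurve.HasConvexHull F O X →
      ∃ l : Submodule ℝ (Fin 3 → ℝ), Module.finrank ℝ l = 2 ∧
        (∃ K ∈ RealCurve.interiorOvals F O, ∃ L ∈ RealCurve.interiorOvals F O,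
          K ≠ L ∧ X K ∈ RealCurve.projLine l ∧ X L ∈ RealCurve.projLine l) ∧
        13 ≤ (RealCurve.realPart F ∩ RealCurve.projLine l).encard) := by
  rcases RealCurve.hasConvexHull_or_exists_line hm hF hO hO_unique hX hX_line with
    h | ⟨l, hl, hKL, h13, hle⟩
  · exact ⟨fun _ => h, fun h' => absurd h h'⟩
  · refine ⟨fun hm11 => ?_, fun _ => ⟨l, hl, hKL, h13⟩⟩
    have h : ((13 : ℕ) : ℕ∞) ≤ ((m + 1 : ℕ) : ℕ∞) := by
      push_cast
      exact h13.trans hle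
    have := Nat.cast_le.1 h
    omega
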